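/- A Lattès map is a rational map $f\colon\widehat{\mathbb C}\to\widehat{\mathbb C}$ of the Riemann sphere whose local degree at every critical point is $2$ and which has exactly four postcritical points (points $f^n(c)$ with $c$ critical and $n\ge 1$), none of which is critical. A finite subdivision rule with underlying space $X$ consists of: a finite CW complex structure $S$ of dimension at most $2$ on $X$ (the subdivision complex) which is the union of its closed 2-cells, and such that every 2-cell has a characteristic map defined on a closed disk with a cell structure that has at least three vertices and all its vertices and edges on the boundary circle, this map taking each open cell of the disk homeomorphically onto an open cell of $S$; a finite CW complex structure $S'$ of dimension at most $2$ on $X$ which subdivides $S$ (each open cell of $S'$ lies in an open cell of $S$); and a continuous map $\sigma\colon X\to X$ (the subdivision map) which takes each open cell of $S'$ homeomorphically onto an open cell of $S$ of the same dimension. It has one tile type if $S$ has exactly one 2-cell. The valence of a vertex of $S$ is the number of edge ends at it. **Lemma (Pruning Lemma).** Let $f$ be a Lattès map. 1. If $f$ is the subdivision map of a finite subdivision rule with underlying space $\widehat{\mathbb C}$ and one tile type, then $f$ is the subdivision map of a finite subdivision rule with underlying space $\widehat{\mathbb C}$ and one tile type such that every vertex of its subdivision complex with valence $1$ or $2$ is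 a postcritical point of $f$. 2. For every finite subdivision rule with underlying space $\widehat{\mathbb C}$, one tile type and subdivision map $f$ such that every vertex of valence $1$ or $2$ of its subdivision complex is postcritical, the four postcritical points are vertices, and the 1-skeleton of the subdivision complex, as a graph with the postcritical vertices marked, is isomorphic to one of the following five trees: (a) a path with four vertices, all marked; (b) a star with three edges, all four vertices marked; (c) a star with four edges whose four leaves are marked and whose center is not; (d) the tree with one unmarked vertex, of valence $3$, from which two legs consist of one edge ending in a marked vertex and the third leg consists of two edges with marked middle vertex and marked end vertex; (e) the tree with two unmarked vertices of valence $3$ joined by an edge, each of them joined to two further vertices, these four leaves being marked. -/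

import Mathlib

noncomputable section

open Set

namespace Lattes

/-! ## Rational maps of the Riemann sphere `OnePoint ℂ` and Lattès maps -/

/-- A rational map of the Riemann sphere: a continuous self-map which is given on `ℂ` by a quotient
`p / q` of coprime polynomials (with value `∞` at the zeros of `q`). The value at `∞` is determined
by continuity. -/
def IsRationalMap (f : OnePoint ℂ → OnePoint ℂ) : Prop :=
  Continuous f ∧ ∃ p q : Polynomial ℂ, IsCoprime p q ∧
    (∀ z : ℂ, q.eval z = 0 → f (z : OnePoint ℂ) = OnePoint.infty) ∧
    (∀ z : ℂ, q.eval z ≠ 0 → f (z : OnePoint ℂ) = ((p.eval z / q.eval z : ℂ) : OnePoint ℂ))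

/-- The standard holomorphic local parametrization of the Riemann sphere centred at `x`:
`t ↦ a + t` at a finite point `a`, and `t ↦ 1 / t` (with `0 ↦ ∞`) at `∞`. -/
def localParam (x : OnePoint ℂ) (t : ℂ) : OnePoint ℂ :=
  x.elim (if t = 0 then OnePoint.infty else ((t⁻¹ : ℂ) : OnePoint ℂ))
    (fun a => ((a + t : ℂ) : OnePoint ℂ))

/-- The standard holomorphic local coordinate of the Riemann sphere vanishing at `y`:
`w ↦ w - b` at a finite point `b`, and `w ↦ 1 / w` (with `∞ ↦ 0`) at `∞`. For finite `b`, the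
value at `w = ∞`, which lies outside the chart, is immaterial. -/
def localCoord (y w : OnePoint ℂ) : ℂ :=
  y.elim (w.elim 0 (fun c => c⁻¹)) (fun b => w.elim 0 (fun c => c - b))

/-- The local degree of a holomorphic map `f` of the Riemann sphere at `x`: the order of vanishing
at `0` of `f` read in local coordinates centred at `x` and `f x`. It is `⊤` if `f` is constant. -/
def localDegree (f : OnePoint ℂ → OnePoint ℂ) (x : OnePoint ℂ) : ℕ∞ :=
  analyticOrderAt (fun t : ℂ => localCoord (f x) (f (localParam x t))) 0

/-- Critical points: the points at which the local degree is not `1`. -/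
def IsCriticalPoint (f : OnePoint ℂ → OnePoint ℂ) (x : OnePoint ℂ) : Prop :=
  localDegree f x ≠ 1

/-- The postcritical set: all points `fⁿ(c)` with `c` critical and `n ≥ 1`. -/
def postcriticalSet (f : OnePoint ℂ → OnePoint ℂ) : Set (OnePoint ℂ) :=
  {y | ∃ c, IsCriticalPoint f c ∧ ∃ n : ℕ, 1 ≤ n ∧ f^[n] c = y}

/-- A Lattès map: a rational map whose local degree at every critical point is `2`, with exactly
four postcritical points, none of which is also critical. -/
structure IsLattesMap (f : OnePoint ℂ → OnePoint ℂ) : Prop where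
  isRationalMap : IsRationalMap f
  localDegree_eq_two : ∀ x, IsCriticalPoint f x → localDegree f x = 2
  ncard_postcriticalSet : (postcriticalSet f).ncard = 4
  not_isCriticalPoint : ∀ x ∈ postcriticalSet f, ¬ IsCriticalPoint f x

/-! ## Finite subdivision rules -/

section Complexes

variable {X : Type*} [TopologicalSpace X]

/-- `f` restricts to a homeomorphism from `A` onto `B`. -/
def MapsHomeomorphicallyOnto {Y Z : Type*} [TopologicalSpace Y] [TopologicalSpace Z]
    (f : Y → Z) (A : Set Y) (B : Set Z) : Prop :=
  Topology.IsEmbedding (A.domRestrict f) ∧ f '' A = B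

/-- The `n`-cells of a CW structure `K` on the space `X`. -/
abbrev Cell (K : Topology.CWComplex (univ : Set X)) (n : ℕ) : Type _ :=
  letI := K
  Topology.RelCWComplex.cell (univ : Set X) n

/-- The open cell, as a subset of `X`, of a cell of a CW structure `K` on `X`. -/
abbrev openCell (K : Topology.CWComplex (univ : Set X)) (n : ℕ) (c : Cell K n) : Set X :=
  letI := K
  Topology.RelCWComplex.openCell (C := (univ : Set X)) n c

/-- The closed cell, as a subset of `X`, of a cell of a CW structure `K` on `X`. -/
abbrev closedCell (K : Topology.CWComplex (univ : Set X)) (n : ℕ) (c : Cell K n) : Set X :=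
  letI := K
  Topology.RelCWComplex.closedCell (C := (univ : Set X)) n c

/-- The point of `X` which constitutes the vertex (`0`-cell) `v`. -/
abbrev vertexPoint (K : Topology.CWComplex (univ : Set X)) (v : Cell K 0) : X :=
  letI := K
  Topology.RelCWComplex.map (C := (univ : Set X)) 0 v ![]

/-- The 1-skeleton of a CW structure on `X`, as a multigraph (loops and multiple edges allowed). -/
abbrev oneSkeleton (K : Topology.CWComplex (univ : Set X)) : Graph (Cell K 0) (Cell K 1) :=
  letI := K
  Topology.CWComplex.OneSkeletonGraph (univ : Set X)

/-- The valence of a vertex: the number of edge ends at the vertex, so that loops count twice. -/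
def valence (K : Topology.CWComplex (univ : Set X)) (v : Cell K 0) : ℕ :=
  {e | (oneSkeleton K).Inc e v}.ncard + {e | (oneSkeleton K).IsLoopAt e v}.ncard

/-- A CW structure is finite and has dimension at most two. -/
def IsFiniteTwoDimensional (K : Topology.CWComplex (univ : Set X)) : Prop :=
  (∀ n, Finite (Cell K n)) ∧ ∀ n, 2 < n → IsEmpty (Cell K n)

/-- The vertex `exp (2 π i k / n)` of the closed unit disk, viewed as an `n`-gon. -/
def polygonVertex (n k : ℕ) : ℂ :=
  Complex.exp (2 * Real.pi * Complex.I * ((k : ℂ) / n))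

/-- The open edge of the closed unit disk, viewed as an `n`-gon, from the `k`-th to the next
vertex: an open arc of the unit circle. -/
def polygonEdge (n k : ℕ) : Set ℂ :=
  (fun t : ℝ => Complex.exp (2 * Real.pi * Complex.I * (((k : ℂ) + t) / n))) '' Ioo 0 1

/-- The 2-cell `c` has a tile type: a CW structure `s` on a closed disk with `n ≥ 3` vertices, all
of whose vertices and edges lie in the boundary circle, together with a characteristic map
`ψ : s → X` of the 2-cell `c` which maps each open cell of `s` homeomorphically onto an open cell.
Up to homeomorphism of the disk, `s` is the closed unit disk with vertices at the `n`-th roots of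
unity. -/
def HasTileType (K : Topology.CWComplex (univ : Set X)) (c : Cell K 2) : Prop :=
  ∃ n : ℕ, 3 ≤ n ∧ ∃ ψ : ℂ → X,
    ContinuousOn ψ (Metric.closedBall 0 1) ∧
    MapsHomeomorphicallyOnto ψ (Metric.ball 0 1) (openCell K 2 c) ∧
    (∀ k < n, ∃ e : Cell K 1, MapsHomeomorphicallyOnto ψ (polygonEdge n k) (openCell K 1 e)) ∧
    (∀ k < n, ∃ v : Cell K 0, ψ (polygonVertex n k) = vertexPoint K v)

/-- A finite subdivision rule whose subdivision complex has underlying space `X`. -/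
structure FiniteSubdivisionRule (X : Type*) [TopologicalSpace X] where
  /-- The subdivision complex. -/
  complex : Topology.CWComplex (univ : Set X)
  complex_finite : IsFiniteTwoDimensional complex
  /-- The subdivision complex is the union of its closed 2-cells. -/
  complex_pure : ⋃ c, closedCell complex 2 c = univ
  hasTileType : ∀ c, HasTileType complex c
  /-- The subdivision of the subdivision complex. -/
  subdivision : Topology.CWComplex (univ : Set X)
  subdivision_finite : IsFiniteTwoDimensional subdivision
  /-- Every open cell of the subdivision is contained in an open cell of the complex. -/
  subdivision_refines : ∀ n (c : Cell subdivision n), ∃ m, ∃ d : Cell complex m,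
    openCell subdivision n c ⊆ openCell complex m d
  /-- The subdivision map. -/
  map : X → X
  continuous_map : Continuous map
  /-- The subdivision map takes every open cell of the subdivision homeomorphically onto an open
  cell, of the same dimension, of the complex. In particular it is cellular. -/
  map_openCell : ∀ n (c : Cell subdivision n), ∃ d : Cell complex n,
    MapsHomeomorphicallyOnto map (openCell subdivision n c) (openCell complex n d)

/-- The rule has exactly one tile type, that is, its subdivision complex has exactly one 2-cell. -/
def FiniteSubdivisionRule.HasOneTileType (R : FiniteSubdivisionRule X) : Prop :=
  Nat.card (Cell R.complex 2) = 1

/-- Every vertex of the subdivision complex with valence `1` or `2` belongs to `P`. -/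
def FiniteSubdivisionRule.IsPruned (R : FiniteSubdivisionRule X) (P : Set X) : Prop :=
  ∀ v : Cell R.complex 0, valence R.complex v = 1 ∨ valence R.complex v = 2 →
    vertexPoint R.complex v ∈ P

/-! ## The five forms of the 1-skeleton -/

/-- The 1-skeleton of `K` is isomorphic to the graph with vertex set `{0, …, m - 1}` and edge set
`E`, in such a way that the vertices belonging to `P` correspond to `0, 1, 2, 3`. -/
def HasForm (K : Topology.CWComplex (univ : Set X)) (P : Set X) (m : ℕ)
    (E : Finset (Sym2 (Fin m))) : Prop :=
  ∃ (α : Cell K 0 ≃ Fin m) (β : Cell K 1 ≃ E),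
    (∀ e x y, (oneSkeleton K).IsLink e x y ↔ (β e : Sym2 (Fin m)) = s(α x, α y)) ∧
    ∀ v, vertexPoint K v ∈ P ↔ (α v : ℕ) < 4

/-- The 1-skeleton of `K`, with the vertices in `P` marked, has one of the five forms:
* a path through four marked vertices;
* three edges joining a marked vertex to the three other marked vertices;
* four edges joining an unmarked vertex to the four marked vertices;
* an unmarked vertex of valence 3 with two legs consisting of one edge that ends in a marked vertex,
  and one leg consisting of two edges, with middle and end vertices marked;
* an edge joining two unmarked vertices of valence 3, each of which is joined to two of the four
  marked vertices. -/
def HasOneOfFiveForms (K : Topology.CWComplex (univ : Set X)) (P : Set X) : Prop :=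
  HasForm K P 4 {s(0, 1), s(1, 2), s(2, 3)} ∨
  HasForm K P 4 {s(0, 1), s(0, 2), s(0, 3)} ∨
  HasForm K P 5 {s(4, 0), s(4, 1), s(4, 2), s(4, 3)} ∨
  HasForm K P 5 {s(4, 0), s(4, 1), s(4, 2), s(2, 3)} ∨
  HasForm K P 6 {s(4, 0), s(4, 1), s(4, 5), s(5, 2), s(5, 3)}

end Complexes

end Lattes

end

noncomputable section

open Set Topology Filter Metric

namespace Lattes

/-! ## Homeomorphisms of the Riemann sphere -/

/-! Write `P` for the postcritical set, `ψ` for the characteristic map of the only tile, from a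
closed disk viewed as an `n`-gon onto the sphere, and `T` for the 1-skeleton, which is the image of
the boundary circle. Everything rests on knowing which boundary points `ψ` identifies. Two
identified pairs with different images never cross (`IsDiskMap.noncrossing`): the chord joining one
pair becomes a closed curve, which separates the sphere, while the images of the two halves of the
disk would be joined at the common image of the other pair. The separation theorem needed here is
proved with continuous logarithms (`not_isPreconnected_compl_paths`).

By non-crossing, two sides over one edge are glued with reversed orientation, so an edge cannot have
three sides (`not_three_sides`). An edge with only one side would give the sphere a boundary point
(`exists_second_side`). Hence every edge has exactly two sides, and a chord between them splits the
vertices into two classes that only this edge joins (`exists_cut`). The boundary of the tile is thus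
a closed walk through a connected graph in which every edge is a bridge, and `T` is a tree
(`IsTreeWalk.isTree`).

The second assertion follows by counting. Near a critical point `f` is two-to-one, but it is
injective on the open cells of the subdivision; so critical points are vertices of the subdivision,
and postcritical points are vertices of the complex. If a pruned tree has `m` vertices, the four
marked ones have degree at least `1` and the others at least `3`, so `2 (m - 1) ≥ 4 + 3 (m - 4)` and
`m ≤ 6`; inspection leaves five trees (`graphForm_of_isTree`).

For the first assertion, vertices outside `P` that lie on one or two edges are removed one at a
time. Merging two edges only relabels the boundary of the tile (`exists_merge`); deleting a leaf
zips up the two sides at its tip (`exists_removeLeaf`), which is carried out in the half-plane. The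
difficulty is to keep `f` compatible with the smaller skeleton. The property that survives every
step is that `f` maps each tight subset of `T` into `T`, where tight means that two disjoint legs
inside the set start at each point outside `P`. Indeed, if the image of a tight set entered a
deleted leaf, consider its point farthest towards the tip: `f` is injective near a preimage, so of
the two legs there one is carried still farther (`image_subset_of_leaf`). When nothing can be
removed any more, `T` is itself tight, so `f` maps `T` into `T`; and a vertex with three edges
cannot be sent into an open edge (`apply_mem_of_three_edges`), so `f` maps vertices to vertices.

Finally `f` is a covering off `P` with finite fibers, so the cells of the pruned complex lift
(`exists_liftedComplex`). The lifted complex refines the pruned one, because a lifted open cell is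
connected and never leaves the cell in which it starts (`IsLattesMap.exists_rule`). -/

/-- The finite coordinate of a point of the sphere, with junk value `0` at `∞`. -/
def toComplex (x : OnePoint ℂ) : ℂ := x.elim 0 id

@[simp] lemma toComplex_coe (z : ℂ) : toComplex (z : OnePoint ℂ) = z := rfl

@[simp] lemma toComplex_infty : toComplex OnePoint.infty = 0 := rfl

lemma coe_toComplex {x : OnePoint ℂ} (hx : x ≠ OnePoint.infty) :
    ((toComplex x : ℂ) : OnePoint ℂ) = x := by
  obtain ⟨z, rfl⟩ := OnePoint.ne_infty_iff_exists.mp hx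
  rfl

lemma continuousAt_toComplex {x : OnePoint ℂ} (hx : x ≠ OnePoint.infty) :
    ContinuousAt toComplex x := by
  obtain ⟨z, rfl⟩ := OnePoint.ne_infty_iff_exists.mp hx
  rw [OnePoint.continuousAt_coe]
  exact continuousAt_id

/-- Inversion `z ↦ 1 / z` of the Riemann sphere. -/
def sphereInv (x : OnePoint ℂ) : OnePoint ℂ :=
  x.elim ((0 : ℂ) : OnePoint ℂ)
    (fun z => if z = 0 then OnePoint.infty else ((z⁻¹ : ℂ) : OnePoint ℂ))

@[simp] lemma sphereInv_infty : sphereInv OnePoint.infty = ((0 : ℂ) : OnePoint ℂ) := rfl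

@[simp] lemma sphereInv_zero : sphereInv ((0 : ℂ) : OnePoint ℂ) = OnePoint.infty := by
  simp [sphereInv]

lemma sphereInv_coe {z : ℂ} (hz : z ≠ 0) :
    sphereInv (z : OnePoint ℂ) = ((z⁻¹ : ℂ) : OnePoint ℂ) := by
  simp [sphereInv, hz]

lemma sphereInv_involutive : Function.Involutive sphereInv := by
  intro x
  induction x using OnePoint.rec with
  | infty => simp
  | coe z =>
    by_cases hz : z = 0
    · subst hz; simp
    · rw [sphereInv_coe hz, sphereInv_coe (inv_ne_zero hz), inv_inv]

lemma tendsto_coe_cobounded :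
    Tendsto ((↑) : ℂ → OnePoint ℂ) (Bornology.cobounded ℂ) (𝓝 OnePoint.infty) := by
  rw [Metric.cobounded_eq_cocompact, ← coclosedCompact_eq_cocompact]
  exact OnePoint.tendsto_coe_infty

lemma continuous_sphereInv : Continuous sphereInv := by
  rw [continuous_iff_continuousAt]
  intro x
  induction x using OnePoint.rec with
  | infty =>
    rw [OnePoint.continuousAt_infty', coclosedCompact_eq_cocompact,
      ← Metric.cobounded_eq_cocompact]
    have h : Tendsto (fun z : ℂ => ((z⁻¹ : ℂ) : OnePoint ℂ)) (Bornology.cobounded ℂ)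
        (𝓝 ((0 : ℂ) : OnePoint ℂ)) :=
      (OnePoint.continuous_coe.tendsto _).comp tendsto_inv₀_cobounded
    refine h.congr' ?_
    filter_upwards [Bornology.isBounded_def.mp (Bornology.isBounded_singleton (x := (0 : ℂ)))] with z hz
    have hz : z ≠ 0 := hz
    simp [sphereInv_coe hz]
  | coe z =>
    rw [OnePoint.continuousAt_coe]
    by_cases hz : z = 0
    · subst hz
      rw [continuousAt_iff_punctured_nhds]
      have h : Tendsto (fun z : ℂ => ((z⁻¹ : ℂ) : OnePoint ℂ)) (𝓝[≠] (0 : ℂ))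
          (𝓝 OnePoint.infty) :=
        tendsto_coe_cobounded.comp tendsto_inv₀_nhdsNE_zero
      simp only [Function.comp_apply, sphereInv_zero]
      refine h.congr' ?_
      filter_upwards [self_mem_nhdsWithin] with w hw
      simp [sphereInv_coe hw]
    · have h : ContinuousAt (fun z : ℂ => ((z⁻¹ : ℂ) : OnePoint ℂ)) z :=
        OnePoint.continuous_coe.continuousAt.comp (continuousAt_inv₀ hz)
      refine h.congr ?_
      filter_upwards [isOpen_ne.mem_nhds hz] with w hw
      simp [sphereInv_coe hw]

/-- Inversion of the Riemann sphere, as a homeomorphism. -/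
def sphereInvHomeomorph : OnePoint ℂ ≃ₜ OnePoint ℂ where
  toFun := sphereInv
  invFun := sphereInv
  left_inv := sphereInv_involutive
  right_inv := sphereInv_involutive
  continuous_toFun := continuous_sphereInv
  continuous_invFun := continuous_sphereInv

/-- Translation of the Riemann sphere, as a homeomorphism. -/
def sphereTranslate (a : ℂ) : OnePoint ℂ ≃ₜ OnePoint ℂ := (Homeomorph.addRight a).onePointCongr

@[simp] lemma sphereTranslate_coe (a z : ℂ) :
    sphereTranslate a (z : OnePoint ℂ) = ((z + a : ℂ) : OnePoint ℂ) := rfl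

@[simp] lemma sphereTranslate_infty (a : ℂ) :
    sphereTranslate a OnePoint.infty = OnePoint.infty := rfl

lemma exists_homeomorph_infty (o : OnePoint ℂ) :
    ∃ M : OnePoint ℂ ≃ₜ OnePoint ℂ, M o = OnePoint.infty := by
  induction o using OnePoint.rec with
  | infty => exact ⟨Homeomorph.refl _, rfl⟩
  | coe z =>
    refine ⟨(sphereTranslate (-z)).trans sphereInvHomeomorph, ?_⟩
    change sphereInv (sphereTranslate (-z) (z : OnePoint ℂ)) = _
    simp

lemma exists_homeomorph_infty_zero {o s : OnePoint ℂ} (h : s ≠ o) :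
    ∃ M : OnePoint ℂ ≃ₜ OnePoint ℂ, M o = OnePoint.infty ∧ M s = ((0 : ℂ) : OnePoint ℂ) := by
  obtain ⟨M, hM⟩ := exists_homeomorph_infty o
  have hs : M s ≠ OnePoint.infty := fun h' => h (M.injective (h'.trans hM.symm))
  obtain ⟨z, hz⟩ := OnePoint.ne_infty_iff_exists.mp hs
  refine ⟨M.trans (sphereTranslate (-z)), ?_, ?_⟩
  · change sphereTranslate (-z) (M o) = _
    rw [hM, sphereTranslate_infty]
  · change sphereTranslate (-z) (M s) = _
    rw [← hz, sphereTranslate_coe]; simp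

/-! ## Continuous logarithms -/

/-- Lift the homotopy through the covering `exp`, starting from the constant logarithm `0` of `1`.
This turns every explicit contraction inside the punctured plane into a continuous logarithm. -/
lemma exists_log_of_homotopy {S : Type*} [TopologicalSpace S] (H : C(unitInterval × S, ℂ))
    (h0 : ∀ x, H x ≠ 0) (h1 : ∀ s, H (0, s) = 1) :
    ∃ L : C(S, ℂ), ∀ s, Complex.exp (L s) = H (1, s) := by
  let H' : C(unitInterval × S, {z : ℂ // z ≠ 0}) := ⟨fun x => ⟨H x, h0 x⟩, by fun_prop⟩
  let f : C(S, ℂ) := ContinuousMap.const S 0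
  have hf : ∀ s, H' (0, s) = ⟨Complex.exp (f s), Complex.exp_ne_zero _⟩ := by
    intro s
    apply Subtype.ext
    simp [H', f, h1]
  let F := Complex.isCoveringMap_exp.liftHomotopy H' f hf
  refine ⟨⟨fun s => F (1, s), by fun_prop⟩, fun s => ?_⟩
  have := congrFun (Complex.isCoveringMap_exp.liftHomotopy_lifts H' f hf) (1, s)
  exact congrArg Subtype.val this

/-- Contract along segments to a base point `a`; dividing by `g a` makes the homotopy start at `1`.
-/
lemma exists_log_of_convex {Ω : Set ℂ} (hΩ : Convex ℝ Ω) {g : ℂ → ℂ} (hg : ContinuousOn g Ω)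
    (h0 : ∀ z ∈ Ω, g z ≠ 0) :
    ∃ L : ℂ → ℂ, ContinuousOn L Ω ∧ ∀ z ∈ Ω, Complex.exp (L z) = g z := by
  rcases Ω.eq_empty_or_nonempty with rfl | ⟨a, ha⟩
  · exact ⟨0, by simp, by simp⟩
  have hmem : ∀ x : unitInterval × Ω, a + (x.1 : ℝ) • ((x.2 : ℂ) - a) ∈ Ω := fun x =>
    hΩ.add_smul_sub_mem ha x.2.2 x.1.2
  let H : C(unitInterval × Ω, ℂ) :=
    ⟨fun x => g (a + (x.1 : ℝ) • ((x.2 : ℂ) - a)) / g a,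
      (hg.comp_continuous (by fun_prop) hmem).div_const _⟩
  obtain ⟨L, hL⟩ := exists_log_of_homotopy H
    (fun x => div_ne_zero (h0 _ (hmem x)) (h0 a ha)) (fun s => by simp [H, div_self (h0 a ha)])
  classical
  refine ⟨fun z => if hz : z ∈ Ω then L ⟨z, hz⟩ + Complex.log (g a) else 0, ?_, ?_⟩
  · rw [continuousOn_iff_continuous_domRestrict]
    have : Ω.domRestrict (fun z => if hz : z ∈ Ω then L ⟨z, hz⟩ + Complex.log (g a) else 0)
        = fun z => L z + Complex.log (g a) := by
      ext z; simp
    rw [this]; fun_prop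
  · intro z hz
    simp only [hz, dif_pos, Complex.exp_add, hL, Complex.exp_log (h0 a ha)]
    simp [H, div_mul_cancel₀ _ (h0 a ha)]

/-- An affine function has no continuous logarithm on a circle around its zero. -/
lemma no_log_on_sphere {p c : ℂ} {r : ℝ} (hr : 0 < r) {L : ℂ → ℂ}
    (hL : ContinuousOn L (Metric.sphere p r))
    (h : ∀ z ∈ Metric.sphere p r, Complex.exp (L z) = c * (z - p)) : False := by
  let γ : ℝ → ℂ := circleMap p r
  have hγ : ∀ θ, γ θ ∈ Metric.sphere p r := fun θ => circleMap_mem_sphere p hr.le θ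
  -- Subtracting the angle leaves a logarithm of the constant `c * r`, hence a constant function;
  -- but `γ` has period `2π`, while the subtracted term has changed by `2πi`.
  let G : ℝ → ℂ := fun θ => L (γ θ) - θ * Complex.I
  have hG : Continuous G :=
    (hL.comp_continuous (continuous_circleMap p r) hγ).sub (by fun_prop)
  have hexp : ∀ θ, Complex.exp (G θ) = c * r := by
    intro θ
    have h1 := h _ (hγ θ)
    simp only [G, Complex.exp_sub, h1]
    rw [div_eq_iff (Complex.exp_ne_zero _)]
    simp only [γ, circleMap, add_sub_cancel_left]
    ring
  have hconst : ∀ θ, G θ = G 0 := fun θ =>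
    Complex.isCoveringMap_exp.const_of_comp hG
      (fun a b => Subtype.ext ((hexp a).trans (hexp b).symm)) θ 0
  have h2 := hconst (2 * Real.pi)
  have hper : γ (2 * Real.pi) = γ 0 := by
    have := periodic_circleMap p r 0
    simpa [γ] using this
  simp only [G, hper] at h2
  have : (2 * Real.pi : ℂ) * Complex.I = 0 := by
    push_cast at h2
    simp at h2
  simp [Real.pi_ne_zero] at this

/-- The complement of a path from `p ≠ 0` to `∞` which avoids `0` carries a logarithm of
`1 - z / p`. -/
lemma exists_log_compl_path {c : ℝ → OnePoint ℂ} (hc : ContinuousOn c (Icc 0 1)) {p : ℂ}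
    (h0 : c 0 = (p : OnePoint ℂ)) (h1 : c 1 = OnePoint.infty)
    (hz : ∀ t ∈ Icc (0 : ℝ) 1, c t ≠ ((0 : ℂ) : OnePoint ℂ)) :
    ∃ L : ℂ → ℂ, ContinuousOn L {z : ℂ | (z : OnePoint ℂ) ∉ c '' Icc 0 1} ∧
      ∀ z : ℂ, (z : OnePoint ℂ) ∉ c '' Icc 0 1 → Complex.exp (L z) = 1 - z / p := by
  set S : Set ℂ := {z : ℂ | (z : OnePoint ℂ) ∉ c '' Icc 0 1} with hS
  have hp : p ≠ 0 := by
    rintro rfl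
    exact hz 0 (by simp) h0
  -- `ι` is the reciprocal of the reversed path. It is finite because the path avoids `0`, and it
  -- runs from `0` to `1 / p`. So `1 - z * ι t` deforms `1` into `1 - z / p`, and it vanishes only
  -- if `z` lies on the path.
  let ι : unitInterval → ℂ := fun t => toComplex (sphereInv (c (1 - t)))
  have hmem : ∀ t : unitInterval, (1 - t : ℝ) ∈ Icc (0 : ℝ) 1 := fun t =>
    ⟨by linarith [t.2.2], by linarith [t.2.1]⟩
  have hne : ∀ t : unitInterval, sphereInv (c (1 - t)) ≠ OnePoint.infty := by
    intro t ht
    apply hz _ (hmem t)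
    rw [← sphereInv_involutive (c (1 - t)), ht, sphereInv_infty]
  have hι : Continuous ι := by
    rw [continuous_iff_continuousAt]
    intro t
    refine ContinuousAt.comp (f := fun t : unitInterval => sphereInv (c (1 - t)))
      (continuousAt_toComplex (hne t)) ?_
    exact (continuous_sphereInv.comp
      (hc.comp_continuous (by fun_prop) hmem)).continuousAt
  let H : C(unitInterval × S, ℂ) := ⟨fun x => 1 - x.2 * ι x.1, by fun_prop⟩
  obtain ⟨L, hL⟩ := exists_log_of_homotopy H (by
    rintro ⟨t, z, hzS⟩ h
    simp only [H, ContinuousMap.coe_mk] at h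
    have h' : z * ι t = 1 := (sub_eq_zero.mp h).symm
    have hz0 : z ≠ 0 := left_ne_zero_of_mul_eq_one h'
    have hι' : ι t = z⁻¹ := eq_inv_of_mul_eq_one_right h'
    apply hzS
    refine ⟨1 - t, hmem t, ?_⟩
    have : sphereInv (c (1 - t)) = ((z⁻¹ : ℂ) : OnePoint ℂ) := by
      rw [← hι', coe_toComplex (hne t)]
    rw [← sphereInv_involutive (c (1 - t)), this, sphereInv_coe (inv_ne_zero hz0), inv_inv])
    (by
      intro s
      simp [H, ι, h1])
  classical
  refine ⟨fun z => if hz : z ∈ S then L ⟨z, hz⟩ else 0, ?_, ?_⟩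
  · rw [continuousOn_iff_continuous_domRestrict]
    have : S.domRestrict (fun z => if hz : z ∈ S then L ⟨z, hz⟩ else 0) = L := by
      ext z; simp
    rw [this]; fun_prop
  · intro z hz
    have hz' : z ∈ S := hz
    simp only [hz', dif_pos, hL]
    simp [H, ι, h0, sphereInv_coe hp, div_eq_mul_inv]

/-- Two paths from `p` to `∞` which avoid `0` and meet only at their end points separate the
plane. -/
theorem not_isPreconnected_compl_paths {c₁ c₂ : ℝ → OnePoint ℂ} (hc₁ : ContinuousOn c₁ (Icc 0 1))
    (hc₂ : ContinuousOn c₂ (Icc 0 1)) {p : ℂ}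
    (h₁0 : c₁ 0 = (p : OnePoint ℂ)) (h₁1 : c₁ 1 = OnePoint.infty)
    (h₁z : ∀ t ∈ Icc (0 : ℝ) 1, c₁ t ≠ ((0 : ℂ) : OnePoint ℂ))
    (h₂0 : c₂ 0 = (p : OnePoint ℂ)) (h₂1 : c₂ 1 = OnePoint.infty)
    (h₂z : ∀ t ∈ Icc (0 : ℝ) 1, c₂ t ≠ ((0 : ℂ) : OnePoint ℂ))
    (hmeet : ∀ x ∈ c₁ '' Icc 0 1, x ∈ c₂ '' Icc 0 1 → x = (p : OnePoint ℂ) ∨ x = OnePoint.infty) :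
    ¬ IsPreconnected {z : ℂ | (z : OnePoint ℂ) ∉ c₁ '' Icc 0 1 ∪ c₂ '' Icc 0 1} := by
  intro hpre
  have hp : p ≠ 0 := by
    rintro rfl
    exact h₁z 0 (by simp) h₁0
  obtain ⟨L₁, hL₁, hE₁⟩ := exists_log_compl_path hc₁ h₁0 h₁1 h₁z
  obtain ⟨L₂, hL₂, hE₂⟩ := exists_log_compl_path hc₂ h₂0 h₂1 h₂z
  set O₁ : Set ℂ := {z : ℂ | (z : OnePoint ℂ) ∉ c₁ '' Icc 0 1} with hO₁
  set O₂ : Set ℂ := {z : ℂ | (z : OnePoint ℂ) ∉ c₂ '' Icc 0 1} with hO₂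
  have hopen : ∀ c : ℝ → OnePoint ℂ, ContinuousOn c (Icc 0 1) →
      IsOpen {z : ℂ | (z : OnePoint ℂ) ∉ c '' Icc 0 1} := fun c hc =>
    ((isCompact_Icc.image_of_continuousOn hc).isClosed.preimage
      OnePoint.continuous_coe).isOpen_compl
  have hO : {z : ℂ | (z : OnePoint ℂ) ∉ c₁ '' Icc 0 1 ∪ c₂ '' Icc 0 1} = O₁ ∩ O₂ := by
    ext z; simp [O₁, O₂]
  rw [hO] at hpre
  have hD : ContinuousOn (fun z => L₁ z - L₂ z) (O₁ ∩ O₂) :=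
    (hL₁.mono inter_subset_left).sub (hL₂.mono inter_subset_right)
  -- Both `L₁` and `L₂` are logarithms of `1 - z / p`, so their difference has values in the
  -- discrete set `2πi ℤ` and is constant on a connected set.
  have hconst : ∃ k : ℂ, Complex.exp k = 1 ∧ ∀ z ∈ O₁ ∩ O₂, L₁ z = L₂ z + k := by
    rcases (O₁ ∩ O₂).eq_empty_or_nonempty with he | ⟨a, ha⟩
    · exact ⟨0, by simp, by simp [he]⟩
    have hexp : ∀ z ∈ O₁ ∩ O₂, Complex.exp (L₁ z - L₂ z) = 1 := by
      intro z hz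
      rw [Complex.exp_sub, hE₁ z hz.1, hE₂ z hz.2, div_self]
      rw [← hE₁ z hz.1]; exact Complex.exp_ne_zero _
    refine ⟨L₁ a - L₂ a, hexp a ha, fun z hz => ?_⟩
    have := Complex.isCoveringMap_exp.constOn_of_comp hpre hD
      (fun x hx y hy => Subtype.ext ((hexp x hx).trans (hexp y hy).symm)) hz ha
    linear_combination this
  obtain ⟨k, hk, hkL⟩ := hconst
  classical
  -- The paths meet in the plane only at `p`, so after correction by `k` the two logarithms glue to
  -- one on all of `ℂ ∖ {p}`, in particular on a circle around `p`.
  let L : ℂ → ℂ := fun z => if z ∈ O₁ then L₁ z else L₂ z + k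
  have hcov : ∀ z : ℂ, z ≠ p → z ∈ O₁ ∪ O₂ := by
    intro z hz
    by_contra h
    simp only [mem_union, not_or, O₁, O₂, mem_ofPred_eq, not_not] at h
    rcases hmeet z h.1 h.2 with h' | h'
    · exact hz (OnePoint.coe_injective h')
    · exact OnePoint.coe_ne_infty z h'
  have hLc : ∀ z ≠ p, ContinuousAt L z := by
    intro z hz
    rcases hcov z hz with h | h
    · refine ((hL₁ z h).continuousAt ((hopen c₁ hc₁).mem_nhds h)).congr ?_
      filter_upwards [(hopen c₁ hc₁).mem_nhds h] with w hw
      have : w ∈ O₁ := hw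
      simp [L, this]
    · refine (((hL₂ z h).continuousAt ((hopen c₂ hc₂).mem_nhds h)).add
        (continuousAt_const (y := k))).congr ?_
      filter_upwards [(hopen c₂ hc₂).mem_nhds h] with w hw
      by_cases hw1 : w ∈ O₁
      · simp [L, hw1, hkL w ⟨hw1, hw⟩]
      · simp [L, hw1]
  have hLe : ∀ z ≠ p, Complex.exp (L z) = (-1 / p) * (z - p) := by
    intro z hz
    have : (-1 / p) * (z - p) = 1 - z / p := by field_simp; ring
    rw [this]
    by_cases h1 : z ∈ O₁
    · simp only [L, h1, if_pos]; exact hE₁ z h1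
    · have h2 : z ∈ O₂ := (hcov z hz).resolve_left h1
      simp only [L, h1, if_neg, not_false_iff, Complex.exp_add, hk, mul_one]
      exact hE₂ z h2
  have hs : ∀ z ∈ Metric.sphere p 1, z ≠ p := by
    rintro z hz rfl
    simp at hz
  exact no_log_on_sphere one_pos
    (fun z hz => (hLc z (hs z hz)).continuousWithinAt) (fun z hz => hLe z (hs z hz))

/-! ## Identifications on the boundary of a disk mapped onto the sphere do not cross -/

/-- A continuous map of the closed unit disk onto `X` which is injective on the open disk, and
under which the images of the open disk and of the boundary circle are disjoint. -/
structure IsDiskMap {X : Type*} [TopologicalSpace X] (ψ : ℂ → X) : Prop where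
  cont : ContinuousOn ψ (closedBall 0 1)
  inj : InjOn ψ (ball 0 1)
  surj : ψ '' closedBall 0 1 = univ
  ne : ∀ z ∈ ball (0 : ℂ) 1, ∀ w ∈ sphere (0 : ℂ) 1, ψ z ≠ ψ w

lemma IsDiskMap.comp_mul {X : Type*} [TopologicalSpace X] {ψ : ℂ → X} (h : IsDiskMap ψ) {u : ℂ}
    (hu : ‖u‖ = 1) : IsDiskMap (fun z => ψ (u * z)) := by
  have hu0 : u ≠ 0 := by rintro rfl; simp at hu
  refine ⟨h.cont.comp (by fun_prop) (fun z hz => ?_), ?_, ?_, ?_⟩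
  · simpa [hu] using hz
  · intro z hz w hw hzw
    exact mul_left_cancel₀ hu0 (h.inj (by simpa [hu] using hz) (by simpa [hu] using hw) hzw)
  · refine eq_univ_of_forall fun x => ?_
    obtain ⟨z, hz, rfl⟩ := h.surj.symm ▸ mem_univ x
    refine ⟨u⁻¹ * z, by simpa [hu] using hz, ?_⟩
    simp [hu0]
  · intro z hz w hw
    exact h.ne _ (by simpa [hu] using hz) _ (by simpa [hu] using hw)

lemma IsDiskMap.homeomorph_comp {X Y : Type*} [TopologicalSpace X] [TopologicalSpace Y]
    {ψ : ℂ → X} (h : IsDiskMap ψ) (M : X ≃ₜ Y) : IsDiskMap (fun z => M (ψ z)) := by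
  refine ⟨M.continuous.comp_continuousOn h.cont, M.injective.comp_injOn h.inj, ?_, ?_⟩
  · refine eq_univ_of_forall fun x => ?_
    obtain ⟨z, hz, hx⟩ := h.surj.symm ▸ mem_univ (M.symm x)
    exact ⟨z, hz, by simp [hx]⟩
  · intro z hz w hw hzw
    exact h.ne z hz w hw (M.injective hzw)

/-- Normal form of the crossing configuration: the chord is vertical, its midpoint goes to `∞`, and
the second pair, one point on each side of the chord, goes to `0`. The two halves of the chord
become paths from `p` to `∞` as in `not_isPreconnected_compl_paths`, but the images of the two
half-disks show that their complement is connected. -/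
lemma IsDiskMap.noncrossing_aux {g : ℂ → OnePoint ℂ} (h : IsDiskMap g) {δ : ℝ} (h0 : 0 < δ)
    (hπ : δ < Real.pi) {v w : ℂ} (hv : ‖v‖ = 1) (hw : ‖w‖ = 1) (hvδ : Real.cos δ < v.re)
    (hwδ : w.re < Real.cos δ)
    (hx : g ⟨Real.cos δ, -Real.sin δ⟩ = g ⟨Real.cos δ, Real.sin δ⟩)
    (hgv : g v = ((0 : ℂ) : OnePoint ℂ)) (hgw : g w = ((0 : ℂ) : OnePoint ℂ))
    (hx0 : g ⟨Real.cos δ, Real.sin δ⟩ ≠ ((0 : ℂ) : OnePoint ℂ))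
    (hm : g ⟨Real.cos δ, 0⟩ = OnePoint.infty) : False := by
  have hs : 0 < Real.sin δ := Real.sin_pos_of_pos_of_lt_pi h0 hπ
  have hsc : Real.sin δ ^ 2 + Real.cos δ ^ 2 = 1 := Real.sin_sq_add_cos_sq δ
  let C : ℝ → ℂ := fun τ => ⟨Real.cos δ, Real.sin δ * τ⟩
  have hC1 : C 1 = ⟨Real.cos δ, Real.sin δ⟩ := by simp [C]
  have hC1' : C (-1) = ⟨Real.cos δ, -Real.sin δ⟩ := by simp [C]
  have hC0 : C 0 = ⟨Real.cos δ, 0⟩ := by simp [C]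
  have hCcont : Continuous C := by
    have : C = fun τ : ℝ => Complex.equivRealProdCLM.symm (Real.cos δ, Real.sin δ * τ) := rfl
    rw [this]; fun_prop
  have hnorm : ∀ z : ℂ, ‖z‖ ^ 2 = z.re ^ 2 + z.im ^ 2 := fun z => by
    rw [← Complex.normSq_eq_norm_sq, Complex.normSq_apply]; ring
  have hCball : ∀ τ : ℝ, |τ| < 1 → C τ ∈ ball (0 : ℂ) 1 := by
    intro τ hτ
    rw [mem_ball_zero_iff, ← sq_lt_one_iff₀ (norm_nonneg _), hnorm]
    have : τ ^ 2 < 1 := by rwa [sq_lt_one_iff_abs_lt_one]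
    simp only [C]
    nlinarith [mul_pos hs hs]
  have hCsphere : ∀ τ : ℝ, |τ| = 1 → C τ ∈ sphere (0 : ℂ) 1 := by
    intro τ hτ
    rw [mem_sphere_zero_iff_norm, ← pow_eq_one_iff_of_nonneg (norm_nonneg _) two_ne_zero, hnorm]
    have : τ ^ 2 = 1 := by rw [← sq_abs, hτ]; norm_num
    simp only [C]
    nlinarith
  have hCclosed : ∀ τ : ℝ, |τ| ≤ 1 → C τ ∈ closedBall (0 : ℂ) 1 := by
    intro τ hτ
    rcases hτ.lt_or_eq with h | h
    · exact ball_subset_closedBall (hCball τ h)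
    · exact sphere_subset_closedBall (hCsphere τ h)
  have hCinj : ∀ τ τ' : ℝ, C τ = C τ' → τ = τ' := by
    intro τ τ' h
    have := congrArg Complex.im h
    simpa [C, hs.ne'] using this
  have hC_of : ∀ z ∈ closedBall (0 : ℂ) 1, z.re = Real.cos δ → ∃ τ : ℝ, |τ| ≤ 1 ∧ C τ = z := by
    intro z hz hre
    refine ⟨z.im / Real.sin δ, ?_, ?_⟩
    · rw [mem_closedBall_zero_iff, ← sq_le_one_iff₀ (norm_nonneg _), hnorm, hre] at hz
      rw [← sq_le_one_iff_abs_le_one, div_pow, div_le_one (by positivity)]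
      linarith
    · apply Complex.ext
      · simp [C, hre]
      · simp only [C]; field_simp
  have hgC0 : ∀ τ : ℝ, |τ| ≤ 1 → g (C τ) ≠ ((0 : ℂ) : OnePoint ℂ) := by
    intro τ hτ h'
    rcases hτ.lt_or_eq with h1 | h1
    · exact h.ne _ (hCball τ h1) v (by simpa using hv) (h'.trans hgv.symm)
    · rcases abs_eq (zero_le_one) |>.mp h1 with rfl | rfl
      · exact hx0 (hC1 ▸ h')
      · rw [hC1', hx] at h'; exact hx0 h'
  have hxinf : g (C 1) ≠ OnePoint.infty := by
    rw [← hm, ← hC0]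
    exact (h.ne _ (hCball 0 (by simp)) _ (hCsphere 1 (by simp))).symm
  obtain ⟨p, hp⟩ := OnePoint.ne_infty_iff_exists.mp hxinf
  have hp' : g (C (-1)) = p := by rw [hC1', hx, ← hC1, hp]
  have hgCinf : ∀ z ∈ closedBall (0 : ℂ) 1, g z = OnePoint.infty → z = C 0 := by
    intro z hz hgz
    rw [← hm, ← hC0] at hgz
    by_cases hzb : z ∈ ball (0 : ℂ) 1
    · exact h.inj hzb (hCball 0 (by simp)) hgz
    · have hzs : z ∈ sphere (0 : ℂ) 1 := by
        rw [← closedBall_sdiff_ball]; exact ⟨hz, hzb⟩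
      exact absurd hgz.symm (h.ne _ (hCball 0 (by simp)) _ hzs)
  have habs : ∀ τ ∈ Icc (0 : ℝ) 1, |1 - τ| ≤ 1 ∧ |-(1 - τ)| ≤ 1 := by
    intro τ hτ
    rw [abs_neg, and_self, abs_le]
    constructor <;> linarith [hτ.1, hτ.2]
  let c₁ : ℝ → OnePoint ℂ := fun τ => g (C (1 - τ))
  let c₂ : ℝ → OnePoint ℂ := fun τ => g (C (-(1 - τ)))
  have hJ : ∀ x : OnePoint ℂ, x ∈ c₁ '' Icc 0 1 ∪ c₂ '' Icc 0 1 ↔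
      ∃ τ : ℝ, |τ| ≤ 1 ∧ g (C τ) = x := by
    intro x
    constructor
    · rintro (⟨τ, hτ, rfl⟩ | ⟨τ, hτ, rfl⟩)
      · exact ⟨_, (habs τ hτ).1, rfl⟩
      · exact ⟨_, (habs τ hτ).2, rfl⟩
    · rintro ⟨τ, hτ, rfl⟩
      rw [abs_le] at hτ
      rcases le_total 0 τ with h' | h'
      · left; exact ⟨1 - τ, ⟨by linarith, by linarith⟩, by simp [c₁]⟩
      · right; exact ⟨1 + τ, ⟨by linarith, by linarith⟩, by simp [c₂]⟩
  refine not_isPreconnected_compl_paths (c₁ := c₁) (c₂ := c₂) (p := p)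
    (h.cont.comp (hCcont.comp (by fun_prop)).continuousOn (fun τ hτ => hCclosed _ (habs τ hτ).1))
    (h.cont.comp (hCcont.comp (by fun_prop)).continuousOn (fun τ hτ => hCclosed _ (habs τ hτ).2))
    (by simp [c₁, hp]) (by simp [c₁, hC0, hm]) (fun τ hτ => hgC0 _ (habs τ hτ).1)
    (by simp [c₂, hp']) (by simp [c₂, hC0, hm]) (fun τ hτ => hgC0 _ (habs τ hτ).2) ?_ ?_
  · rintro x ⟨τ, hτ, rfl⟩ ⟨τ', hτ', hxx⟩
    rcases hτ.1.eq_or_lt with rfl | h1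
    · left; simp [c₁, hp]
    rcases hτ'.1.eq_or_lt with rfl | h1'
    · left; rw [← hxx]; simp [c₂, hp']
    right
    have e := hCinj _ _ (h.inj (hCball (-(1 - τ')) ?_) (hCball (1 - τ) ?_) hxx)
    · have : τ = 1 := by linarith [hτ.2, hτ'.2]
      simp [c₁, this, hC0, hm]
    · rw [abs_lt]; constructor <;> linarith [hτ'.2]
    · rw [abs_lt]; constructor <;> linarith [hτ.2]
  · set O : Set ℂ := {z : ℂ | (z : OnePoint ℂ) ∉ c₁ '' Icc 0 1 ∪ c₂ '' Icc 0 1} with hO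
    let D₁ : Set ℂ := {z | Real.cos δ < z.re} ∩ ball 0 1
    let D₂ : Set ℂ := {z | z.re < Real.cos δ} ∩ ball 0 1
    let k : ℂ → ℂ := fun z => toComplex (g z)
    -- Only the chord midpoint is sent to `∞`, so off the chord the junk value of `toComplex` plays
    -- no role.
    have hkcont : ∀ z ∈ closedBall (0 : ℂ) 1, z.re ≠ Real.cos δ →
        ContinuousWithinAt k (closedBall 0 1) z := by
      intro z hz hre
      refine (continuousAt_toComplex ?_).comp_continuousWithinAt (h.cont z hz)
      intro h'
      exact hre (by rw [hgCinf z hz h'])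
    have hkO : ∀ z ∈ ball (0 : ℂ) 1, z.re ≠ Real.cos δ → k z ∈ O := by
      intro z hz hre
      have hne : g z ≠ OnePoint.infty := fun h' =>
        hre (by rw [hgCinf z (ball_subset_closedBall hz) h'])
      rw [hO, mem_ofPred_eq, hJ, coe_toComplex hne]
      rintro ⟨τ, hτ, hτz⟩
      rcases hτ.lt_or_eq with h1 | h1
      · exact hre (by rw [← h.inj (hCball τ h1) hz hτz])
      · exact h.ne _ hz _ (hCsphere τ h1) hτz.symm
    have hcl : ∀ {D : Set ℂ}, IsOpen D → (∀ z ∈ D, z.re ≠ Real.cos δ) →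
        ∀ z ∈ closedBall (0 : ℂ) 1, z ∈ D → k z ∈ closure (k '' (D ∩ ball 0 1)) := by
      intro D hD hDre z hz hzD
      have hz' : z ∈ closure (D ∩ ball 0 1) := by
        apply hD.inter_closure
        exact ⟨hzD, by rwa [closure_ball _ one_ne_zero]⟩
      exact ((hkcont z hz (hDre z hzD)).mono
        (inter_subset_right.trans ball_subset_closedBall)).mem_closure_image hz'
    have ho₁ : IsOpen {z : ℂ | Real.cos δ < z.re} := isOpen_lt continuous_const Complex.continuous_re
    have ho₂ : IsOpen {z : ℂ | z.re < Real.cos δ} := isOpen_lt Complex.continuous_re continuous_const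
    -- The set lies between the connected image of an open half-disk and the closure of that image.
    -- Taking the closure also captures the images of boundary points of the disk.
    have hpre : ∀ {D : Set ℂ}, Convex ℝ D → (∀ z ∈ D, z.re ≠ Real.cos δ) →
        IsPreconnected (O ∩ closure (k '' (D ∩ ball 0 1))) := by
      intro D hD hDre
      refine IsPreconnected.subset_closure (s := k '' (D ∩ ball 0 1)) ?_ ?_ inter_subset_right
      · exact (hD.inter (convex_ball _ _)).isPreconnected.image k (fun z hz =>
          (hkcont z (ball_subset_closedBall hz.2) (hDre z hz.1)).mono
            (inter_subset_right.trans ball_subset_closedBall))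
      · rintro _ ⟨z, hz, rfl⟩
        exact ⟨hkO z hz.2 (hDre z hz.1), subset_closure ⟨z, hz, rfl⟩⟩
    have hOeq : O = (O ∩ closure (k '' ({z | Real.cos δ < z.re} ∩ ball 0 1))) ∪
        (O ∩ closure (k '' ({z | z.re < Real.cos δ} ∩ ball 0 1))) := by
      refine subset_antisymm ?_ (union_subset inter_subset_left inter_subset_left)
      intro z hz
      obtain ⟨ζ, hζ, hζz⟩ := h.surj.symm ▸ mem_univ (z : OnePoint ℂ)
      have hkz : k ζ = z := by simp [k, hζz]
      rcases lt_trichotomy (Real.cos δ) ζ.re with h1 | h1 | h1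
      · left; exact ⟨hz, hkz ▸ hcl ho₁ (fun z hz => ne_of_gt hz) ζ hζ h1⟩
      · exfalso
        obtain ⟨τ, hτ, rfl⟩ := hC_of ζ hζ h1.symm
        rw [hO, mem_ofPred_eq, hJ] at hz
        exact hz ⟨τ, hτ, hζz⟩
      · right; exact ⟨hz, hkz ▸ hcl ho₂ (fun z hz => ne_of_lt hz) ζ hζ h1⟩
    have h0O : (0 : ℂ) ∈ O := by
      rw [hO, mem_ofPred_eq, hJ]
      rintro ⟨τ, hτ, h'⟩
      exact hgC0 τ hτ h'
    rw [hOeq]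
    -- The point `0` lies in both pieces: as the image of `v` in the right one and of `w` in the
    -- left one.
    refine IsPreconnected.union 0 ⟨h0O, ?_⟩ ⟨h0O, ?_⟩
      (hpre (convex_halfSpace_re_gt _) (fun z hz => ne_of_gt hz))
      (hpre (convex_halfSpace_re_lt _) (fun z hz => ne_of_lt hz))
    · have := hcl ho₁ (fun z hz => ne_of_gt hz) v (by simp [hv]) hvδ
      simpa [k, hgv] using this
    · have := hcl ho₂ (fun z hz => ne_of_lt hz) w (by simp [hw]) hwδ
      simpa [k, hgw] using this

/-- The point of the unit circle at angle `2 π θ / n`, so that the vertices of the `n`-gon have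
integral parameters. -/
def polygonPoint (n : ℕ) (θ : ℝ) : ℂ := Complex.exp (2 * Real.pi * Complex.I * ((θ : ℂ) / n))

lemma polygonPoint_eq (n : ℕ) (θ : ℝ) :
    polygonPoint n θ = Complex.exp ((2 * Real.pi * θ / n : ℝ) * Complex.I) := by
  rw [polygonPoint]; congr 1; push_cast; ring

@[simp] lemma norm_polygonPoint (n : ℕ) (θ : ℝ) : ‖polygonPoint n θ‖ = 1 := by
  rw [polygonPoint_eq, Complex.norm_exp_ofReal_mul_I]

lemma polygonPoint_mem_sphere (n : ℕ) (θ : ℝ) : polygonPoint n θ ∈ sphere (0 : ℂ) 1 := by simp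

lemma polygonPoint_mem_closedBall (n : ℕ) (θ : ℝ) : polygonPoint n θ ∈ closedBall (0 : ℂ) 1 := by
  simp

lemma continuous_polygonPoint (n : ℕ) : Continuous (polygonPoint n) := by
  unfold polygonPoint; fun_prop

lemma polygonPoint_add (n : ℕ) (θ η : ℝ) :
    polygonPoint n (θ + η) = polygonPoint n θ * polygonPoint n η := by
  simp only [polygonPoint, ← Complex.exp_add]
  congr 1; push_cast; ring

lemma polygonPoint_eq_iff {n : ℕ} (hn : n ≠ 0) {θ η : ℝ} :
    polygonPoint n θ = polygonPoint n η ↔ ∃ k : ℤ, θ = η + k * n := by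
  have hn' : (n : ℂ) ≠ 0 := by exact_mod_cast hn
  rw [polygonPoint, polygonPoint, Complex.exp_eq_exp_iff_exists_int]
  refine exists_congr fun k => ?_
  rw [show (2 * Real.pi * Complex.I * ((η : ℂ) / n) + k * (2 * Real.pi * Complex.I)) =
    2 * Real.pi * Complex.I * ((η : ℂ) / n + k) by ring,
    mul_right_inj' Complex.two_pi_I_ne_zero, div_add' _ _ _ hn', div_left_inj' hn']
  exact_mod_cast Iff.rfl

lemma polygonPoint_add_int_mul {n : ℕ} (hn : n ≠ 0) (θ : ℝ) (k : ℤ) :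
    polygonPoint n (θ + k * n) = polygonPoint n θ :=
  (polygonPoint_eq_iff hn).mpr ⟨k, rfl⟩

lemma exists_polygonPoint_eq {n : ℕ} (hn : n ≠ 0) {z : ℂ} (hz : ‖z‖ = 1) :
    ∃ θ : ℝ, polygonPoint n θ = z := by
  refine ⟨n * Complex.arg z / (2 * Real.pi), ?_⟩
  have hn' : (n : ℝ) ≠ 0 := by exact_mod_cast hn
  rw [polygonPoint_eq]
  have : 2 * Real.pi * (n * Complex.arg z / (2 * Real.pi)) / n = Complex.arg z := by
    field_simp
  rw [this]
  conv_rhs => rw [← Complex.norm_mul_exp_arg_mul_I z, hz]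
  simp

/-- The equivalence relation induced on the boundary circle by a disk map onto the sphere is
non-crossing. -/
theorem IsDiskMap.noncrossing {ψ : ℂ → OnePoint ℂ} (h : IsDiskMap ψ) {n : ℕ} {a t b s : ℝ}
    (hat : a < t) (htb : t < b) (hbs : b < s) (hsa : s < a + n)
    (hab : ψ (polygonPoint n a) = ψ (polygonPoint n b))
    (hts : ψ (polygonPoint n t) = ψ (polygonPoint n s)) :
    ψ (polygonPoint n a) = ψ (polygonPoint n t) := by
  by_contra hne
  have hn0 : (0 : ℝ) < n := by linarith
  -- Rotating by the midpoint of the arc from `a` to `b` makes their chord vertical; `δ` is half the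
  -- angle of this arc.
  set u := polygonPoint n ((a + b) / 2) with hu
  set c := 2 * Real.pi / n with hc
  have hcpos : 0 < c := by positivity
  have hcn : c * n = 2 * Real.pi := by rw [hc]; field_simp
  set δ := c * ((b - a) / 2) with hδ
  have hpt : ∀ θ : ℝ, polygonPoint n (θ - (a + b) / 2) =
      ⟨Real.cos (c * (θ - (a + b) / 2)), Real.sin (c * (θ - (a + b) / 2))⟩ := by
    intro θ
    rw [polygonPoint_eq, show 2 * Real.pi * (θ - (a + b) / 2) / n = c * (θ - (a + b) / 2) by
      rw [hc]; ring, Complex.exp_mul_I, ← Complex.ofReal_cos, ← Complex.ofReal_sin]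
    generalize Real.cos (c * (θ - (a + b) / 2)) = x
    generalize Real.sin (c * (θ - (a + b) / 2)) = y
    apply Complex.ext <;> simp
  have hup : ∀ θ : ℝ, u * polygonPoint n (θ - (a + b) / 2) = polygonPoint n θ := by
    intro θ
    rw [hu, ← polygonPoint_add]; congr 1; ring
  have h' := h.comp_mul (u := u) (by simp [u])
  have hδ0 : 0 < δ := mul_pos hcpos (by linarith)
  have hδπ : δ < Real.pi := by
    have : c * ((b - a) / 2) < c * (n / 2) := mul_lt_mul_of_pos_left (by linarith) hcpos
    linarith [hδ]
  have hxa : polygonPoint n (a - (a + b) / 2) = ⟨Real.cos δ, -Real.sin δ⟩ := by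
    rw [hpt, ← Real.sin_neg, ← Real.cos_neg δ]
    congr 2 <;> rw [hδ] <;> ring
  have hxb : polygonPoint n (b - (a + b) / 2) = ⟨Real.cos δ, Real.sin δ⟩ := by
    rw [hpt]
    congr 2 <;> rw [hδ] <;> ring
  have hs0 : ψ (u * ⟨Real.cos δ, 0⟩) ≠ ψ (polygonPoint n t) := by
    refine h.ne _ ?_ _ (polygonPoint_mem_sphere _ _)
    have h2 : |Real.cos δ| < 1 := by
      rw [← sq_lt_one_iff_abs_lt_one]
      nlinarith [Real.sin_sq_add_cos_sq δ, Real.sin_pos_of_pos_of_lt_pi hδ0 hδπ]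
    have : (⟨Real.cos δ, 0⟩ : ℂ) = ((Real.cos δ : ℝ) : ℂ) := rfl
    rw [this, mem_ball_zero_iff, norm_mul, Complex.norm_real, hu, norm_polygonPoint, one_mul]
    exact h2
  obtain ⟨M, hM1, hM2⟩ := exists_homeomorph_infty_zero hs0.symm
  refine (h'.homeomorph_comp M).noncrossing_aux (δ := δ) hδ0 hδπ
    (v := polygonPoint n (t - (a + b) / 2)) (w := polygonPoint n (s - (a + b) / 2))
    (norm_polygonPoint _ _) (norm_polygonPoint _ _) ?_ ?_ ?_ ?_ ?_ ?_ hM1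
  · rw [hpt]
    change Real.cos δ < Real.cos _
    rw [← Real.cos_abs (c * (t - (a + b) / 2)), abs_mul, abs_of_pos hcpos]
    refine Real.cos_lt_cos_of_nonneg_of_le_pi (by positivity) hδπ.le
      (mul_lt_mul_of_pos_left ?_ hcpos)
    rw [abs_lt]; constructor <;> linarith
  · rw [hpt]
    change Real.cos _ < Real.cos δ
    have h1 : δ < c * (s - (a + b) / 2) := mul_lt_mul_of_pos_left (by linarith) hcpos
    have h2 : c * (s - (a + b) / 2) < 2 * Real.pi - δ := by
      rw [hδ, ← hcn, ← mul_sub]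
      exact mul_lt_mul_of_pos_left (by linarith) hcpos
    rcases le_total (c * (s - (a + b) / 2)) Real.pi with h3 | h3
    · exact Real.cos_lt_cos_of_nonneg_of_le_pi hδ0.le h3 h1
    · rw [← Real.cos_two_pi_sub]
      exact Real.cos_lt_cos_of_nonneg_of_le_pi hδ0.le (by linarith) (by linarith)
  · rw [← hxa, ← hxb, hup, hup, hab]
  · rw [hup, hM2]
  · rw [hup, ← hts, hM2]
  · rw [← hxb, hup, ← hab, ← hM2]
    exact fun h' => hne (M.injective h')

/-! ## Embeddings of open parts of compact sets -/

/-- For a neighbourhood `N'` of `x`, the image of `K ∖ N'` is compact, hence closed. It misses `f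
x`, by injectivity on `O` and because points of `K ∖ O` never share a value with points of `O`. Its
complement is the neighbourhood of `f x` that has to be pulled back. -/
lemma isEmbedding_domRestrict_of_isCompact {Y Z : Type*} [TopologicalSpace Y] [TopologicalSpace Z]
    [T2Space Z] {f : Y → Z} {K O : Set Y} (hK : IsCompact K) (hf : ContinuousOn f K) (hOK : O ⊆ K)
    (hinj : InjOn f O) (hne : ∀ x ∈ O, ∀ y ∈ K, y ∉ O → f x ≠ f y) :
    IsEmbedding (O.domRestrict f) := by
  refine ⟨isInducing_iff_nhds.mpr fun x => le_antisymm ?_ ?_, injOn_iff_injective.mp hinj⟩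
  · exact ((hf.mono hOK).domRestrict.tendsto x).le_comap
  · intro N hN
    obtain ⟨N', hN', hxN', hNN'⟩ : ∃ N' : Set Y, IsOpen N' ∧ (x : Y) ∈ N' ∧
        Subtype.val ⁻¹' N' ⊆ N := by
      rw [nhds_subtype, mem_comap] at hN
      obtain ⟨t, ht, htN⟩ := hN
      obtain ⟨N', h1, h2, h3⟩ := mem_nhds_iff.mp ht
      exact ⟨N', h2, h3, (preimage_mono h1).trans htN⟩
    have hF : IsClosed (f '' (K \ N')) :=
      ((hK.diff hN').image_of_continuousOn (hf.mono sdiff_subset)).isClosed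
    refine mem_comap.mpr ⟨(f '' (K \ N'))ᶜ, hF.isOpen_compl.mem_nhds ?_, ?_⟩
    · rintro ⟨y, ⟨hyK, hyN⟩, hxy⟩
      by_cases hyO : y ∈ O
      · exact hyN (hinj hyO x.2 hxy ▸ hxN')
      · exact hne x x.2 y hyK hyO hxy.symm
    · intro z hz
      apply hNN'
      by_contra hzN
      exact hz ⟨z, ⟨hOK z.2, hzN⟩, rfl⟩

lemma exists_continuousOn_leftInvOn {Y Z : Type*} [TopologicalSpace Y] [TopologicalSpace Z]
    [Nonempty Y] {f : Y → Z} {O : Set Y} (h : IsEmbedding (O.domRestrict f)) :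
    ∃ g : Z → Y, ContinuousOn g (f '' O) ∧ LeftInvOn g f O := by
  classical
  have hr : range (O.domRestrict f) = f '' O := range_domRestrict f O
  let e := h.toHomeomorph
  refine ⟨fun z => if hz : z ∈ range (O.domRestrict f) then e.symm ⟨z, hz⟩
    else Classical.arbitrary Y, ?_, ?_⟩
  · rw [← hr, continuousOn_iff_continuous_domRestrict]
    have : (range (O.domRestrict f)).domRestrict (fun z =>
        if hz : z ∈ range (O.domRestrict f) then (e.symm ⟨z, hz⟩ : Y) else Classical.arbitrary Y)
        = fun z => (e.symm z : Y) := by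
      ext ⟨z, hz⟩; simp only [domRestrict_apply, dif_pos hz]
    rw [this]
    fun_prop
  · intro y hy
    have hz : f y ∈ range (O.domRestrict f) := ⟨⟨y, hy⟩, rfl⟩
    simp only [dif_pos hz]
    have : (⟨f y, hz⟩ : range (O.domRestrict f)) = e ⟨y, hy⟩ := Subtype.ext rfl
    rw [this, e.symm_apply_apply]

/-! ## Polygonal tilings with one tile -/

/-- A presentation of a cell structure with one 2-cell on `X`: the closed disk, viewed as an
`n`-gon, is mapped onto `X` by `ψ`, the vertices of the cell structure are the points of `V` and
its open edges are the members of `𝓔`. -/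
structure PolygonTiling {X : Type*} [TopologicalSpace X] (n : ℕ) (ψ : ℂ → X) (V : Set X)
    (𝓔 : Set (Set X)) : Prop extends IsDiskMap ψ where
  three_le : 3 ≤ n
  vertex : ∀ k : ℤ, ψ (polygonPoint n k) ∈ V
  vertex_surj : ∀ v ∈ V, ∃ k : ℤ, ψ (polygonPoint n k) = v
  edge : ∀ k : ℤ, ∃ E ∈ 𝓔, BijOn (fun θ => ψ (polygonPoint n θ)) (Ioo (k : ℝ) (k + 1)) E
  edge_surj : ∀ E ∈ 𝓔, ∃ k : ℤ, BijOn (fun θ => ψ (polygonPoint n θ)) (Ioo (k : ℝ) (k + 1)) E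
  disjoint_edges : 𝓔.PairwiseDisjoint id
  disjoint_vertices : ∀ E ∈ 𝓔, Disjoint V E

/-- The `k`-th side of the `n`-gon is mapped bijectively onto `E`. -/
def SideOver {X : Type*} (n : ℕ) (ψ : ℂ → X) (k : ℤ) (E : Set X) : Prop :=
  BijOn (fun θ => ψ (polygonPoint n θ)) (Ioo (k : ℝ) (k + 1)) E

namespace PolygonTiling

section General

variable {X : Type*} [TopologicalSpace X] {n : ℕ} {ψ : ℂ → X} {V : Set X} {𝓔 : Set (Set X)}

lemma n_ne_zero (h : PolygonTiling n ψ V 𝓔) : n ≠ 0 := by have := h.three_le; omega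

lemma periodic (h : PolygonTiling n ψ V 𝓔) (θ : ℝ) (k : ℤ) :
    ψ (polygonPoint n (θ + k * n)) = ψ (polygonPoint n θ) := by
  rw [polygonPoint_add_int_mul h.n_ne_zero]

lemma side_unique (h : PolygonTiling n ψ V 𝓔) {k : ℤ} {E : Set X} (hE : E ∈ 𝓔) {θ : ℝ}
    (hθ : θ ∈ Ioo (k : ℝ) (k + 1)) (hθE : ψ (polygonPoint n θ) ∈ E) : SideOver n ψ k E := by
  obtain ⟨E', hE', hk⟩ := h.edge k
  have : E' = E := h.disjoint_edges.elim hE' hE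
    (not_disjoint_iff.mpr ⟨_, hk.mapsTo hθ, hθE⟩)
  exact this ▸ hk

lemma exists_side (h : PolygonTiling n ψ V 𝓔) {E : Set X} (hE : E ∈ 𝓔) {θ : ℝ}
    (hθE : ψ (polygonPoint n θ) ∈ E) :
    ∃ k : ℤ, θ ∈ Ioo (k : ℝ) (k + 1) ∧ SideOver n ψ k E := by
  have hne : θ ≠ (⌊θ⌋ : ℝ) := by
    intro h'
    rw [h'] at hθE
    exact disjoint_left.mp (h.disjoint_vertices E hE) (h.vertex _) hθE
  have : θ ∈ Ioo (⌊θ⌋ : ℝ) (⌊θ⌋ + 1) :=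
    ⟨(Int.floor_le θ).lt_of_ne hne.symm, Int.lt_floor_add_one θ⟩
  exact ⟨_, this, h.side_unique hE this hθE⟩

lemma exists_int_of_mem (h : PolygonTiling n ψ V 𝓔) {θ : ℝ} (hθ : ψ (polygonPoint n θ) ∈ V) :
    ∃ k : ℤ, θ = k := by
  by_contra hne
  push Not at hne
  have hθ' : θ ∈ Ioo (⌊θ⌋ : ℝ) (⌊θ⌋ + 1) :=
    ⟨(Int.floor_le θ).lt_of_ne (hne _).symm, Int.lt_floor_add_one θ⟩
  obtain ⟨E, hE, hk⟩ := h.edge ⌊θ⌋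
  exact disjoint_left.mp (h.disjoint_vertices E hE) hθ (hk.mapsTo hθ')

lemma side_add (h : PolygonTiling n ψ V 𝓔) {k : ℤ} {E : Set X} (hk : SideOver n ψ k E) (q : ℤ) :
    SideOver n ψ (k + q * n) E := by
  obtain ⟨E', hE', hk'⟩ := h.edge (k + q * n)
  have key : BijOn (fun θ => ψ (polygonPoint n θ)) (Ioo ((k + q * n : ℤ) : ℝ)
      ((k + q * n : ℤ) + 1)) E := by
    have himg : (fun θ : ℝ => θ + q * n) '' Ioo (k : ℝ) (k + 1) =
        Ioo ((k + q * n : ℤ) : ℝ) ((k + q * n : ℤ) + 1) := by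
      rw [image_add_const_Ioo]; congr 1 <;> push_cast <;> ring
    rw [← himg]
    refine ⟨?_, ?_, ?_⟩
    · rintro _ ⟨θ, hθ, rfl⟩
      change ψ (polygonPoint n (θ + q * n)) ∈ E
      rw [h.periodic]; exact hk.mapsTo hθ
    · rintro _ ⟨θ, hθ, rfl⟩ _ ⟨η, hη, rfl⟩ he
      have he' : ψ (polygonPoint n (θ + q * n)) = ψ (polygonPoint n (η + q * n)) := he
      rw [h.periodic, h.periodic] at he'
      rw [hk.injOn hθ hη he']
    · intro x hx
      obtain ⟨θ, hθ, rfl⟩ := hk.surjOn hx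
      exact ⟨_, ⟨θ, hθ, rfl⟩, h.periodic θ q⟩
  exact key

end General

variable {n : ℕ} {ψ : ℂ → OnePoint ℂ} {V : Set (OnePoint ℂ)} {𝓔 : Set (Set (OnePoint ℂ))}

/-- If the gluing preserved the order, the pairs `x, y` and `x', y'` would cross. -/
lemma side_antitone (h : PolygonTiling n ψ V 𝓔) {j k : ℤ} {E : Set (OnePoint ℂ)}
    (hj : SideOver n ψ j E) (hjk : j < k) (hkn : k < j + n) {x x' y y' : ℝ}
    (hx : x ∈ Ioo (j : ℝ) (j + 1)) (hx' : x' ∈ Ioo (j : ℝ) (j + 1))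
    (hy : y ∈ Ioo (k : ℝ) (k + 1)) (hy' : y' ∈ Ioo (k : ℝ) (k + 1)) (hxx : x < x')
    (hxy : ψ (polygonPoint n x) = ψ (polygonPoint n y))
    (hxy' : ψ (polygonPoint n x') = ψ (polygonPoint n y')) : y' < y := by
  by_contra hle
  have hjk' : (j : ℝ) + 1 ≤ k := by exact_mod_cast hjk
  have hkn' : (k : ℝ) + 1 ≤ j + n := by exact_mod_cast hkn
  have hne : ψ (polygonPoint n x) ≠ ψ (polygonPoint n x') := fun h' => hxx.ne (hj.injOn hx hx' h')
  rcases (not_lt.mp hle).eq_or_lt with rfl | hlt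
  · exact hne (hxy.trans hxy'.symm)
  · exact hne (h.noncrossing hxx (by linarith [hx'.2, hy.1]) hlt (by linarith [hy'.2, hx.1])
      hxy hxy')

/-- The gluing of side `j` to side `l` reverses order, and so do the gluings of `j` to `k` and of
`k` to `l`; but the composite of the last two preserves it. -/
lemma not_three_sides (h : PolygonTiling n ψ V 𝓔) {j k l : ℤ} {E : Set (OnePoint ℂ)}
    (hj : SideOver n ψ j E) (hk : SideOver n ψ k E) (hl : SideOver n ψ l E)
    (hjk : j < k) (hkl : k < l) (hln : l < j + n) : False := by
  have hx : ((j : ℝ) + 1 / 3) ∈ Ioo (j : ℝ) (j + 1) := ⟨by linarith, by linarith⟩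
  have hx' : ((j : ℝ) + 2 / 3) ∈ Ioo (j : ℝ) (j + 1) := ⟨by linarith, by linarith⟩
  have hxx : ((j : ℝ) + 1 / 3) < j + 2 / 3 := by linarith
  obtain ⟨y, hy, hxy⟩ := hk.surjOn (hj.mapsTo hx)
  obtain ⟨y', hy', hxy'⟩ := hk.surjOn (hj.mapsTo hx')
  obtain ⟨z, hz, hxz⟩ := hl.surjOn (hj.mapsTo hx)
  obtain ⟨z', hz', hxz'⟩ := hl.surjOn (hj.mapsTo hx')
  have h1 := h.side_antitone hj hjk (by omega) hx hx' hy hy' hxx hxy.symm hxy'.symm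
  have h2 := h.side_antitone hj (hjk.trans hkl) hln hx hx' hz hz' hxx hxz.symm hxz'.symm
  have h3 := h.side_antitone hk hkl (by omega) hy' hy hz' hz h1 (hxy'.trans hxz'.symm)
    (hxy.trans hxz.symm)
  exact lt_asymm h2 h3

/-- By strict convexity of the disk, the open segment between two distinct points of it lies in the
open disk. So any part of the boundary circle may be added or left out without losing convexity. -/
lemma _root_.Lattes.convex_of_ball_subset {Ω : Set ℂ} (h1 : ball (0 : ℂ) 1 ⊆ Ω)
    (h2 : Ω ⊆ closedBall 0 1) : Convex ℝ Ω := by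
  rw [convex_iff_openSegment_subset]
  intro x hx y hy
  rcases eq_or_ne x y with rfl | hxy
  · simpa using hx
  · refine Subset.trans ?_ h1
    have := (strictConvex_closedBall ℝ (0 : ℂ) 1).openSegment_subset (h2 hx) (h2 hy) hxy
    rwa [interior_closedBall _ one_ne_zero] at this

/-- Every edge corresponds to at least two sides of the polygon. -/
lemma exists_second_side (h : PolygonTiling n ψ V 𝓔) {j : ℤ} {E : Set (OnePoint ℂ)} (hE : E ∈ 𝓔)
    (hj : SideOver n ψ j E) : ∃ k : ℤ, j < k ∧ k < j + n ∧ SideOver n ψ k E := by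
  by_contra hno
  push Not at hno
  have hn0 : (0 : ℤ) < n := by have := h.three_le; omega
  set a : ℝ := j + 1 / 2 with ha
  have haj : a ∈ Ioo (j : ℝ) (j + 1) := ⟨by linarith, by linarith⟩
  set x₁ := polygonPoint n a with hx₁
  set A : Set ℂ := polygonPoint n '' Ioo (j : ℝ) (j + 1) with hA
  have hx₁A : x₁ ∈ A := ⟨a, haj, rfl⟩
  have hAs : A ⊆ sphere 0 1 := by
    rintro _ ⟨θ, -, rfl⟩; exact polygonPoint_mem_sphere _ _
  -- If no other side lies over `E`, the whole preimage of `E` in the disk is the arc `A`. Then `ψ`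
  -- is injective on the open disk together with `A`.
  have hpre : ∀ z ∈ closedBall (0 : ℂ) 1, ψ z ∈ E → z ∈ A := by
    intro z hz hzE
    have hzs : ‖z‖ = 1 := by
      by_contra hne
      have hzb : z ∈ ball (0 : ℂ) 1 := by
        rw [mem_ball_zero_iff]; exact lt_of_le_of_ne (by simpa using hz) hne
      obtain ⟨θ, hθ, hθz⟩ := hj.surjOn hzE
      exact h.ne z hzb _ (polygonPoint_mem_sphere n θ) hθz.symm
    obtain ⟨θ, rfl⟩ := exists_polygonPoint_eq h.n_ne_zero hzs
    obtain ⟨k, hθk, hk⟩ := h.exists_side hE hzE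
    let q : ℤ := (k - j) / n
    have hk' : SideOver n ψ (k + (-q) * n) E := h.side_add hk (-q)
    have e1 : k + (-q) * n = j + (k - j) % n := by
      have := Int.mul_ediv_add_emod (k - j) n
      simp only [q]; linarith
    have e2 := Int.emod_nonneg (k - j) hn0.ne'
    have e3 := Int.emod_lt_of_pos (k - j) hn0
    have e4 : k + (-q) * n = j := by
      by_contra hne
      exact hno _ (by omega) (by omega) hk'
    have e5 : (k : ℝ) + (-q : ℤ) * n = j := by exact_mod_cast e4
    refine ⟨θ + (-q : ℤ) * n, ⟨by linarith [hθk.1], by linarith [hθk.2]⟩, ?_⟩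
    exact polygonPoint_add_int_mul h.n_ne_zero θ (-q)
  have hinjA : InjOn ψ A := by
    rintro _ ⟨θ, hθ, rfl⟩ _ ⟨η, hη, rfl⟩ he
    rw [hj.injOn hθ hη he]
  have hψA : ∀ z ∈ A, ψ z ∈ E := by
    rintro _ ⟨θ, hθ, rfl⟩; exact hj.mapsTo hθ
  set Ω : Set ℂ := ball 0 1 ∪ A with hΩ
  have hΩc : Ω ⊆ closedBall 0 1 :=
    union_subset ball_subset_closedBall (hAs.trans sphere_subset_closedBall)
  have hinjΩ : InjOn ψ Ω := by
    rintro z (hz | hz) w (hw | hw) he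
    · exact h.inj hz hw he
    · exact absurd he (h.ne z hz w (hAs hw))
    · exact absurd he.symm (h.ne w hw z (hAs hz))
    · exact hinjA hz hw he
  -- The image of a corner is not a value of `ψ` on `Ω`; sending it to `∞` turns `ψ` into an
  -- injective map `g` from `Ω` to the plane.
  obtain ⟨M, hM⟩ := exists_homeomorph_infty (ψ (polygonPoint n j))
  have hMΩ : ∀ z ∈ Ω, M (ψ z) ≠ OnePoint.infty := by
    intro z hz hzM
    have he := M.injective (hzM.trans hM.symm)
    rcases hz with hz | hz
    · exact h.ne z hz _ (polygonPoint_mem_sphere _ _) he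
    · exact disjoint_left.mp (h.disjoint_vertices E hE) (h.vertex j) (he ▸ hψA z hz)
  let g : ℂ → ℂ := fun z => toComplex (M (ψ z))
  have hg : ContinuousOn g Ω := fun z hz =>
    (continuousAt_toComplex (hMΩ z hz)).comp_continuousWithinAt (f := fun z => M (ψ z))
      ((M.continuous.comp_continuousOn (h.cont.mono hΩc)) z hz)
  have hginj : InjOn g Ω := by
    intro z hz w hw he
    apply hinjΩ hz hw
    apply M.injective
    rw [← coe_toComplex (hMΩ z hz), ← coe_toComplex (hMΩ w hw)]
    exact congrArg _ he
  have hx₁Ω : x₁ ∈ Ω := Or.inr hx₁A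
  have hx₁b : x₁ ∉ ball (0 : ℂ) 1 := by simp [x₁]
  -- As `x₁` is on the boundary, `Ω ∖ {x₁}` is still convex; this is how a boundary point differs
  -- from an interior one.
  obtain ⟨L, hL, hLe⟩ := exists_log_of_convex (Ω := Ω \ {x₁})
    (convex_of_ball_subset
      (fun z hz => ⟨Or.inl hz, fun he => hx₁b (he ▸ hz)⟩)
      (sdiff_subset.trans hΩc)) (g := fun z => g z - g x₁)
    ((hg.mono sdiff_subset).sub continuousOn_const)
    (fun z hz => sub_ne_zero.mpr fun he => hz.2 (hginj hz.1 hx₁Ω he))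
  -- a compact neighbourhood of `x₁` in the disk, contained in `Ω`
  obtain ⟨ρ, hρ, hρΩ⟩ : ∃ ρ > 0, closedBall (0 : ℂ) 1 ∩ ball x₁ ρ ⊆ Ω := by
    have hB : IsClosed (polygonPoint n '' Icc ((j : ℝ) + 1) (j + n)) :=
      (isCompact_Icc.image (continuous_polygonPoint n)).isClosed
    have hx₁B : x₁ ∉ polygonPoint n '' Icc ((j : ℝ) + 1) (j + n) := by
      rintro ⟨θ, hθ, he⟩
      obtain ⟨k, hk⟩ := (polygonPoint_eq_iff h.n_ne_zero).mp he
      have hn0' : (0 : ℝ) < n := by exact_mod_cast hn0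
      have h1 : (0 : ℝ) < k * n := by linarith [hθ.1, haj.2]
      have h2 : (0 : ℝ) < k := pos_of_mul_pos_left h1 hn0'.le
      have h3 : (1 : ℝ) ≤ k := by exact_mod_cast (by exact_mod_cast h2 : (0 : ℤ) < k)
      nlinarith [hθ.2, haj.1]
    obtain ⟨ρ, hρ, hρB⟩ := Metric.isOpen_iff.mp hB.isOpen_compl x₁ hx₁B
    refine ⟨ρ, hρ, ?_⟩
    rintro z ⟨hz, hzρ⟩
    by_cases hzb : z ∈ ball (0 : ℂ) 1
    · exact Or.inl hzb
    · right
      have hzs : ‖z‖ = 1 := by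
        have : z ∈ sphere (0 : ℂ) 1 := by
          rw [← closedBall_sdiff_ball]; exact ⟨hz, hzb⟩
        simpa using this
      obtain ⟨θ, rfl⟩ := exists_polygonPoint_eq h.n_ne_zero hzs
      have hn0' : (0 : ℝ) < n := by exact_mod_cast hn0
      obtain ⟨q, hq, -⟩ := existsUnique_add_zsmul_mem_Ioc hn0' θ (j : ℝ)
      rw [zsmul_eq_mul] at hq
      rw [← polygonPoint_add_int_mul h.n_ne_zero θ q] at hzρ ⊢
      refine ⟨_, ⟨hq.1, ?_⟩, rfl⟩
      by_contra hlt
      exact hρB hzρ ⟨_, ⟨not_lt.mp hlt, hq.2⟩, rfl⟩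
  -- `F` is the image of the part of the disk away from `x₁`. A small circle around `g x₁` avoids
  -- it, so the circle is covered by values of `g` near `x₁`.
  set F : Set (OnePoint ℂ) := ψ '' (closedBall 0 1 \ ball x₁ ρ) with hF
  have hFc : IsClosed F := (((isCompact_closedBall _ _).diff isOpen_ball).image_of_continuousOn
    (h.cont.mono sdiff_subset)).isClosed
  have hyF : ψ x₁ ∉ F := by
    rintro ⟨z, ⟨hz, hzρ⟩, he⟩
    have hzA : z ∈ A := hpre z hz (he ▸ hψA _ hx₁A)
    have : z = x₁ := hinjA hzA hx₁A he
    subst this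
    exact hzρ (mem_ball_self hρ)
  have hopen : IsOpen {u : ℂ | M.symm (u : OnePoint ℂ) ∉ F} :=
    hFc.isOpen_compl.preimage (M.symm.continuous.comp OnePoint.continuous_coe)
  have hgx : M.symm ((g x₁ : ℂ) : OnePoint ℂ) = ψ x₁ := by
    rw [coe_toComplex (hMΩ x₁ hx₁Ω)]; simp
  obtain ⟨r, hr, hrF⟩ := Metric.nhds_basis_closedBall.mem_iff.mp
    (hopen.mem_nhds (show g x₁ ∈ _ by rw [mem_ofPred_eq, hgx]; exact hyF))
  -- a continuous inverse of `g`
  have hemb : IsEmbedding (Ω.domRestrict g) := by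
    have h1 : IsEmbedding (Ω.domRestrict ψ) := by
      refine isEmbedding_domRestrict_of_isCompact (isCompact_closedBall (0 : ℂ) 1) h.cont hΩc
        hinjΩ ?_
      rintro x hx y hy hyΩ he
      rcases hx with hx | hx
      · have hys : y ∈ sphere (0 : ℂ) 1 := by
          rw [← closedBall_sdiff_ball]; exact ⟨hy, fun h' => hyΩ (Or.inl h')⟩
        exact h.ne x hx y hys he
      · exact hyΩ (Or.inr (hpre y hy (he ▸ hψA x hx)))
    have h2 : IsEmbedding (fun x : Ω => ((g x : ℂ) : OnePoint ℂ)) := by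
      have : (fun x : Ω => ((g x : ℂ) : OnePoint ℂ)) = M ∘ Ω.domRestrict ψ := by
        ext1 x; exact coe_toComplex (hMΩ x x.2)
      rw [this]
      exact M.isEmbedding.comp h1
    exact OnePoint.isOpenEmbedding_coe.isEmbedding.of_comp_iff.mp h2
  obtain ⟨G, hG, hGl⟩ := exists_continuousOn_leftInvOn hemb
  have hsph : ∀ u ∈ sphere (g x₁) r, ∃ z ∈ Ω \ {x₁}, g z = u := by
    intro u hu
    have huF := hrF (sphere_subset_closedBall hu)
    obtain ⟨z, hz, hzu⟩ := h.surj.symm ▸ mem_univ (M.symm (u : OnePoint ℂ))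
    have hzρ : z ∈ ball x₁ ρ := by
      by_contra hzρ
      exact huF ⟨z, ⟨hz, hzρ⟩, hzu⟩
    have hgz : g z = u := by simp [g, hzu]
    refine ⟨z, ⟨hρΩ ⟨hz, hzρ⟩, ?_⟩, hgz⟩
    rintro rfl
    rw [← hgz] at hu
    simp at hu
    exact hr.ne hu
  -- Composing `L` with the inverse `G` of `g` gives a logarithm of `u - g x₁` on a circle around `g
  -- x₁`.
  refine no_log_on_sphere (p := g x₁) (c := 1) hr (L := fun u => L (G u)) ?_ ?_
  · refine hL.comp (hG.mono fun u hu => ?_) (fun u hu => ?_)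
    · obtain ⟨z, hz, rfl⟩ := hsph u hu
      exact ⟨z, hz.1, rfl⟩
    · obtain ⟨z, hz, rfl⟩ := hsph u hu
      rw [hGl hz.1]; exact hz
  · intro u hu
    obtain ⟨z, hz, rfl⟩ := hsph u hu
    rw [hGl hz.1, hLe z hz, one_mul]

/-- Every edge corresponds to exactly two sides of the polygon. -/
lemma exists_two_sides (h : PolygonTiling n ψ V 𝓔) {j : ℤ} {E : Set (OnePoint ℂ)} (hE : E ∈ 𝓔)
    (hj : SideOver n ψ j E) : ∃ k : ℤ, j < k ∧ k < j + n ∧ SideOver n ψ k E ∧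
      ∀ m, SideOver n ψ m E → j ≤ m → m < j + n → m = j ∨ m = k := by
  obtain ⟨k, hjk, hkn, hk⟩ := h.exists_second_side hE hj
  refine ⟨k, hjk, hkn, hk, fun m hm hjm hmn => ?_⟩
  by_contra hne
  push Not at hne
  rcases lt_or_gt_of_ne hne.2 with h' | h'
  · exact h.not_three_sides hj hm hk (lt_of_le_of_ne hjm hne.1.symm) h' hkn
  · exact h.not_three_sides hj hk hm hjk h' hmn

lemma exists_rep (h : PolygonTiling n ψ V 𝓔) (j m : ℤ) :
    ∃ q : ℤ, j ≤ m + q * n ∧ m + q * n < j + n := by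
  have hn0 : (0 : ℤ) < n := by have := h.three_le; omega
  refine ⟨-((m - j) / n), ?_⟩
  have e1 : m + (-((m - j) / n)) * n = j + (m - j) % n := by
    have := Int.mul_ediv_add_emod (m - j) n
    linarith
  have e2 := Int.emod_nonneg (m - j) hn0.ne'
  have e3 := Int.emod_lt_of_pos (m - j) hn0
  omega

lemma vertex_periodic (h : PolygonTiling n ψ V 𝓔) (m q : ℤ) :
    ψ (polygonPoint n ((m + q * n : ℤ) : ℝ)) = ψ (polygonPoint n m) := by
  have := h.periodic (m : ℝ) q
  push_cast
  exact this

/-- Removing a point of an edge disconnects the 1-skeleton. -/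
lemma exists_cut (h : PolygonTiling n ψ V 𝓔) {E : Set (OnePoint ℂ)} (hE : E ∈ 𝓔) :
    ∃ s : Set (OnePoint ℂ), ∀ k : ℤ,
      (SideOver n ψ k E ↔
        ¬ (ψ (polygonPoint n k) ∈ s ↔ ψ (polygonPoint n ((k + 1 : ℤ) : ℝ)) ∈ s)) := by
  obtain ⟨j, hj⟩ : ∃ j, SideOver n ψ j E := h.edge_surj E hE
  obtain ⟨k, hjk, hkn, hk, huniq⟩ := h.exists_two_sides hE hj
  set a : ℝ := j + 1 / 2 with ha
  have haj : a ∈ Ioo (j : ℝ) (j + 1) := ⟨by linarith, by linarith⟩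
  obtain ⟨b, hb, hab⟩ := hk.surjOn (hj.mapsTo haj)
  have hab : ψ (polygonPoint n b) = ψ (polygonPoint n a) := hab
  have hjk' : (j : ℝ) + 1 ≤ k := by exact_mod_cast hjk
  have hkn' : (k : ℝ) + 1 ≤ j + n := by exact_mod_cast hkn
  -- The points `a` and `b` of the two sides over `E` are identified; the cut consists of the images
  -- of the boundary points between them.
  refine ⟨(fun θ => ψ (polygonPoint n θ)) '' Ioo a b, fun m => ?_⟩
  have hT : ∀ θ ∈ Ioo a b, ψ (polygonPoint n θ) ∈ (fun θ => ψ (polygonPoint n θ)) '' Ioo a b :=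
    fun θ hθ => ⟨θ, hθ, rfl⟩
  -- If a point beyond `b` had the same image as a point `t` of the arc, non-crossing would identify
  -- `t` with `a`. Then `t` would lie on one of the two sides over `E`, where only `a` and `b` have
  -- this image.
  have hF : ∀ θ : ℝ, b < θ → θ < a + n →
      ψ (polygonPoint n θ) ∉ (fun θ => ψ (polygonPoint n θ)) '' Ioo a b := by
    rintro θ hbθ hθ ⟨t, ht, htθ⟩
    have hat := h.noncrossing ht.1 ht.2 hbθ hθ hab.symm htθ
    obtain ⟨m, htm, hm⟩ := h.exists_side hE (hat ▸ hj.mapsTo haj)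
    have h1 : (j : ℝ) < m + 1 := by linarith [htm.2, ht.1, haj.1]
    have h2 : (m : ℝ) < k + 1 := by linarith [htm.1, ht.2, hb.2]
    have h1' : j < m + 1 := by exact_mod_cast h1
    have h2' : m < k + 1 := by exact_mod_cast h2
    rcases huniq m hm (by omega) (by omega) with rfl | rfl
    · exact ht.1.ne (hj.injOn haj htm hat)
    · exact ht.2.ne' (hk.injOn hb htm (hab.trans hat))
  obtain ⟨q, hq1, hq2⟩ := h.exists_rep j m
  have hside : SideOver n ψ m E ↔ SideOver n ψ (m + q * n) E := by
    refine ⟨fun h' => h.side_add h' q, fun h' => ?_⟩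
    have := h.side_add h' (-q)
    rwa [show m + q * n + -q * n = m by ring] at this
  rw [hside, ← h.vertex_periodic m q, ← h.vertex_periodic (m + 1) q,
    show m + 1 + q * n = (m + q * n) + 1 by ring]
  generalize m + q * n = m at hq1 hq2
  -- With `m` reduced to `[j, j + n)`, only the sides `j` and `k` contain an end of the chord; both
  -- ends of any other side lie on the same side of it.
  rcases lt_trichotomy m k with hmk | rfl | hmk
  · rcases hq1.eq_or_lt with rfl | hjm
    · simp only [hj, true_iff]
      have h1 : ψ (polygonPoint n (((j + 1 : ℤ)) : ℝ)) ∈ _ :=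
        hT _ ⟨by push_cast; exact haj.2, by push_cast; linarith [hb.1]⟩
      have h2 := hF (j + n) (by linarith [hb.2]) (by linarith [haj.1])
      have h3 : ψ (polygonPoint n ((j : ℝ) + n)) = ψ (polygonPoint n j) := by
        have := h.periodic j 1; simpa using this
      rw [h3] at h2
      tauto
    · have hjm' : (j : ℝ) + 1 ≤ m := by exact_mod_cast hjm
      have hmk' : (m : ℝ) + 1 ≤ k := by exact_mod_cast hmk
      have h1 := hT m ⟨by linarith [haj.2], by linarith [hb.1]⟩
      have h2 := hT ((m + 1 : ℤ) : ℝ) ⟨by push_cast; linarith [haj.2], by push_cast; linarith [hb.1]⟩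
      have h3 : ¬ SideOver n ψ m E := fun h' => by
        rcases huniq m h' hq1 hq2 with rfl | rfl <;> omega
      tauto
  · have h1 := hT m ⟨by linarith [haj.2], hb.1⟩
    have h2 := hF ((m + 1 : ℤ) : ℝ) (by push_cast; exact hb.2) (by push_cast; linarith [haj.1])
    tauto
  · have hmk' : (k : ℝ) + 1 ≤ m := by exact_mod_cast hmk
    have hmn' : (m : ℝ) + 1 ≤ j + n := by exact_mod_cast hq2
    have h1 := hF m (by linarith [hb.2]) (by linarith [haj.1])
    have h2 := hF ((m + 1 : ℤ) : ℝ) (by push_cast; linarith [hb.2])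
      (by push_cast; linarith [haj.1])
    have h3 : ¬ SideOver n ψ m E := fun h' => by
      rcases huniq m h' hq1 hq2 with rfl | rfl <;> omega
    tauto

/-- If both sides at a corner of the polygon lie over the same edge, then no other corner is
mapped to the same vertex. -/
lemma corner_unique (h : PolygonTiling n ψ V 𝓔) {k m : ℤ} {E : Set (OnePoint ℂ)} (hE : E ∈ 𝓔)
    (hk : SideOver n ψ k E) (hk' : SideOver n ψ (k - 1) E)
    (hm : ψ (polygonPoint n m) = ψ (polygonPoint n k)) : ∃ q : ℤ, m = k + q * n := by
  obtain ⟨q, hq1, hq2⟩ := h.exists_rep k m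
  rcases hq1.eq_or_lt with he | hlt
  · exact ⟨-q, by rw [he]; ring⟩
  exfalso
  have ha : ((k : ℝ) + 1 / 2) ∈ Ioo (k : ℝ) (k + 1) := ⟨by linarith, by linarith⟩
  -- The chord from `b` on side `k - 1` to the midpoint of side `k` cuts off corner `k` alone, so an
  -- identification of this corner with a different one would cross it.
  obtain ⟨b, hb, hab⟩ := hk'.surjOn (hk.mapsTo ha)
  push_cast at hb
  have h1 : ((k : ℝ) + 1) ≤ ((m + q * n : ℤ) : ℝ) := by exact_mod_cast hlt
  have h2 : ((m + q * n : ℤ) : ℝ) + 1 ≤ k + n := by exact_mod_cast hq2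
  have := h.noncrossing (a := b) (t := k) (b := k + 1 / 2) (s := ((m + q * n : ℤ) : ℝ))
    (by linarith [hb.2]) (by linarith) (by linarith) (by linarith [hb.1]) hab
    (by rw [h.vertex_periodic, hm])
  refine disjoint_left.mp (h.disjoint_vertices E hE) (h.vertex k) ?_
  rw [← this]
  exact hk'.mapsTo (by push_cast; exact hb)

end PolygonTiling

/-! ### CW structures with one tile and their polygonal presentation -/

section CWBasics

variable {X : Type*} [TopologicalSpace X]

/-- The set of vertices of a CW structure. -/
def vertexSet (K : Topology.CWComplex (univ : Set X)) : Set X := range (vertexPoint K)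

/-- The set of open edges of a CW structure. -/
def edgeSets (K : Topology.CWComplex (univ : Set X)) : Set (Set X) := range (openCell K 1)

lemma openCell_zero (K : Topology.CWComplex (univ : Set X)) (v : Cell K 0) :
    openCell K 0 v = {vertexPoint K v} := by
  let := K
  exact RelCWComplex.openCell_zero_eq_singleton

lemma vertexPoint_injective (K : Topology.CWComplex (univ : Set X)) :
    Function.Injective (vertexPoint K) := by
  let := K
  exact RelCWComplex.injective_map_zero (univ : Set X)

lemma openCell_nonempty (K : Topology.CWComplex (univ : Set X)) {n : ℕ} (c : Cell K n) :
    (openCell K n c).Nonempty := by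
  let := K
  exact RelCWComplex.openCell_nonempty n c

lemma eq_of_mem_openCell (K : Topology.CWComplex (univ : Set X)) {n m : ℕ} {c : Cell K n}
    {d : Cell K m} {x : X} (hc : x ∈ openCell K n c) (hd : x ∈ openCell K m d) :
    (⟨n, c⟩ : Σ n, Cell K n) = ⟨m, d⟩ := by
  let := K
  by_contra hne
  exact disjoint_left.mp (RelCWComplex.disjoint_openCell_of_ne hne) hc hd

lemma dim_eq_of_mem_openCell (K : Topology.CWComplex (univ : Set X)) {n m : ℕ} {c : Cell K n}
    {d : Cell K m} {x : X} (hc : x ∈ openCell K n c) (hd : x ∈ openCell K m d) : n = m :=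
  congrArg Sigma.fst (eq_of_mem_openCell K hc hd)

lemma cell_eq_of_mem_openCell (K : Topology.CWComplex (univ : Set X)) {n : ℕ} {c d : Cell K n}
    {x : X} (hc : x ∈ openCell K n c) (hd : x ∈ openCell K n d) : c = d := by
  have := eq_of_mem_openCell K hc hd
  simpa using this

lemma exists_mem_openCell (K : Topology.CWComplex (univ : Set X)) (x : X) :
    ∃ n, ∃ c : Cell K n, x ∈ openCell K n c := by
  let := K
  have h := CWComplex.iUnion_openCell_eq_complex (C := (univ : Set X))
  have hx : x ∈ ⋃ (n : ℕ) (j : Cell K n), openCell K n j := by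
    rw [h]; trivial
  simpa using hx

lemma exists_mem_openCell_le (K : Topology.CWComplex (univ : Set X)) (hK : IsFiniteTwoDimensional K)
    (x : X) : ∃ n ≤ 2, ∃ c : Cell K n, x ∈ openCell K n c := by
  obtain ⟨n, c, hx⟩ := exists_mem_openCell K x
  refine ⟨n, ?_, c, hx⟩
  by_contra hn
  exact (hK.2 n (by omega)).false c

/-- An open cell has a neighbourhood which meets no other open cell of at most the same
dimension. -/
lemma exists_isOpen_openCell [T2Space X] (K : Topology.CWComplex (univ : Set X))
    (hK : IsFiniteTwoDimensional K) {n : ℕ} (c : Cell K n) :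
    ∃ O : Set X, IsOpen O ∧ openCell K n c ⊆ O ∧ ∀ m (d : Cell K m), m ≤ n → ∀ x ∈ O,
      x ∈ openCell K m d → (⟨m, d⟩ : Σ n, Cell K n) = ⟨n, c⟩ := by
  let := K
  have := hK.1 n
  -- Remove the lower skeleton and the other closed cells of the same dimension. The latter are
  -- finite in number, so a closed set is removed.
  refine ⟨((RelCWComplex.skeletonLT (univ : Set X) n : Set X) ∪
    ⋃ d : {d : Cell K n // d ≠ c}, closedCell K n d)ᶜ, ?_, ?_, ?_⟩
  · refine (IsClosed.union (RelCWComplex.Subcomplex.closed _) ?_).isOpen_compl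
    exact isClosed_iUnion_of_finite fun d => RelCWComplex.isClosed_closedCell
  · intro x hx hx'
    rcases hx' with hx' | hx'
    · exact disjoint_left.mp (RelCWComplex.disjoint_skeletonLT_openCell (le_refl _)) hx' hx
    · obtain ⟨⟨d, hd⟩, hxd⟩ := mem_iUnion.mp hx'
      change x ∈ RelCWComplex.closedCell n d at hxd
      rw [← RelCWComplex.cellFrontier_union_openCell_eq_closedCell] at hxd
      rcases hxd with hxd | hxd
      · exact disjoint_left.mp (RelCWComplex.disjoint_skeletonLT_openCell (le_refl _))
          (RelCWComplex.cellFrontier_subset_skeletonLT n d hxd) hx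
      · exact hd (cell_eq_of_mem_openCell K hxd hx)
  · intro m d hmn x hxO hxd
    by_contra hne
    apply hxO
    rcases hmn.lt_or_eq with h | rfl
    · left
      have h1 := RelCWComplex.openCell_subset_skeletonLT m d hxd
      exact RelCWComplex.skeletonLT_mono (by exact_mod_cast h) h1
    · right
      refine mem_iUnion.mpr ⟨⟨d, fun h => hne (by rw [h])⟩, ?_⟩
      exact RelCWComplex.openCell_subset_closedCell m d hxd

lemma cellFrontier_eq [T2Space X] (K : Topology.CWComplex (univ : Set X)) {n : ℕ} (c : Cell K n) :
    letI := K
    RelCWComplex.cellFrontier (C := (univ : Set X)) n c =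
      closure (openCell K n c) \ openCell K n c := by
  let := K
  change _ = closure (RelCWComplex.openCell n c) \ RelCWComplex.openCell n c
  rw [RelCWComplex.closure_openCell_eq_closedCell,
    ← RelCWComplex.cellFrontier_union_openCell_eq_closedCell, union_sdiff_right]
  refine (Disjoint.sdiff_eq_left ?_).symm
  exact (RelCWComplex.disjoint_skeletonLT_openCell (le_refl (n : ℕ∞))).mono_left
    (RelCWComplex.cellFrontier_subset_skeletonLT n c)

/-- A finite CW structure of dimension at most two with exactly one 2-cell, which has a tile type
and whose closure is the whole space. -/
structure IsOneTile (K : Topology.CWComplex (univ : Set X)) : Prop where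
  finite : IsFiniteTwoDimensional K
  pure : ⋃ c, closedCell K 2 c = univ
  hasTileType : ∀ c, HasTileType K c
  card : Nat.card (Cell K 2) = 1

lemma polygonVertex_eq (n k : ℕ) : polygonVertex n k = polygonPoint n k := by
  simp [polygonVertex, polygonPoint]

lemma polygonEdge_eq (n k : ℕ) : polygonEdge n k = polygonPoint n '' Ioo (k : ℝ) (k + 1) := by
  have : Ioo (k : ℝ) (k + 1) = (fun t : ℝ => (k : ℝ) + t) '' Ioo 0 1 := by
    rw [image_const_add_Ioo]; simp
  rw [this, image_image]
  simp [polygonEdge, polygonPoint]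

lemma injOn_polygonPoint {n : ℕ} (hn : 1 ≤ n) (a : ℝ) : InjOn (polygonPoint n) (Ioo a (a + 1)) := by
  intro θ hθ η hη h
  obtain ⟨k, hk⟩ := (polygonPoint_eq_iff (by omega)).mp h
  have hn' : (1 : ℝ) ≤ n := by exact_mod_cast hn
  have hk0 : k = 0 := by
    by_contra hne
    rcases lt_or_gt_of_ne hne with h' | h'
    · have : (k : ℝ) ≤ -1 := by exact_mod_cast (by omega : k ≤ -1)
      nlinarith [hθ.1, hη.2]
    · have : (1 : ℝ) ≤ k := by exact_mod_cast h'
      nlinarith [hθ.2, hη.1]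
  simpa [hk0] using hk

/-- A CW structure with one tile is presented by a polygon. -/
lemma IsOneTile.exists_polygonTiling [T2Space X] {K : Topology.CWComplex (univ : Set X)}
    (hK : IsOneTile K) : ∃ n ψ, PolygonTiling n ψ (vertexSet K) (edgeSets K) := by
  obtain ⟨⟨c⟩, hsub⟩ : Nonempty (Cell K 2) ∧ Subsingleton (Cell K 2) := by
    obtain ⟨h1, h2⟩ := Nat.card_eq_one_iff_unique.mp hK.card
    exact ⟨h2, h1⟩
  obtain ⟨n, hn, ψ, hcont, hball, hedge, hvert⟩ := hK.hasTileType c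
  have hn0 : n ≠ 0 := by omega
  have hnpos : (0 : ℤ) < n := by omega
  refine ⟨n, ψ, ?_⟩
  -- `HasTileType` speaks only of indices below `n`, whereas a `PolygonTiling` is indexed by `ℤ`,
  -- periodically.
  have hred : ∀ m : ℤ, ∃ k < n, ∃ q : ℤ, m = k + q * n := by
    intro m
    refine ⟨(m % n).toNat, ?_, m / n, ?_⟩
    · have := Int.emod_lt_of_pos m hnpos
      have := Int.emod_nonneg m hnpos.ne'
      omega
    · have := Int.emod_nonneg m hnpos.ne'
      rw [Int.toNat_of_nonneg this]
      have := Int.mul_ediv_add_emod m n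
      linarith
  have hper : ∀ (θ : ℝ) (q : ℤ), polygonPoint n (θ + q * n) = polygonPoint n θ :=
    polygonPoint_add_int_mul hn0
  have hV : ∀ m : ℤ, ∃ v, ψ (polygonPoint n m) = vertexPoint K v := by
    intro m
    obtain ⟨k, hk, q, rfl⟩ := hred m
    obtain ⟨v, hv⟩ := hvert k hk
    refine ⟨v, ?_⟩
    rw [← hv, polygonVertex_eq]
    push_cast
    rw [hper]
  have hE : ∀ m : ℤ, ∃ e : Cell K 1,
      BijOn (fun θ => ψ (polygonPoint n θ)) (Ioo (m : ℝ) (m + 1)) (openCell K 1 e) := by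
    intro m
    obtain ⟨k, hk, q, rfl⟩ := hred m
    obtain ⟨e, hemb, himg⟩ := hedge k hk
    have hinj := injOn_iff_injective.mpr hemb.injective
    rw [polygonEdge_eq] at hinj himg
    have h1 : Ioo (((k + q * n : ℤ)) : ℝ) ((k + q * n : ℤ) + 1) =
        (fun θ : ℝ => θ + q * n) '' Ioo (k : ℝ) (k + 1) := by
      rw [image_add_const_Ioo]; push_cast; congr 1; ring
    refine ⟨e, ?_⟩
    rw [h1]
    have himg' : (fun θ => ψ (polygonPoint n θ)) '' ((fun θ : ℝ => θ + q * n) ''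
        Ioo (k : ℝ) (k + 1)) = openCell K 1 e := by
      rw [image_image, ← himg, image_image]
      simp only [hper]
    rw [← himg']
    refine InjOn.bijOn_image ?_
    rintro _ ⟨θ, hθ, rfl⟩ _ ⟨η, hη, rfl⟩ he
    simp only [hper] at he
    rw [injOn_polygonPoint (by omega) _ hθ hη (hinj ⟨θ, hθ, rfl⟩ ⟨η, hη, rfl⟩ he)]
  have hfl : ∀ θ : ℝ, (∃ m : ℤ, θ = m) ∨ ∃ m : ℤ, θ ∈ Ioo (m : ℝ) (m + 1) := by
    intro θ
    by_cases h : θ = ⌊θ⌋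
    · exact Or.inl ⟨_, h⟩
    · exact Or.inr ⟨⌊θ⌋, (Int.floor_le θ).lt_of_ne (Ne.symm h), Int.lt_floor_add_one θ⟩
  have hcell2 : ∀ z ∈ ball (0 : ℂ) 1, ψ z ∈ openCell K 2 c := fun z hz =>
    hball.2 ▸ mem_image_of_mem ψ hz
  have hsurj : ψ '' closedBall 0 1 = univ := by
    refine eq_univ_of_univ_subset ?_
    have hcl : IsClosed (ψ '' closedBall 0 1) :=
      ((isCompact_closedBall _ _).image_of_continuousOn hcont).isClosed
    -- This is where purity and the uniqueness of the 2-cell enter.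
    have h1 : closedCell K 2 c = univ := by
      rw [← hK.pure]
      refine subset_antisymm (subset_iUnion (closedCell K 2) c) (iUnion_subset fun d => ?_)
      rw [Subsingleton.elim d c]
    rw [← h1]
    let := K
    change RelCWComplex.closedCell 2 c ⊆ _
    rw [← RelCWComplex.closure_openCell_eq_closedCell]
    refine closure_minimal ?_ hcl
    change openCell K 2 c ⊆ _
    rw [← hball.2]
    exact image_mono ball_subset_closedBall
  have hsph : ∀ x : X, x ∉ openCell K 2 c → ∃ θ, ψ (polygonPoint n θ) = x := by
    intro x hx
    obtain ⟨z, hz, rfl⟩ := hsurj.symm ▸ mem_univ x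
    have hzs : ‖z‖ = 1 := by
      have : z ∈ sphere (0 : ℂ) 1 := by
        rw [← closedBall_sdiff_ball]; exact ⟨hz, fun h => hx (hcell2 z h)⟩
      simpa using this
    obtain ⟨θ, rfl⟩ := exists_polygonPoint_eq hn0 hzs
    exact ⟨θ, rfl⟩
  have hvmem : ∀ v, vertexPoint K v ∈ openCell K 0 v := fun v => by simp [openCell_zero]
  refine ⟨⟨hcont, injOn_iff_injective.mpr hball.1.injective, hsurj, ?_⟩, hn, fun k => ?_, ?_,
    fun k => ?_, ?_, ?_, ?_⟩
  · intro z hz w hw he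
    obtain ⟨θ, rfl⟩ := exists_polygonPoint_eq hn0 (by simpa using hw : ‖w‖ = 1)
    have h2 := hcell2 z hz
    rw [he] at h2
    rcases hfl θ with ⟨m, rfl⟩ | ⟨m, hm⟩
    · obtain ⟨v, hv⟩ := hV m
      rw [hv] at h2
      have := dim_eq_of_mem_openCell K h2 (hvmem v)
      omega
    · obtain ⟨e, he'⟩ := hE m
      have := dim_eq_of_mem_openCell K h2 (he'.mapsTo hm)
      omega
  · obtain ⟨v, hv⟩ := hV k
    exact ⟨v, hv.symm⟩
  · rintro _ ⟨v, rfl⟩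
    obtain ⟨θ, hθ⟩ := hsph (vertexPoint K v) (fun h => by
      have := dim_eq_of_mem_openCell K h (hvmem v)
      omega)
    rcases hfl θ with ⟨m, rfl⟩ | ⟨m, hm⟩
    · exact ⟨m, hθ⟩
    · obtain ⟨e, he'⟩ := hE m
      have h1 := he'.mapsTo hm
      simp only [hθ] at h1
      have := dim_eq_of_mem_openCell K h1 (hvmem v)
      omega
  · obtain ⟨e, he⟩ := hE k
    exact ⟨_, ⟨e, rfl⟩, he⟩
  · rintro _ ⟨e, rfl⟩
    obtain ⟨x, hx⟩ := openCell_nonempty K e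
    obtain ⟨θ, rfl⟩ := hsph x (fun h => by
      have := dim_eq_of_mem_openCell K h hx
      omega)
    rcases hfl θ with ⟨m, rfl⟩ | ⟨m, hm⟩
    · obtain ⟨v, hv⟩ := hV m
      rw [hv] at hx
      have := dim_eq_of_mem_openCell K hx (hvmem v)
      omega
    · obtain ⟨e', he'⟩ := hE m
      rw [cell_eq_of_mem_openCell K hx (he'.mapsTo hm)]
      exact ⟨m, he'⟩
  · rintro _ ⟨e, rfl⟩ _ ⟨e', rfl⟩ hne
    refine disjoint_left.mpr fun x hx hx' => hne ?_
    rw [cell_eq_of_mem_openCell K hx hx']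
  · rintro _ ⟨e, rfl⟩
    refine disjoint_left.mpr ?_
    rintro _ ⟨v, rfl⟩ hx
    have := dim_eq_of_mem_openCell K hx (hvmem v)
    omega

/-- The closed side is compact, so its image is the closure of the edge; the two corners go to
vertices, which lie outside the edge. -/
lemma PolygonTiling.closure_diff [T2Space X] {n : ℕ} {ψ : ℂ → X} {V : Set X} {𝓔 : Set (Set X)}
    (h : PolygonTiling n ψ V 𝓔) {k : ℤ} {E : Set X} (hE : E ∈ 𝓔) (hk : SideOver n ψ k E) :
    closure E \ E = {ψ (polygonPoint n k), ψ (polygonPoint n ((k + 1 : ℤ) : ℝ))} := by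
  have hφ : Continuous fun θ => ψ (polygonPoint n θ) :=
    h.cont.comp_continuous (continuous_polygonPoint n) (polygonPoint_mem_closedBall n)
  have hcl : closure E = (fun θ => ψ (polygonPoint n θ)) '' Icc (k : ℝ) (k + 1) := by
    rw [← hk.image_eq]
    refine subset_antisymm ?_ ?_
    · exact closure_minimal (image_mono Ioo_subset_Icc_self) (isCompact_Icc.image hφ).isClosed
    · rw [← closure_Ioo (by simp : (k : ℝ) ≠ k + 1)]
      exact image_closure_subset_closure_image hφ
  have hsplit : Icc (k : ℝ) (k + 1) = Ioo (k : ℝ) (k + 1) ∪ {(k : ℝ), (k : ℝ) + 1} :=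
    (Ioo_union_both (by linarith)).symm
  have hd : Disjoint ({ψ (polygonPoint n k), ψ (polygonPoint n ((k + 1 : ℤ) : ℝ))} : Set X) E := by
    refine (h.disjoint_vertices E hE).mono_left ?_
    rintro x (rfl | rfl) <;> exact h.vertex _
  rw [hcl, hsplit, image_union, hk.image_eq, union_sdiff_left, image_pair]
  push_cast at hd ⊢
  exact hd.sdiff_eq_left

/-- Links in the 1-skeleton are defined by the frontiers of the 1-cells. A frontier depends only on
the open cell, so it can be read off from any side over it instead of the characteristic map chosen
in `K`. -/
lemma isLink_iff_of_sideOver [T2Space X] (K : Topology.CWComplex (univ : Set X)) {n : ℕ} {ψ : ℂ → X}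
    (h : PolygonTiling n ψ (vertexSet K) (edgeSets K)) {k : ℤ} {e : Cell K 1}
    (hk : SideOver n ψ k (openCell K 1 e)) (x y : Cell K 0) :
    (oneSkeleton K).IsLink e x y ↔
      ({ψ (polygonPoint n k), ψ (polygonPoint n ((k + 1 : ℤ) : ℝ))} : Set X) =
        {vertexPoint K x, vertexPoint K y} := by
  let := K
  rw [← h.closure_diff ⟨e, rfl⟩ hk, ← cellFrontier_eq K e]
  exact CWComplex.OneSkeletonGraph.isLink_iff_pair e x y

end CWBasics

/-! ## Construction of CW structures -/

/-- A finite CW structure of dimension at most two from its characteristic maps. -/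
lemma exists_cwComplex.{u} {X : Type u} [TopologicalSpace X] [T2Space X] (cell : ℕ → Type u)
    (hfin : ∀ n, Finite (cell n)) (hempty : ∀ n, 2 < n → IsEmpty (cell n))
    (g : ∀ n, cell n → (Fin n → ℝ) → X)
    (hcont : ∀ n c, ContinuousOn (g n c) (closedBall 0 1))
    (hinj : ∀ n c, InjOn (g n c) (ball 0 1))
    (hbd : ∀ n c, ∀ x ∈ sphere (0 : Fin n → ℝ) 1, ∃ m < n, ∃ d : cell m,
      g n c x ∈ g m d '' ball 0 1)
    (hdisj : ∀ n (c : cell n) m (d : cell m), ∀ x ∈ ball 0 1, ∀ y ∈ ball 0 1,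
      g n c x = g m d y → (⟨n, c⟩ : Σ n, cell n) = ⟨m, d⟩)
    (hcover : ∀ x, ∃ n c, x ∈ g n c '' ball 0 1) :
    ∃ K : Topology.CWComplex (univ : Set X), IsFiniteTwoDimensional K ∧
      ∃ e : ∀ n, Cell K n ≃ cell n, ∀ n c, openCell K n c = g n (e n c) '' ball 0 1 := by
  have hemb : ∀ n c, IsEmbedding ((ball 0 1).domRestrict (g n c)) := by
    intro n c
    refine isEmbedding_domRestrict_of_isCompact (isCompact_closedBall 0 1) (hcont n c)
      ball_subset_closedBall (hinj n c) ?_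
    intro x hx y hy hyb he
    have hys : y ∈ sphere (0 : Fin n → ℝ) 1 := by
      rw [← closedBall_sdiff_ball]; exact ⟨hy, hyb⟩
    obtain ⟨m, hm, d, z, hz, hzy⟩ := hbd n c y hys
    have := congrArg Sigma.fst (hdisj n c m d x hx z hz (he.trans hzy.symm))
    exact hm.ne' this
  choose G hG hGl using fun n c => exists_continuousOn_leftInvOn (hemb n c)
  let Φ : ∀ n, cell n → PartialEquiv (Fin n → ℝ) X := fun n c =>
    { toFun := g n c
      invFun := G n c
      source := ball 0 1
      target := g n c '' ball 0 1
      map_source' := fun x hx => mem_image_of_mem _ hx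
      map_target' := by
        rintro _ ⟨x, hx, rfl⟩
        rw [hGl n c hx]; exact hx
      left_inv' := fun x hx => hGl n c hx
      right_inv' := by
        rintro _ ⟨x, hx, rfl⟩
        rw [hGl n c hx] }
  let K : Topology.CWComplex (univ : Set X) :=
    CWComplex.mkFinite univ cell Φ
      (eventually_atTop.mpr ⟨3, fun n hn => hempty n (by omega)⟩) hfin (fun n c => rfl) hcont hG
      (by
        rintro ⟨n, c⟩ - ⟨m, d⟩ - hne
        refine disjoint_left.mpr ?_
        rintro _ ⟨x, hx, rfl⟩ ⟨y, hy, hxy⟩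
        exact hne (hdisj n c m d x hx y hy hxy.symm))
      (by
        intro n c x hx
        obtain ⟨m, hm, d, hd⟩ := hbd n c x hx
        simp only [mem_iUnion]
        exact ⟨m, hm, d, image_mono ball_subset_closedBall hd⟩)
      (by
        refine eq_univ_of_forall fun x => ?_
        obtain ⟨n, c, hx⟩ := hcover x
        simp only [mem_iUnion]
        exact ⟨n, c, image_mono ball_subset_closedBall hx⟩)
  exact ⟨K, ⟨hfin, hempty⟩, fun n => Equiv.refl _, fun n c => rfl⟩

/-- Characteristic maps of 2-cells live on the sup-norm ball of `Fin 2 → ℝ`, the tile on the round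
disk. A linear isomorphism carries the square to a bounded convex set with interior, which is then
mapped to the unit ball. -/
lemma exists_homeomorph_cube_disk : ∃ H : (Fin 2 → ℝ) ≃ₜ ℂ,
    H '' ball 0 1 = ball 0 1 ∧ H '' closedBall 0 1 = closedBall 0 1 := by
  have hrank : Module.finrank ℝ (Fin 2 → ℝ) = Module.finrank ℝ ℂ := by simp
  let L : (Fin 2 → ℝ) ≃L[ℝ] ℂ := ContinuousLinearEquiv.ofFinrankEq hrank
  have hopen : IsOpen (L '' ball 0 1) := L.toHomeomorph.isOpenMap _ isOpen_ball
  have hcl : closure (L '' ball 0 1) = L '' closedBall 0 1 := by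
    rw [← closure_ball (0 : Fin 2 → ℝ) one_ne_zero]
    exact (L.toHomeomorph.image_closure _).symm
  obtain ⟨h, h1, h2, -⟩ := exists_homeomorph_image_interior_closure_frontier_eq_unitBall
    (s := L '' ball 0 1) ((convex_ball 0 1).linear_image L.toLinearMap)
    (by rw [hopen.interior_eq]; exact ⟨L 0, mem_image_of_mem _ (mem_ball_self one_pos)⟩)
    (((isCompact_closedBall (0 : Fin 2 → ℝ) 1).image L.continuous).isBounded.subset
      (image_mono ball_subset_closedBall))
  refine ⟨L.toHomeomorph.trans h, ?_, ?_⟩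
  · have : (L.toHomeomorph.trans h : (Fin 2 → ℝ) → ℂ) = h ∘ L := rfl
    rw [this, image_comp, ← h1, hopen.interior_eq]
  · have : (L.toHomeomorph.trans h : (Fin 2 → ℝ) → ℂ) = h ∘ L := rfl
    rw [this, image_comp, ← h2, hcl]

/-- The types of cells of a cell structure with vertices `V`, edges `𝓔` and one tile. -/
def tilingCell.{u} {X : Type u} (V : Set X) (𝓔 : Set (Set X)) : ℕ → Type u
  | 0 => V
  | 1 => 𝓔
  | 2 => PUnit
  | _ + 3 => PEmpty

lemma mem_ball_fin_one {s : Fin 1 → ℝ} : s ∈ ball (0 : Fin 1 → ℝ) 1 ↔ s 0 ∈ Ioo (-1 : ℝ) 1 := by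
  rw [mem_ball_zero_iff, pi_norm_lt_iff one_pos]
  simp [abs_lt]

lemma mem_sphere_fin_one {s : Fin 1 → ℝ} (hs : s ∈ sphere (0 : Fin 1 → ℝ) 1) :
    s 0 = 1 ∨ s 0 = -1 := by
  have : ‖s‖ = |s 0| := by simp [Pi.norm_def]
  rw [mem_sphere_zero_iff_norm, this] at hs
  exact (abs_eq zero_le_one).mp hs

/-- The converse of `IsOneTile.exists_polygonTiling`: a polygon whose boundary identifications have
been modified is again a CW structure. -/
lemma PolygonTiling.exists_isOneTile {X : Type*} [TopologicalSpace X] [T2Space X] {n : ℕ}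
    {ψ : ℂ → X} {V : Set X} {𝓔 : Set (Set X)} (h : PolygonTiling n ψ V 𝓔) :
    ∃ K : Topology.CWComplex (univ : Set X), IsOneTile K ∧ vertexSet K = V ∧ edgeSets K = 𝓔 := by
  obtain ⟨H, hH1, hH2⟩ := exists_homeomorph_cube_disk
  have hHs : ∀ x ∈ sphere (0 : Fin 2 → ℝ) 1, H x ∈ sphere (0 : ℂ) 1 := by
    intro x hx
    rw [← closedBall_sdiff_ball] at hx ⊢
    refine ⟨hH2 ▸ mem_image_of_mem _ hx.1, fun hb => hx.2 ?_⟩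
    rw [← hH1] at hb
    exact H.injective.mem_set_image.mp hb
  have hφ : Continuous fun θ => ψ (polygonPoint n θ) :=
    h.cont.comp_continuous (continuous_polygonPoint n) (polygonPoint_mem_closedBall n)
  have hn0 := h.n_ne_zero
  choose κ hκ using h.edge_surj
  -- For each edge one side over it is chosen; `γ` parametrizes that side affinely by `[-1, 1]`.
  let γ : ∀ E : 𝓔, (Fin 1 → ℝ) → ℝ := fun E s => κ E E.2 + (s 0 + 1) / 2
  have hγball : ∀ E : 𝓔, γ E '' ball 0 1 = Ioo (κ E E.2 : ℝ) (κ E E.2 + 1) := by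
    intro E
    ext θ
    constructor
    · rintro ⟨s, hs, rfl⟩
      rw [mem_ball_fin_one] at hs
      constructor <;> simp only [γ] <;> linarith [hs.1, hs.2]
    · intro hθ
      refine ⟨fun _ => 2 * (θ - κ E E.2) - 1, ?_, by simp [γ]⟩
      rw [mem_ball_fin_one]
      constructor <;> linarith [hθ.1, hθ.2]
  let g : ∀ m, tilingCell V 𝓔 m → (Fin m → ℝ) → X := fun m =>
    match m with
    | 0 => fun v _ => (v : V).1
    | 1 => fun E s => ψ (polygonPoint n (γ E s))
    | 2 => fun _ x => ψ (H x)
    | _ + 3 => fun c => PEmpty.elim c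
  have hg0 : ∀ v : V, g 0 v '' ball 0 1 = {v.1} := fun v => by
    have : (ball (0 : Fin 0 → ℝ) 1).Nonempty := ⟨0, mem_ball_self one_pos⟩
    exact this.image_const v.1
  have hg1 : ∀ E : 𝓔, g 1 E '' ball 0 1 = E.1 := fun E => by
    have : g 1 E = (fun θ => ψ (polygonPoint n θ)) ∘ γ E := rfl
    rw [this, image_comp, hγball]
    exact (hκ E.1 E.2).image_eq
  have hg2 : ∀ c, g 2 c '' ball 0 1 = ψ '' ball 0 1 := fun c => by
    have : g 2 c = ψ ∘ H := rfl
    rw [this, image_comp, hH1]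
  have hVfin : V.Finite := by
    refine ((Set.finite_Ico (0 : ℤ) n).image fun k : ℤ => ψ (polygonPoint n k)).subset ?_
    intro v hv
    obtain ⟨k, rfl⟩ := h.vertex_surj v hv
    have hnpos : (0 : ℤ) < n := by omega
    refine ⟨k % n, ⟨Int.emod_nonneg k hnpos.ne', Int.emod_lt_of_pos k hnpos⟩, ?_⟩
    have e : (k : ℝ) = ((k % n : ℤ) : ℝ) + ((k / n : ℤ) : ℝ) * n := by
      have := Int.mul_ediv_add_emod k n
      have : k = k % n + (k / n) * n := by linarith
      exact_mod_cast this
    change ψ (polygonPoint n ((k % n : ℤ) : ℝ)) = ψ (polygonPoint n k)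
    rw [e, h.periodic]
  have hEfin : 𝓔.Finite := by
    refine ((Set.finite_Ico (0 : ℤ) n).image fun k : ℤ =>
      (fun θ => ψ (polygonPoint n θ)) '' Ioo (k : ℝ) (k + 1)).subset ?_
    intro E hE
    obtain ⟨k, hk⟩ := h.edge_surj E hE
    have hnpos : (0 : ℤ) < n := by omega
    refine ⟨k % n, ⟨Int.emod_nonneg k hnpos.ne', Int.emod_lt_of_pos k hnpos⟩, ?_⟩
    have e : k % n = k + (-(k / n)) * n := by
      have := Int.mul_ediv_add_emod k n
      linarith
    have := h.side_add hk (-(k / n))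
    rw [← e] at this
    exact this.image_eq
  have hsph : ∀ z ∈ sphere (0 : ℂ) 1, ψ z ∈ V ∨ ∃ E : 𝓔, ψ z ∈ E.1 := by
    intro z hz
    obtain ⟨θ, rfl⟩ := exists_polygonPoint_eq hn0 (by simpa using hz : ‖z‖ = 1)
    by_cases hθ : θ = ⌊θ⌋
    · left; rw [hθ]; exact h.vertex _
    · right
      obtain ⟨E, hE, hk⟩ := h.edge ⌊θ⌋
      exact ⟨⟨E, hE⟩, hk.mapsTo ⟨(Int.floor_le θ).lt_of_ne (Ne.symm hθ), Int.lt_floor_add_one θ⟩⟩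
  have hVE : ∀ (v : V) (E : 𝓔), v.1 ∉ E.1 := fun v E =>
    disjoint_left.mp (h.disjoint_vertices E.1 E.2) v.2
  have hVU : ∀ v : V, v.1 ∉ ψ '' ball 0 1 := by
    rintro ⟨v, hv⟩ ⟨z, hz, hzv⟩
    obtain ⟨k, rfl⟩ := h.vertex_surj v hv
    exact h.ne z hz _ (polygonPoint_mem_sphere _ _) hzv
  have hEU : ∀ E : 𝓔, ∀ x ∈ E.1, x ∉ ψ '' ball 0 1 := by
    rintro ⟨E, hE⟩ x hx ⟨z, hz, hzx⟩
    obtain ⟨k, hk⟩ := h.edge_surj E hE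
    obtain ⟨θ, hθ, rfl⟩ := hk.surjOn hx
    exact h.ne z hz _ (polygonPoint_mem_sphere _ _) hzx
  have hcw := exists_cwComplex (tilingCell V 𝓔) ?_ ?_ g ?_ ?_ ?_ ?_ ?_
  rotate_left
  · intro m
    match m with
    | 0 => exact hVfin
    | 1 => exact hEfin
    | 2 => exact inferInstanceAs (Finite PUnit)
    | _ + 3 => exact inferInstanceAs (Finite PEmpty)
  · intro m hm
    match m, hm with
    | m + 3, _ => exact inferInstanceAs (IsEmpty PEmpty)
  · intro m c
    match m, c with
    | 0, v => exact continuousOn_const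
    | 1, E =>
      have : Continuous (γ E) := by simp only [γ]; fun_prop
      exact (hφ.comp this).continuousOn
    | 2, c => exact h.cont.comp H.continuous.continuousOn (fun x hx => hH2 ▸ mem_image_of_mem _ hx)
    | _ + 3, c => exact PEmpty.elim c
  · intro m c
    match m, c with
    | 0, v => exact fun x _ y _ _ => Subsingleton.elim x y
    | 1, E =>
      intro s hs t ht hst
      have h1 := (hκ E.1 E.2).injOn (hγball E ▸ mem_image_of_mem _ hs)
        (hγball E ▸ mem_image_of_mem _ ht) hst
      ext i
      rw [Fin.eq_zero i]
      simp only [γ] at h1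
      linarith
    | 2, c =>
      intro x hx y hy hxy
      exact H.injective (h.inj (hH1 ▸ mem_image_of_mem _ hx) (hH1 ▸ mem_image_of_mem _ hy) hxy)
    | _ + 3, c => exact PEmpty.elim c
  · intro m c x hx
    match m, c with
    | 0, v =>
      rw [mem_sphere_zero_iff_norm, Subsingleton.elim x 0, norm_zero] at hx
      exact absurd hx zero_ne_one
    | 1, E =>
      refine ⟨0, by omega, ?_⟩
      have : ∃ k : ℤ, γ E x = k := by
        rcases mem_sphere_fin_one hx with h1 | h1
        · exact ⟨κ E.1 E.2 + 1, by simp [γ, h1]⟩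
        · exact ⟨κ E.1 E.2, by simp [γ, h1]⟩
      obtain ⟨k, hk⟩ := this
      refine ⟨⟨_, h.vertex k⟩, ?_⟩
      rw [hg0]
      change ψ (polygonPoint n (γ E x)) = _
      rw [hk]
    | 2, c =>
      rcases hsph (H x) (hHs x hx) with hv | ⟨E, hE⟩
      · exact ⟨0, by omega, ⟨_, hv⟩, by rw [hg0]; rfl⟩
      · exact ⟨1, by omega, E, by rw [hg1]; exact hE⟩
    | _ + 3, c => exact PEmpty.elim c
  · intro m c l d x hx y hy hxy
    have hc := mem_image_of_mem (g m c) hx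
    have hd := mem_image_of_mem (g l d) hy
    rw [hxy] at hc
    generalize g l d y = p at hc hd
    match m, c, l, d with
    | 0, v, 0, w =>
      have : v = w := Subtype.ext (((hg0 v).subset hc).symm.trans ((hg0 w).subset hd))
      exact congrArg (Sigma.mk 0) this
    | 0, v, 1, E => exact absurd ((hg1 E).subset hd) (((hg0 v).subset hc : p = v.1) ▸ hVE v E)
    | 0, v, 2, _ => exact absurd ((hg2 PUnit.unit).subset hd) (((hg0 v).subset hc : p = v.1) ▸ hVU v)
    | 1, E, 0, v => exact absurd ((hg1 E).subset hc) (((hg0 v).subset hd : p = v.1) ▸ hVE v E)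
    | 1, E, 1, E' =>
      have : E = E' := Subtype.ext (h.disjoint_edges.elim E.2 E'.2
        (not_disjoint_iff.mpr ⟨p, (hg1 E).subset hc, (hg1 E').subset hd⟩))
      exact congrArg (Sigma.mk 1) this
    | 1, E, 2, _ => exact absurd ((hg2 PUnit.unit).subset hd) (hEU E p ((hg1 E).subset hc))
    | 2, _, 0, v => exact absurd ((hg2 PUnit.unit).subset hc) (((hg0 v).subset hd : p = v.1) ▸ hVU v)
    | 2, _, 1, E => exact absurd ((hg2 PUnit.unit).subset hc) (hEU E p ((hg1 E).subset hd))
    | 2, _, 2, _ => rfl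
    | _ + 3, c, _, _ => exact PEmpty.elim c
    | _, _, _ + 3, c => exact PEmpty.elim c
  · intro x
    obtain ⟨z, hz, rfl⟩ := h.surj.symm ▸ mem_univ x
    by_cases hzb : z ∈ ball (0 : ℂ) 1
    · exact ⟨2, PUnit.unit, (hg2 PUnit.unit).symm.subset (mem_image_of_mem _ hzb)⟩
    · have hzs : z ∈ sphere (0 : ℂ) 1 := by
        rw [← closedBall_sdiff_ball]; exact ⟨hz, hzb⟩
      rcases hsph z hzs with hv | ⟨E, hE⟩
      · exact ⟨0, ⟨_, hv⟩, by rw [hg0]; rfl⟩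
      · exact ⟨1, E, by rw [hg1]; exact hE⟩
  obtain ⟨K, hK, e, he⟩ := hcw
  have hcell2 : ∀ c, openCell K 2 c = ψ '' ball 0 1 := fun c =>
    (he 2 c).trans (hg2 PUnit.unit)
  have hV : vertexSet K = V := by
    ext x
    constructor
    · rintro ⟨v, rfl⟩
      have h1 := he 0 v
      rw [openCell_zero] at h1
      have h2 := hg0 (e 0 v)
      rw [← h1] at h2
      rw [singleton_eq_singleton_iff.mp h2]
      exact (e 0 v).2
    · intro hx
      refine ⟨(e 0).symm ⟨x, hx⟩, ?_⟩
      have h1 := he 0 ((e 0).symm ⟨x, hx⟩)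
      rw [openCell_zero] at h1
      have h3 : e 0 ((e 0).symm ⟨x, hx⟩) = (⟨x, hx⟩ : V) := (e 0).apply_symm_apply _
      rw [h3] at h1
      have h1 := h1.trans (hg0 ⟨x, hx⟩)
      exact singleton_eq_singleton_iff.mp h1
  have hEd : edgeSets K = 𝓔 := by
    ext E
    constructor
    · rintro ⟨c, rfl⟩
      have h1 := (he 1 c).trans (hg1 (e 1 c))
      rw [h1]; exact (e 1 c).2
    · intro hE
      refine ⟨(e 1).symm ⟨E, hE⟩, ?_⟩
      have h3 : e 1 ((e 1).symm ⟨E, hE⟩) = (⟨E, hE⟩ : 𝓔) := (e 1).apply_symm_apply _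
      have h1 := he 1 ((e 1).symm ⟨E, hE⟩)
      rw [h3] at h1
      exact h1.trans (hg1 ⟨E, hE⟩)
  refine ⟨K, ⟨hK, ?_, fun c => ?_, ?_⟩, hV, hEd⟩
  · refine eq_univ_of_forall fun x => mem_iUnion.mpr ⟨(e 2).symm PUnit.unit, ?_⟩
    have hcl : closedCell K 2 ((e 2).symm PUnit.unit) =
        closure (openCell K 2 ((e 2).symm PUnit.unit)) := by
      let := K
      exact RelCWComplex.closure_openCell_eq_closedCell.symm
    rw [hcl, hcell2]
    obtain ⟨z, hz, rfl⟩ := h.surj.symm ▸ mem_univ x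
    have hz' : z ∈ closure (ball (0 : ℂ) 1) := by rwa [closure_ball _ one_ne_zero]
    exact ((h.cont z hz).mono ball_subset_closedBall).mem_closure_image hz'
  · refine ⟨n, h.three_le, ψ, h.cont, ⟨?_, (hcell2 c).symm⟩, fun k _ => ?_, fun k _ => ?_⟩
    · refine isEmbedding_domRestrict_of_isCompact (isCompact_closedBall 0 1) h.cont
        ball_subset_closedBall h.inj ?_
      intro z hz w hw hwb
      exact h.ne z hz w (by rw [← closedBall_sdiff_ball]; exact ⟨hw, hwb⟩)
    · obtain ⟨E, hE, hk⟩ := h.edge k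
      obtain ⟨c, rfl⟩ := hEd.symm ▸ hE
      have hk' : BijOn (fun θ => ψ (polygonPoint n θ)) (Ioo (k : ℝ) (k + 1)) (openCell K 1 c) := by
        exact_mod_cast hk
      refine ⟨c, ?_, ?_⟩
      · rw [polygonEdge_eq]
        refine isEmbedding_domRestrict_of_isCompact (K := polygonPoint n '' Icc (k : ℝ) (k + 1))
          (isCompact_Icc.image (continuous_polygonPoint n)) (h.cont.mono ?_)
          (image_mono Ioo_subset_Icc_self) ?_ ?_
        · rintro _ ⟨θ, -, rfl⟩; exact polygonPoint_mem_closedBall _ _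
        · rintro _ ⟨θ, hθ, rfl⟩ _ ⟨η, hη, rfl⟩ he
          rw [hk'.injOn hθ hη he]
        · rintro _ ⟨θ, hθ, rfl⟩ _ ⟨η, hη, rfl⟩ hne he
          have hη' : η = ((k : ℤ) : ℝ) ∨ η = ((k + 1 : ℤ) : ℝ) := by
            by_contra hη'
            push Not at hη'
            push_cast at hη'
            exact hne ⟨η, ⟨hη.1.lt_of_ne hη'.1.symm, hη.2.lt_of_ne hη'.2⟩, rfl⟩
          have h1 : ψ (polygonPoint n η) ∈ V := by
            rcases hη' with rfl | rfl <;> exact h.vertex _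
          rw [← he] at h1
          exact disjoint_left.mp (h.disjoint_vertices _ hE) h1 (hk'.mapsTo hθ)
      · rw [polygonEdge_eq, image_image]
        exact hk'.image_eq
    · have hv := h.vertex k
      rw [← hV] at hv
      obtain ⟨v, hv⟩ := hv
      refine ⟨v, ?_⟩
      rw [hv, polygonVertex_eq]; simp
  · rw [Nat.card_congr (e 2)]
    exact Nat.card_unique (α := PUnit)

/-! ## The half-plane model -/

/-- The Cayley transform, mapping the upper half-plane onto the unit disk and `∞` to `1`. -/
def cayley (z : ℂ) : ℂ := (z - Complex.I) / (z + Complex.I)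

lemma normSq_sub_I (z : ℂ) : ‖z - Complex.I‖ ^ 2 = ‖z + Complex.I‖ ^ 2 - 4 * z.im := by
  rw [← Complex.normSq_eq_norm_sq, ← Complex.normSq_eq_norm_sq, Complex.normSq_apply,
    Complex.normSq_apply]
  simp; ring

lemma add_I_ne_zero {z : ℂ} (hz : 0 ≤ z.im) : z + Complex.I ≠ 0 := by
  intro h
  have := congrArg Complex.im h
  simp at this
  linarith

lemma cayley_mem_ball {z : ℂ} (hz : 0 < z.im) : cayley z ∈ ball (0 : ℂ) 1 := by
  have h0 : 0 < ‖z + Complex.I‖ := norm_pos_iff.mpr (add_I_ne_zero hz.le)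
  rw [mem_ball_zero_iff, cayley, norm_div, div_lt_one h0]
  refine lt_of_pow_lt_pow_left₀ 2 h0.le ?_
  rw [normSq_sub_I]; linarith

lemma continuousOn_cayley : ContinuousOn cayley {z | 0 ≤ z.im} := by
  unfold cayley
  exact ContinuousOn.div (by fun_prop) (by fun_prop) (fun z hz => add_I_ne_zero hz)

lemma cayley_sub_one {z : ℂ} (hz : 0 ≤ z.im) : cayley z - 1 = -2 * Complex.I / (z + Complex.I) := by
  have := add_I_ne_zero hz
  rw [cayley]; field_simp; ring

lemma cayley_ne_one {z : ℂ} (hz : 0 ≤ z.im) : cayley z ≠ 1 := by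
  intro h
  have h1 := cayley_sub_one hz
  rw [h, sub_self, eq_comm, div_eq_zero_iff] at h1
  rcases h1 with h1 | h1
  · simp at h1
  · exact add_I_ne_zero hz h1

/-- The inverse of the Cayley transform. -/
def cayleyInv (w : ℂ) : ℂ := Complex.I * (1 + w) / (1 - w)

lemma cayleyInv_cayley {z : ℂ} (hz : 0 ≤ z.im) : cayleyInv (cayley z) = z := by
  have h1 := add_I_ne_zero hz
  have h2 : 1 - cayley z = 2 * Complex.I / (z + Complex.I) := by
    rw [← neg_sub, cayley_sub_one hz]; ring
  have h3 : 1 + cayley z = 2 * z / (z + Complex.I) := by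
    rw [cayley]; field_simp; ring
  rw [cayleyInv, h2, h3]
  have := Complex.I_ne_zero
  field_simp

lemma cayley_injOn : InjOn cayley {z | 0 ≤ z.im} := by
  intro z hz w hw h
  rw [← cayleyInv_cayley hz, h, cayleyInv_cayley hw]

lemma cayley_cayleyInv {w : ℂ} (hw : w ≠ 1) : cayley (cayleyInv w) = w := by
  have h1 : 1 - w ≠ 0 := sub_ne_zero.mpr hw.symm
  have h2 : cayleyInv w - Complex.I = Complex.I * (2 * w) / (1 - w) := by
    rw [cayleyInv]; field_simp; ring
  have h3 : cayleyInv w + Complex.I = Complex.I * 2 / (1 - w) := by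
    rw [cayleyInv]; field_simp; ring
  rw [cayley, h2, h3]
  have := Complex.I_ne_zero
  field_simp

lemma im_cayleyInv (w : ℂ) : (cayleyInv w).im = (1 - ‖w‖ ^ 2) / ‖1 - w‖ ^ 2 := by
  rw [cayleyInv, ← Complex.normSq_eq_norm_sq, ← Complex.normSq_eq_norm_sq, Complex.div_im,
    Complex.normSq_apply w]
  simp; ring

lemma im_cayleyInv_nonneg {w : ℂ} (hw : ‖w‖ ≤ 1) : 0 ≤ (cayleyInv w).im := by
  rw [im_cayleyInv]
  have : ‖w‖ ^ 2 ≤ 1 := pow_le_one₀ (norm_nonneg _) hw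
  exact div_nonneg (by linarith) (by positivity)

lemma im_cayleyInv_pos {w : ℂ} (hw : ‖w‖ < 1) : 0 < (cayleyInv w).im := by
  rw [im_cayleyInv]
  have h1 : ‖w‖ ^ 2 < 1 := pow_lt_one₀ (norm_nonneg _) hw two_ne_zero
  have h2 : (1 : ℂ) - w ≠ 0 := by
    rw [sub_ne_zero]; rintro rfl; simp at hw
  exact div_pos (by linarith) (by positivity)

lemma im_cayleyInv_eq_zero {w : ℂ} (hw : ‖w‖ = 1) : (cayleyInv w).im = 0 := by
  rw [im_cayleyInv, hw]; simp

lemma continuousAt_cayleyInv {w : ℂ} (hw : w ≠ 1) : ContinuousAt cayleyInv w := by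
  unfold cayleyInv
  exact ContinuousAt.div (by fun_prop) (by fun_prop) (sub_ne_zero.mpr hw.symm)

/-- The parameter on the boundary of the polygon corresponding to a point of the real line. -/
def cayleyAngle (n : ℕ) (x : ℝ) : ℝ := n * (1 / 2 + Real.arctan x / Real.pi)

/-- On the real line, `(x - i) / (x + i)` is the unit complex number with argument `π + 2 arctan x`.
-/
lemma cayley_ofReal {n : ℕ} (hn : n ≠ 0) (x : ℝ) :
    cayley x = polygonPoint n (cayleyAngle n x) := by
  have hn' : (n : ℝ) ≠ 0 := by exact_mod_cast hn
  have hπ := Real.pi_ne_zero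
  have h1 : 2 * Real.pi * cayleyAngle n x / n = Real.pi + 2 * Real.arctan x := by
    rw [cayleyAngle]; field_simp
  have h2 : (0 : ℝ) < 1 + x ^ 2 := by positivity
  have h3 : Complex.exp ((Real.arctan x : ℝ) * Complex.I) =
      (1 + x * Complex.I) / (Real.sqrt (1 + x ^ 2) : ℝ) := by
    rw [Complex.exp_mul_I, ← Complex.ofReal_cos, ← Complex.ofReal_sin, Real.cos_arctan,
      Real.sin_arctan]
    push_cast; ring
  rw [polygonPoint_eq, h1, Complex.ofReal_add, add_mul, Complex.exp_add, Complex.exp_pi_mul_I,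
    Complex.ofReal_mul, mul_assoc, Complex.ofReal_ofNat, two_mul, Complex.exp_add, h3, cayley]
  have h4 : ((Real.sqrt (1 + x ^ 2) : ℝ) : ℂ) * (Real.sqrt (1 + x ^ 2) : ℝ) = 1 + x ^ 2 := by
    rw [← Complex.ofReal_mul, Real.mul_self_sqrt h2.le]; push_cast; ring
  have h5 : (1 : ℂ) + x ^ 2 = (x - Complex.I) * (x + Complex.I) := by
    ring_nf; rw [Complex.I_sq]; ring
  have h6 : (x : ℂ) + Complex.I ≠ 0 := add_I_ne_zero (by simp)
  have h7 : (x : ℂ) - Complex.I ≠ 0 := by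
    intro h
    have := congrArg Complex.im h
    simp at this
  rw [div_mul_div_comm, h4, h5, neg_one_mul, ← neg_div, div_eq_div_iff h6 (mul_ne_zero h7 h6)]
  linear_combination ((x : ℂ) + Complex.I) * (1 + x ^ 2) * Complex.I_sq

lemma strictMono_cayleyAngle {n : ℕ} (hn : n ≠ 0) : StrictMono (cayleyAngle n) := by
  intro x y h
  have hn' : (0 : ℝ) < n := by exact_mod_cast Nat.pos_of_ne_zero hn
  have := Real.arctan_strictMono h
  unfold cayleyAngle
  have hπ := Real.pi_pos
  gcongr

lemma range_cayleyAngle {n : ℕ} (hn : n ≠ 0) : range (cayleyAngle n) = Ioo 0 (n : ℝ) := by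
  have hn' : (0 : ℝ) < n := by exact_mod_cast Nat.pos_of_ne_zero hn
  have hπ := Real.pi_pos
  ext θ
  constructor
  · rintro ⟨x, rfl⟩
    have h1 := Real.arctan_lt_pi_div_two x
    have h2 := Real.neg_pi_div_two_lt_arctan x
    have h3 : -(1 / 2) < Real.arctan x / Real.pi := by rw [lt_div_iff₀ hπ]; linarith
    have h4 : Real.arctan x / Real.pi < 1 / 2 := by rw [div_lt_iff₀ hπ]; linarith
    constructor <;> unfold cayleyAngle <;> nlinarith
  · rintro ⟨h0, h1⟩
    refine ⟨Real.tan (Real.pi * (θ / n - 1 / 2)), ?_⟩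
    have h2 : 0 < θ / n := by positivity
    have h3 : θ / n < 1 := by rwa [div_lt_one hn']
    rw [cayleyAngle, Real.arctan_tan (by nlinarith) (by nlinarith)]
    field_simp; ring

/-- A continuous map of the closed upper half-plane, extended by `p` at infinity, onto `X` which is
injective on the open half-plane, and under which the images of the open half-plane and of its
boundary are disjoint. -/
structure IsHalfPlaneMap {X : Type*} [TopologicalSpace X] (Ψ : ℂ → X) (p : X) : Prop where
  cont : ContinuousOn Ψ {z | 0 ≤ z.im}
  lim : ∀ U ∈ 𝓝 p, ∃ R : ℝ, ∀ z : ℂ, 0 ≤ z.im → R ≤ ‖z‖ → Ψ z ∈ U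
  inj : InjOn Ψ {z | 0 < z.im}
  ne : ∀ z : ℂ, 0 < z.im → ∀ x : ℝ, Ψ z ≠ Ψ x
  ne_infty : ∀ z : ℂ, 0 < z.im → Ψ z ≠ p
  surj : ∀ a, a = p ∨ ∃ z : ℂ, 0 ≤ z.im ∧ Ψ z = a

section HalfPlaneMap

variable {X : Type*} [TopologicalSpace X]

/-- Behaviour at infinity is controlled by `cayley z - 1 = -2i / (z + i)`: a large `z` lands near
the boundary point `1`. -/
lemma IsDiskMap.isHalfPlaneMap {ψ : ℂ → X} (h : IsDiskMap ψ) :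
    IsHalfPlaneMap (fun z => ψ (cayley z)) (ψ 1) := by
  have hcl : ∀ z : ℂ, 0 ≤ z.im → cayley z ∈ closedBall (0 : ℂ) 1 := by
    intro z hz
    rcases hz.eq_or_lt with h0 | h0
    · have : z = (z.re : ℂ) := Complex.ext rfl (by simp [← h0])
      rw [this, cayley_ofReal one_ne_zero]
      exact polygonPoint_mem_closedBall _ _
    · exact ball_subset_closedBall (cayley_mem_ball h0)
  have hre : ∀ x : ℝ, cayley x ∈ sphere (0 : ℂ) 1 := fun x => by
    rw [cayley_ofReal one_ne_zero]; exact polygonPoint_mem_sphere _ _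
  refine ⟨h.cont.comp continuousOn_cayley hcl, fun U hU => ?_, ?_, ?_, ?_, ?_⟩
  · have h1 := h.cont 1 (by simp)
    have h2 := h1 hU
    rw [mem_map, mem_nhdsWithin_iff] at h2
    obtain ⟨ε, hε, hεU⟩ := h2
    refine ⟨3 / ε + 2, fun z hz hR => hεU ⟨?_, hcl z hz⟩⟩
    rw [mem_ball, dist_eq_norm, cayley_sub_one hz, norm_div]
    have h3 : ‖z‖ ≤ ‖z + Complex.I‖ + 1 := by
      have := norm_sub_le (z + Complex.I) Complex.I
      simpa using this
    have h4 : 3 / ε + 1 ≤ ‖z + Complex.I‖ := by linarith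
    have h5 : 0 < 3 / ε := by positivity
    have h6 : ‖(-2 : ℂ) * Complex.I‖ = 2 := by simp
    rw [h6, div_lt_iff₀ (by linarith)]
    have : ε * (3 / ε) = 3 := by field_simp
    nlinarith
  · intro z hz w hw hzw
    exact cayley_injOn (show 0 ≤ z.im from le_of_lt hz) (show 0 ≤ w.im from le_of_lt hw)
      (h.inj (cayley_mem_ball hz) (cayley_mem_ball hw) hzw)
  · exact fun z hz x => h.ne _ (cayley_mem_ball hz) _ (hre x)
  · exact fun z hz => h.ne _ (cayley_mem_ball hz) _ (by simp)
  · intro a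
    obtain ⟨w, hw, rfl⟩ := h.surj.symm.subset (mem_univ a)
    rcases eq_or_ne w 1 with rfl | hw1
    · exact Or.inl rfl
    · exact Or.inr ⟨cayleyInv w, im_cayleyInv_nonneg (by simpa using hw),
        by rw [cayley_cayleyInv hw1]⟩

-- Continuity at `1` uses `‖cayley z - 1‖ * ‖z + i‖ = 2` in the other direction: points near `1`
-- come from large `z`, where `h.lim` applies.
open Classical in
lemma IsHalfPlaneMap.isDiskMap {Ψ : ℂ → X} {p : X} (h : IsHalfPlaneMap Ψ p) :
    IsDiskMap (fun w => if w = 1 then p else Ψ (cayleyInv w)) := by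
  have hne1 : ∀ w ∈ ball (0 : ℂ) 1, w ≠ 1 := by rintro w hw rfl; simp at hw
  refine ⟨?_, ?_, ?_, ?_⟩
  · intro w hw
    have hw' : ‖w‖ ≤ 1 := by simpa using hw
    rcases eq_or_ne w 1 with rfl | hw1
    · intro U hU
      simp only [if_true] at hU
      obtain ⟨R, hR⟩ := h.lim U hU
      rw [mem_map, mem_nhdsWithin_iff]
      refine ⟨(1 / (max R 0 + 1)), by positivity, ?_⟩
      rintro z ⟨hz, hz1⟩
      rw [mem_preimage]
      split_ifs with hzz
      · exact mem_of_mem_nhds hU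
      · have h1 : z ≠ 1 := hzz
        have h0 := im_cayleyInv_nonneg (w := z) (by simpa using hz1)
        refine hR _ h0 ?_
        have h2 := cayley_sub_one h0
        rw [cayley_cayleyInv h1] at h2
        have h3 : ‖z - 1‖ * ‖cayleyInv z + Complex.I‖ = 2 := by
          rw [h2, norm_div, div_mul_cancel₀ _ (norm_ne_zero_iff.mpr (add_I_ne_zero h0))]; simp
        have h4 : ‖cayleyInv z + Complex.I‖ ≤ ‖cayleyInv z‖ + 1 := by
          simpa using norm_add_le (cayleyInv z) Complex.I
        rw [mem_ball, dist_eq_norm, lt_div_iff₀ (by positivity)] at hz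
        have h5 : 0 < ‖z - 1‖ := norm_pos_iff.mpr (sub_ne_zero.mpr h1)
        have h6 : max R 0 + 1 < ‖cayleyInv z + Complex.I‖ := by
          by_contra hcon
          push Not at hcon
          have := mul_le_mul_of_nonneg_left hcon h5.le
          linarith
        linarith [le_max_left R 0]
    · have h1 : ContinuousWithinAt (fun w => Ψ (cayleyInv w)) (closedBall 0 1) w := by
        refine ContinuousWithinAt.comp (t := {z | 0 ≤ z.im}) (h.cont _ (im_cayleyInv_nonneg hw'))
          (continuousAt_cayleyInv hw1).continuousWithinAt ?_
        exact fun z hz => im_cayleyInv_nonneg (by simpa using hz)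
      refine h1.congr_of_eventuallyEq ?_ (by simp [hw1])
      filter_upwards [mem_nhdsWithin_of_mem_nhds (isOpen_ne.mem_nhds hw1)] with z hz
      simp [show z ≠ 1 from hz]
  · intro z hz w hw hzw
    have hz1 := hne1 z hz
    have hw1 := hne1 w hw
    simp only [hz1, hw1, if_false] at hzw
    have := h.inj (im_cayleyInv_pos (by simpa using hz)) (im_cayleyInv_pos (by simpa using hw)) hzw
    rw [← cayley_cayleyInv hz1, this, cayley_cayleyInv hw1]
  · refine eq_univ_of_forall fun a => ?_
    rcases h.surj a with rfl | ⟨z, hz, rfl⟩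
    · exact ⟨1, by simp, by simp⟩
    · refine ⟨cayley z, ?_, ?_⟩
      · rcases hz.eq_or_lt with h0 | h0
        · have : z = (z.re : ℂ) := Complex.ext rfl (by simp [← h0])
          rw [this, cayley_ofReal one_ne_zero]
          exact polygonPoint_mem_closedBall _ _
        · exact ball_subset_closedBall (cayley_mem_ball h0)
      · simp [cayley_ne_one hz, cayleyInv_cayley hz]
  · intro z hz w hw
    have hz1 := hne1 z hz
    have h0 : 0 < (cayleyInv z).im := im_cayleyInv_pos (by simpa using hz)
    simp only [hz1, if_false]
    split_ifs with hw1
    · exact h.ne_infty _ h0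
    · have : cayleyInv w = ((cayleyInv w).re : ℂ) :=
        Complex.ext rfl (by simp [im_cayleyInv_eq_zero (w := w) (by simpa using hw)])
      rw [this]
      exact h.ne _ h0 _

/-- Reparametrization of the half-plane by an increasing homeomorphism of the real axis. -/
lemma IsHalfPlaneMap.comp_orderIso {Ψ : ℂ → X} {p : X} (h : IsHalfPlaneMap Ψ p) (σ : ℝ ≃o ℝ) :
    IsHalfPlaneMap (fun z => Ψ ((σ z.re : ℝ) + z.im * Complex.I)) p := by
  have him : ∀ z : ℂ, ((σ z.re : ℝ) + z.im * Complex.I : ℂ).im = z.im := fun z => by simp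
  have hre : ∀ z : ℂ, ((σ z.re : ℝ) + z.im * Complex.I : ℂ).re = σ z.re := fun z => by simp
  have hσ : Continuous σ := σ.continuous
  refine ⟨?_, fun U hU => ?_, ?_, ?_, ?_, ?_⟩
  · refine h.cont.comp ?_ (fun z hz => by rw [mem_ofPred_eq, him]; exact hz)
    exact Continuous.continuousOn (by fun_prop)
  · obtain ⟨R, hR⟩ := h.lim U hU
    refine ⟨|σ.symm R| + |σ.symm (-R)| + |R| + 1, fun z hz hzR => hR _ (by rwa [him]) ?_⟩
    by_contra hlt
    push Not at hlt
    have h1 := (Complex.abs_re_le_norm _).trans_lt hlt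
    have h2 := (Complex.abs_im_le_norm _).trans_lt hlt
    rw [hre, abs_lt] at h1
    rw [him] at h2
    have h3 : z.re < σ.symm R := (σ.lt_symm_apply).mpr h1.2
    have h4 : σ.symm (-R) < z.re := (σ.symm_apply_lt).mpr h1.1
    have h5 : |z.re| ≤ |σ.symm R| + |σ.symm (-R)| := by
      rw [abs_le]
      constructor
      · linarith [neg_abs_le (σ.symm (-R)), abs_nonneg (σ.symm R)]
      · linarith [le_abs_self (σ.symm R), abs_nonneg (σ.symm (-R))]
    have h6 := Complex.norm_le_abs_re_add_abs_im z
    linarith [le_abs_self R]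
  · intro z hz w hw hzw
    have h1 := h.inj (by rw [mem_ofPred_eq, him]; exact hz) (by rw [mem_ofPred_eq, him]; exact hw)
      hzw
    refine Complex.ext (σ.injective ?_) ?_
    · rw [← hre, h1, hre]
    · rw [← him, h1, him]
  · intro z hz x
    have := h.ne ((σ z.re : ℝ) + z.im * Complex.I) (by rwa [him]) (σ x)
    simpa using this
  · intro z hz
    exact h.ne_infty _ (by rwa [him])
  · intro a
    rcases h.surj a with h0 | ⟨z, hz, rfl⟩
    · exact Or.inl h0
    · refine Or.inr ⟨(σ.symm z.re : ℝ) + z.im * Complex.I, by simpa using hz, ?_⟩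
      simp [Complex.re_add_im]

/-! ### Folding a half-plane map along a boundary segment -/

/-- The parametrization of the half-plane by the half-plane slit along the segment `[0, i]`. -/
def slit (z : ℂ) : ℂ :=
  if 0 ≤ z.re then
    ⟨min z.re z.im + max (z.re - z.im + 1) 0, min z.re z.im + max (z.im - z.re - 1) 0⟩
  else
    ⟨-(min (-z.re) z.im + max (-z.re - z.im + 1) 0), min (-z.re) z.im + max (z.im + z.re - 1) 0⟩

lemma slit_im_nonneg {z : ℂ} (hz : 0 ≤ z.im) : 0 ≤ (slit z).im := by
  unfold slit
  split_ifs with h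
  · exact add_nonneg (le_min h hz) (le_max_right _ _)
  · exact add_nonneg (le_min (by linarith) hz) (le_max_right _ _)

lemma slit_ofReal_of_nonneg {x : ℝ} (hx : 0 ≤ x) : slit x = (x + 1 : ℝ) := by
  apply Complex.ext
  · simp [slit, hx]; linarith
  · simp [slit, hx]; linarith

lemma slit_ofReal_of_neg {x : ℝ} (hx : x < 0) : slit x = (x - 1 : ℝ) := by
  apply Complex.ext
  · simp [slit, hx.not_ge, hx.le]; rw [max_eq_left (by linarith)]; ring
  · simp [slit, hx.not_ge, hx.le]; linarith

/-- Above the real axis only the segment from `0` to `i` returns to the boundary. `slit` sends it to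
its right lip `[0, 1)`, with `i` going to `0`; the limits from the left are the negatives. -/
lemma slit_of_im_pos {z : ℂ} (hz : 0 < z.im) :
    0 < (slit z).im ∨ (z.re = 0 ∧ z.im ≤ 1 ∧ slit z = (1 - z.im : ℝ)) := by
  by_cases h : z.re = 0
  · rcases le_or_gt z.im 1 with h1 | h1
    · right
      refine ⟨h, h1, Complex.ext ?_ ?_⟩
      · simp [slit, h, hz.le]; rw [max_eq_left (by linarith)]; ring
      · simp [slit, h, hz.le, h1]
    · left
      simp [slit, h, hz.le, h1]
  · left
    unfold slit
    split_ifs with h1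
    · exact add_pos_of_pos_of_nonneg (lt_min (lt_of_le_of_ne h1 (Ne.symm h)) hz) (le_max_right _ _)
    · exact add_pos_of_pos_of_nonneg (lt_min (by linarith) hz) (le_max_right _ _)

lemma slit_injOn : InjOn slit {z | 0 ≤ z.im} := by
  intro z hz w hw h
  have h1 := congrArg Complex.re h
  have h2 := congrArg Complex.im h
  simp only [mem_ofPred_eq] at hz hw
  unfold slit at h1 h2
  split_ifs at h1 h2 with hz0 hw0 hw0 <;> simp only at h1 h2 <;> apply Complex.ext <;> grind

lemma norm_le_norm_slit (z : ℂ) : ‖z‖ ≤ ‖slit z‖ + 2 := by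
  have h : |(slit z).re - z.re| ≤ 1 ∧ |(slit z).im - z.im| ≤ 1 := by
    unfold slit
    split_ifs <;> constructor <;> simp only <;> grind
  have h1 := norm_sub_le (slit z) (slit z - z)
  have h2 := Complex.norm_le_abs_re_add_abs_im (slit z - z)
  simp only [Complex.sub_re, Complex.sub_im, sub_sub_cancel] at h1 h2
  linarith [h.1, h.2]

/-- The left lip `[-1, 0)` is not attained, so it is represented by its mirror image on the right
lip. -/
lemma exists_slit_eq {w : ℂ} (hw : 0 ≤ w.im) :
    ∃ z : ℂ, 0 ≤ z.im ∧ (slit z = w ∨ (w.im = 0 ∧ -1 ≤ w.re ∧ w.re < 0 ∧ slit z = (-w.re : ℝ))) := by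
  by_cases h0 : 0 ≤ w.re
  · refine ⟨⟨min w.re w.im + max (w.re - w.im - 1) 0, min w.re w.im + max (w.im + 1 - w.re) 0⟩,
      by positivity, Or.inl ?_⟩
    apply Complex.ext <;> simp only [slit] <;> grind
  · by_cases h1 : w.im = 0 ∧ -1 ≤ w.re
    · refine ⟨⟨0, 1 + w.re⟩, by linarith [h1.2], Or.inr ⟨h1.1, h1.2, not_le.mp h0, ?_⟩⟩
      apply Complex.ext <;> simp only [slit, Complex.ofReal_re, Complex.ofReal_im] <;> grind
    · refine ⟨⟨-(min (-w.re) w.im + max (-w.re - w.im - 1) 0),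
        min (-w.re) w.im + max (w.im + 1 + w.re) 0⟩, ?_, Or.inl ?_⟩
      · have : 0 ≤ -w.re := by linarith
        positivity
      · apply Complex.ext <;> simp only [slit] <;> grind

/-- Zips up the boundary segment `[-1, 1]`. `slit` tears the half-plane open along the segment from
`0` to `i`, but `hsymm` says that `Ψ` agrees on the two lips, so the composite is continuous. By
`hinj` there is no other identification on `[0, 1)`, and this part becomes interior. -/
lemma IsHalfPlaneMap.fold {Ψ : ℂ → X} {p : X} (h : IsHalfPlaneMap Ψ p)
    (hsymm : ∀ t : ℝ, 0 ≤ t → t ≤ 1 → Ψ (t : ℝ) = Ψ (-t : ℝ))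
    (hinj : ∀ t s : ℝ, 0 ≤ t → t < 1 → Ψ t = Ψ s → s = t ∨ s = -t)
    (hp : ∀ t : ℝ, 0 ≤ t → t < 1 → Ψ t ≠ p) :
    IsHalfPlaneMap (fun z => Ψ (slit z)) p := by
  refine ⟨?_, fun U hU => ?_, ?_, ?_, ?_, ?_⟩
  · have h1 : ContinuousOn (fun z => Ψ (slit z)) {z | 0 ≤ z.re ∧ 0 ≤ z.im} := by
      refine ContinuousOn.congr (f := fun z => Ψ
        ((min z.re z.im + max (z.re - z.im + 1) 0 : ℝ) +
          (min z.re z.im + max (z.im - z.re - 1) 0 : ℝ) * Complex.I)) ?_ ?_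
      · refine h.cont.comp (Continuous.continuousOn (by fun_prop)) ?_
        rintro z ⟨hz1, hz2⟩
        have : 0 ≤ min z.re z.im + max (z.im - z.re - 1) 0 := by positivity
        simpa using this
      · rintro z ⟨hz1, hz2⟩
        simp only [slit, hz1, if_true]
        congr 1
        apply Complex.ext <;> simp
    have h2 : ContinuousOn (fun z => Ψ (slit z)) {z | z.re ≤ 0 ∧ 0 ≤ z.im} := by
      refine ContinuousOn.congr (f := fun z => Ψ
        ((-(min (-z.re) z.im + max (-z.re - z.im + 1) 0) : ℝ) +
          (min (-z.re) z.im + max (z.im + z.re - 1) 0 : ℝ) * Complex.I)) ?_ ?_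
      · refine h.cont.comp (Continuous.continuousOn (by fun_prop)) ?_
        rintro z ⟨hz1, hz2⟩
        have : 0 ≤ -z.re := by linarith
        have : 0 ≤ min (-z.re) z.im + max (z.im + z.re - 1) 0 := by positivity
        simpa using this
      · rintro z ⟨hz1, hz2⟩
        rcases hz1.eq_or_lt with h0 | h0
        · have e1 : slit z = ((max (1 - z.im) 0 : ℝ) : ℂ) + (max (z.im - 1) 0 : ℝ) * Complex.I := by
            apply Complex.ext <;> simp [slit, h0, hz2]
            grind
          have e2 : ((-(min (-z.re) z.im + max (-z.re - z.im + 1) 0) : ℝ) +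
              (min (-z.re) z.im + max (z.im + z.re - 1) 0 : ℝ) * Complex.I : ℂ) =
              ((-max (1 - z.im) 0 : ℝ) : ℂ) + (max (z.im - 1) 0 : ℝ) * Complex.I := by
            apply Complex.ext <;> simp [h0, hz2]
            grind
          simp only
          rw [e1, e2]
          -- On the imaginary axis the formulas for the two quadrants give `1 - z.im` and its
          -- negative up to height `1`, where `hsymm` is needed, and agree above it.
          rcases le_total z.im 1 with h1 | h1
          · rw [max_eq_left (by linarith), max_eq_right (by linarith)]
            simpa using hsymm (1 - z.im) (by linarith) (by linarith)
          · rw [max_eq_right (by linarith)]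
            simp
        · simp only [slit, h0.not_ge, if_false]
          congr 1
          apply Complex.ext <;> simp
    have h3 : {z : ℂ | 0 ≤ z.im} = {z | 0 ≤ z.re ∧ 0 ≤ z.im} ∪ {z | z.re ≤ 0 ∧ 0 ≤ z.im} := by
      ext z
      have := le_total 0 z.re
      simp only [mem_ofPred_eq, mem_union]
      tauto
    rw [h3]
    refine h1.union_of_isClosed h2 ?_ ?_
    · exact (isClosed_le continuous_const Complex.continuous_re).inter
        (isClosed_le continuous_const Complex.continuous_im)
    · exact (isClosed_le Complex.continuous_re continuous_const).inter
        (isClosed_le continuous_const Complex.continuous_im)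
  · obtain ⟨R, hR⟩ := h.lim U hU
    refine ⟨R + 2, fun z hz hzR => hR _ (slit_im_nonneg hz) ?_⟩
    linarith [norm_le_norm_slit z]
  · intro z hz w hw hzw
    have hz' : 0 ≤ z.im := le_of_lt hz
    have hw' : 0 ≤ w.im := le_of_lt hw
    have key : slit z = slit w → z = w := fun h' => slit_injOn hz' hw' h'
    have hzw : Ψ (slit z) = Ψ (slit w) := hzw
    rcases slit_of_im_pos hz with h1 | ⟨h1, h1', h1''⟩ <;>
      rcases slit_of_im_pos hw with h2 | ⟨h2, h2', h2''⟩
    · exact key (h.inj h1 h2 hzw)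
    · rw [h2''] at hzw; exact absurd hzw (h.ne _ h1 _)
    · rw [h1''] at hzw; exact absurd hzw.symm (h.ne _ h2 _)
    · rw [h1'', h2''] at hzw
      have hzp : 0 < z.im := hz
      have hwp : 0 < w.im := hw
      refine Complex.ext (h1.trans h2.symm) ?_
      rcases hinj _ _ (by linarith) (by linarith) hzw with h3 | h3 <;> linarith
  · intro z hz x
    have hs : ∃ s : ℝ, slit x = s ∧ 1 ≤ |s| := by
      rcases le_or_gt 0 x with hx | hx
      · exact ⟨x + 1, slit_ofReal_of_nonneg hx, by rw [abs_of_nonneg (by linarith)]; linarith⟩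
      · exact ⟨x - 1, slit_ofReal_of_neg hx, by rw [abs_of_neg (by linarith)]; linarith⟩
    obtain ⟨s, hs, hs1⟩ := hs
    simp only [hs]
    rcases slit_of_im_pos hz with h1 | ⟨h1, h1', h1''⟩
    · exact h.ne _ h1 _
    · rw [h1'']
      intro h2
      rcases hinj _ _ (by linarith) (by linarith) h2 with h3 | h3
      · rw [h3, abs_of_nonneg (by linarith)] at hs1; linarith
      · rw [h3, abs_neg, abs_of_nonneg (by linarith)] at hs1; linarith
  · intro z hz
    rcases slit_of_im_pos hz with h1 | ⟨h1, h1', h1''⟩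
    · exact h.ne_infty _ h1
    · simp only [h1'']
      exact hp _ (by linarith) (by linarith)
  · intro a
    rcases h.surj a with h0 | ⟨w, hw, rfl⟩
    · exact Or.inl h0
    · right
      obtain ⟨z, hz, h1 | ⟨h1, h2, h3, h4⟩⟩ := exists_slit_eq hw
      · exact ⟨z, hz, by rw [h1]⟩
      · refine ⟨z, hz, ?_⟩
        rw [h4, hsymm _ (by linarith) (by linarith)]
        congr 1
        apply Complex.ext <;> simp [h1]

end HalfPlaneMap

/-! ### From half-plane tilings back to polygonal tilings -/

/-- The component of `ℝ ∖ W` which contains `x`. -/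
def arc (W : Finset ℝ) (x : ℝ) : Set ℝ := {y | y ∉ W ∧ ∀ w ∈ W, w < y ↔ w < x}

/-- A one-tile cell structure whose tile is described by the half-plane with vertices `W` and `∞`. -/
structure HalfPlaneTiling {X : Type*} [TopologicalSpace X] (W : Finset ℝ) (Ψ : ℂ → X) (p : X)
    (V : Set X) (𝓔 : Set (Set X)) : Prop extends IsHalfPlaneMap Ψ p where
  infty_mem : p ∈ V
  vertex : ∀ w ∈ W, Ψ (w : ℝ) ∈ V
  vertex_surj : ∀ v ∈ V, v = p ∨ ∃ w ∈ W, Ψ (w : ℝ) = v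
  edge : ∀ x ∉ W, ∃ E ∈ 𝓔, BijOn (fun t : ℝ => Ψ t) (arc W x) E
  edge_surj : ∀ E ∈ 𝓔, ∃ x ∉ W, BijOn (fun t : ℝ => Ψ t) (arc W x) E
  disjoint_edges : 𝓔.PairwiseDisjoint id
  disjoint_vertices : ∀ E ∈ 𝓔, Disjoint V E

/-- `(a, b)` is a component of `(0, m) ∖ S`. -/
def IsGap (S : Set ℝ) (m a b : ℝ) : Prop :=
  0 ≤ a ∧ b ≤ m ∧ (a ∈ S ∨ a = 0) ∧ (b ∈ S ∨ b = m) ∧ ∀ θ ∈ Ioo a b, θ ∉ S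

/-- The points of `W` are the `ρ`-preimages of those of `S`; thus an end of the gap is either the
image of a point of `W` or an end of the whole range of `ρ`. -/
lemma image_arc {m a b : ℝ} {S : Set ℝ} {W : Finset ℝ} {ρ : ℝ → ℝ} (hρ : StrictMono ρ)
    (hr : range ρ = Ioo 0 m) (hW : ∀ x, x ∈ W ↔ ρ x ∈ S) (hab : IsGap S m a b) {x : ℝ}
    (hx : ρ x ∈ Ioo a b) : ρ '' arc W x = Ioo a b := by
  obtain ⟨h0, hm, ha, hb, hS⟩ := hab
  have hxr : ρ x ∈ Ioo 0 m := hr ▸ mem_range_self x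
  ext θ
  constructor
  · rintro ⟨y, ⟨hy, hyx⟩, rfl⟩
    have hyr : ρ y ∈ Ioo 0 m := hr ▸ mem_range_self y
    constructor
    · rcases h0.eq_or_lt with h0 | h0
      · rw [← h0]; exact hyr.1
      · obtain ⟨w, rfl⟩ : a ∈ range ρ := by
          rw [hr]; exact ⟨h0, hx.1.trans hxr.2⟩
        have haS : ρ w ∈ S := ha.resolve_right h0.ne'
        exact hρ ((hyx w ((hW w).mpr haS)).mpr (hρ.lt_iff_lt.mp hx.1))
    · rcases hm.eq_or_lt with h0 | h0
      · rw [h0]; exact hyr.2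
      · obtain ⟨w, rfl⟩ : b ∈ range ρ := by
          rw [hr]; exact ⟨hxr.1.trans hx.2, h0⟩
        have hwW : w ∈ W := (hW w).mpr (hb.resolve_right h0.ne)
        refine hρ (lt_of_le_of_ne ?_ (fun h => hy (h ▸ hwW)))
        by_contra hlt
        exact absurd (hρ ((hyx w hwW).mp (not_le.mp hlt))) hx.2.not_gt
  · intro hθ
    obtain ⟨y, rfl⟩ : θ ∈ range ρ := by
      rw [hr]; exact ⟨h0.trans_lt hθ.1, hθ.2.trans_le hm⟩
    refine ⟨y, ⟨fun hy => hS _ hθ ((hW y).mp hy), fun w hw => ?_⟩, rfl⟩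
    have hwS : ρ w ∉ Ioo a b := fun h => hS _ h ((hW w).mp hw)
    rw [← hρ.lt_iff_lt (b := y), ← hρ.lt_iff_lt (b := x)]
    constructor
    · intro h
      by_contra hlt
      exact hwS ⟨hx.1.trans_le (not_lt.mp hlt), h.trans hθ.2⟩
    · intro h
      by_contra hlt
      exact hwS ⟨hθ.1.trans_le (not_lt.mp hlt), h.trans hx.2⟩

lemma bijOn_arc_iff {X : Type*} {m a b : ℝ} {S : Set ℝ} {W : Finset ℝ} {ρ : ℝ → ℝ}
    (hρ : StrictMono ρ) (hr : range ρ = Ioo 0 m) (hW : ∀ x, x ∈ W ↔ ρ x ∈ S)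
    (hab : IsGap S m a b) {x : ℝ} (hx : ρ x ∈ Ioo a b) {φ : ℝ → X} {E : Set X} :
    BijOn (fun t => φ (ρ t)) (arc W x) E ↔ BijOn φ (Ioo a b) E := by
  rw [← image_arc hρ hr hW hab hx]
  exact bijOn_comp_iff (g := φ) hρ.injective.injOn

lemma isGap_int {n : ℕ} {θ : ℝ} (hθ : θ ∈ Ioo 0 (n : ℝ)) (hi : θ ∉ range ((↑) : ℤ → ℝ)) :
    IsGap (range ((↑) : ℤ → ℝ)) n ⌊θ⌋ (⌊θ⌋ + 1) ∧ θ ∈ Ioo (⌊θ⌋ : ℝ) (⌊θ⌋ + 1) := by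
  refine ⟨⟨?_, ?_, Or.inl ⟨_, rfl⟩, Or.inl ⟨⌊θ⌋ + 1, by push_cast; rfl⟩, ?_⟩, ?_,
    Int.lt_floor_add_one _⟩
  · have : (0 : ℤ) ≤ ⌊θ⌋ := Int.floor_nonneg.mpr hθ.1.le
    exact_mod_cast this
  · have : ⌊θ⌋ < n := Int.floor_lt.mpr (by exact_mod_cast hθ.2)
    exact_mod_cast this
  · rintro _ h ⟨k, rfl⟩
    have h1 : ⌊θ⌋ < k := by exact_mod_cast h.1
    have h2 : k < ⌊θ⌋ + 1 := by exact_mod_cast h.2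
    omega
  · exact (Int.floor_le _).lt_of_ne fun h => hi ⟨_, h⟩

lemma bijOn_Ioo_add {X : Type*} {φ : ℝ → X} {a b c : ℝ} {E : Set X} (h : ∀ θ, φ (θ + c) = φ θ)
    (hE : BijOn φ (Ioo a b) E) : BijOn φ (Ioo (a + c) (b + c)) E := by
  rw [← image_add_const_Ioo, ← bijOn_comp_iff (add_left_injective c).injOn]
  exact hE.congr fun θ _ => (h θ).symm

/-- Induction on the number of points: match all points except the two maxima, then correct by a
piecewise affine map that moves only what lies above the matched points. -/
lemma exists_orderIso_finset (m : ℕ) : ∀ W W' : Finset ℝ, W.card = m → W'.card = m →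
    ∃ σ : ℝ ≃o ℝ, ∀ x, x ∈ W ↔ σ x ∈ W' := by
  induction m with
  | zero =>
    intro W W' hW hW'
    rw [Finset.card_eq_zero] at hW hW'
    exact ⟨OrderIso.refl ℝ, by simp [hW, hW']⟩
  | succ m ih =>
    intro W W' hW hW'
    have hne : W.Nonempty := Finset.card_pos.mp (by omega)
    have hne' : W'.Nonempty := Finset.card_pos.mp (by omega)
    set a := W.max' hne with ha
    set a' := W'.max' hne' with ha'
    have haW : a ∈ W := W.max'_mem hne
    have haW' : a' ∈ W' := W'.max'_mem hne'
    obtain ⟨σ, hσ⟩ := ih (W.erase a) (W'.erase a')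
      (by rw [Finset.card_erase_of_mem haW]; omega) (by rw [Finset.card_erase_of_mem haW']; omega)
    have hlt : ∀ w ∈ W'.erase a', w < min a' (σ a) := by
      intro w hw
      refine lt_min (lt_of_le_of_ne (W'.le_max' w (Finset.mem_of_mem_erase hw))
        (Finset.ne_of_mem_erase hw)) ?_
      have h1 : σ.symm w ∈ W.erase a := by rw [hσ]; simpa using hw
      rw [← σ.symm_apply_lt]
      exact lt_of_le_of_ne (W.le_max' _ (Finset.mem_of_mem_erase h1)) (Finset.ne_of_mem_erase h1)
    -- Below `b` nothing may move, since the matched points are there. Above `b`, stretching by `s`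
    -- takes `σ a` to `a'`, both of which exceed `b`.
    obtain ⟨b, hb, hbM⟩ : ∃ b, (∀ w ∈ W'.erase a', w ≤ b) ∧ b < min a' (σ a) := by
      rcases (W'.erase a').eq_empty_or_nonempty with h0 | h0
      · exact ⟨min a' (σ a) - 1, by simp [h0], by linarith⟩
      · exact ⟨(W'.erase a').max' h0, fun w hw => Finset.le_max' _ w hw,
          hlt _ (Finset.max'_mem _ h0)⟩
    have hba' : 0 < a' - b := by linarith [min_le_left a' (σ a)]
    have hba : 0 < σ a - b := by linarith [min_le_right a' (σ a)]
    set s := (a' - b) / (σ a - b) with hs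
    have hs0 : 0 < s := div_pos hba' hba
    let τ : ℝ → ℝ := fun y => if y ≤ b then y else b + (y - b) * s
    have hτ1 : ∀ y, y ≤ b → τ y = y := fun y hy => if_pos hy
    have hτ2 : ∀ y, b < y → τ y = b + (y - b) * s := fun y hy => if_neg hy.not_ge
    have hτ : StrictMono τ := by
      intro y z hyz
      rcases le_or_gt y b with h1 | h1 <;> rcases le_or_gt z b with h2 | h2
      · rwa [hτ1 y h1, hτ1 z h2]
      · rw [hτ1 y h1, hτ2 z h2]
        have : 0 < (z - b) * s := mul_pos (by linarith) hs0
        linarith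
      · linarith
      · rw [hτ2 y h1, hτ2 z h2]
        have : (y - b) * s < (z - b) * s := mul_lt_mul_of_pos_right (by linarith) hs0
        linarith
    have hτs : Function.Surjective τ := by
      intro y
      rcases le_or_gt y b with h1 | h1
      · exact ⟨y, hτ1 y h1⟩
      · refine ⟨b + (y - b) / s, ?_⟩
        have : 0 < (y - b) / s := div_pos (by linarith) hs0
        rw [hτ2 _ (by linarith)]
        field_simp; ring
    have hτa : τ (σ a) = a' := by
      rw [hτ2 _ (by linarith), hs]; field_simp; ring
    refine ⟨σ.trans (hτ.orderIsoOfSurjective τ hτs), fun x => ?_⟩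
    change x ∈ W ↔ τ (σ x) ∈ W'
    rcases eq_or_ne x a with rfl | hxa
    · rw [hτa]; exact ⟨fun _ => haW', fun _ => haW⟩
    · have h1 : x ∈ W ↔ x ∈ W.erase a := by simp [hxa]
      have h2 : τ (σ x) ≠ a' := fun h => hxa (σ.injective (hτ.injective (h.trans hτa.symm)))
      have h3 : τ (σ x) ∈ W' ↔ τ (σ x) ∈ W'.erase a' := by simp [h2]
      rw [h1, h3, hσ]
      constructor
      · intro h; rwa [hτ1 _ (hb _ h)]
      · intro h
        have h4 := hτ1 _ (hb _ h)
        rwa [hτ.injective h4] at h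

lemma polygonPoint_zero (n : ℕ) : polygonPoint n 0 = 1 := by simp [polygonPoint]

/-- The half-plane map obtained from a disk map and an increasing parametrization of the boundary
with the point `1` removed. -/
lemma IsDiskMap.exists_isHalfPlaneMap {X : Type*} [TopologicalSpace X] {n : ℕ} (hn0 : n ≠ 0)
    {ψ : ℂ → X} (h : IsDiskMap ψ) {ρ : ℝ → ℝ} (hρ : StrictMono ρ)
    (hr : range ρ = Ioo 0 (n : ℝ)) : ∃ Ψ, IsHalfPlaneMap Ψ (ψ 1) ∧
      ∀ x : ℝ, Ψ x = ψ (polygonPoint n (ρ x)) := by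
  have hc := strictMono_cayleyAngle hn0
  have hcr := range_cayleyAngle hn0
  choose s hs using fun x => (show ρ x ∈ range (cayleyAngle n) by
    rw [hcr, ← hr]; exact mem_range_self x)
  have hsm : StrictMono s := fun x y hxy => by
    rw [← hc.lt_iff_lt, hs, hs]; exact hρ hxy
  have hss : Function.Surjective s := fun y => by
    obtain ⟨x, hx⟩ : cayleyAngle n y ∈ range ρ := by rw [hr, ← hcr]; exact mem_range_self y
    exact ⟨x, hc.injective ((hs x).trans hx)⟩
  let σ : ℝ ≃o ℝ := hsm.orderIsoOfSurjective s hss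
  refine ⟨_, h.isHalfPlaneMap.comp_orderIso σ, fun x => ?_⟩
  have : (σ x : ℝ) = s x := rfl
  simp only [Complex.ofReal_re, Complex.ofReal_im, Complex.ofReal_zero, zero_mul, add_zero]
  rw [cayley_ofReal hn0, this, hs]

/-- The polygon has one corner more than `W` has points, since `∞` is a corner too; so two points in
`W` already give a triangle. -/
lemma HalfPlaneTiling.exists_polygonTiling {X : Type*} [TopologicalSpace X] {W : Finset ℝ}
    {Ψ : ℂ → X} {p : X} {V : Set X} {𝓔 : Set (Set X)} (h : HalfPlaneTiling W Ψ p V 𝓔)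
    (h2 : 2 ≤ W.card) : ∃ n ψ, PolygonTiling n ψ V 𝓔 := by
  classical
  set n := W.card + 1 with hn
  have hn0 : n ≠ 0 := by omega
  have hnpos : (0 : ℤ) < n := by omega
  have hc := strictMono_cayleyAngle hn0
  have hcr := range_cayleyAngle hn0
  have hint : ∀ k : ℤ, k ∈ Finset.Ioo 0 (n : ℤ) → ∃ x, cayleyAngle n x = k := by
    intro k hk
    rw [Finset.mem_Ioo] at hk
    have : (k : ℝ) ∈ range (cayleyAngle n) := by
      rw [hcr]; exact ⟨by exact_mod_cast hk.1, by exact_mod_cast hk.2⟩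
    exact this
  choose! r hrk using hint
  have hrinj : InjOn r (Finset.Ioo 0 (n : ℤ)) := by
    intro a ha b hb hab
    have := (hrk a ha).symm.trans ((congrArg _ hab).trans (hrk b hb))
    exact_mod_cast this
  have hcard : ((Finset.Ioo 0 (n : ℤ)).image r).card = W.card := by
    rw [Finset.card_image_of_injOn hrinj, Int.card_Ioo]; omega
  -- Reparametrize the real line so that `W` lands exactly on the points whose boundary angle is an
  -- integer strictly between `0` and `n`.
  obtain ⟨σ, hσ⟩ := exists_orderIso_finset W.card W _ rfl hcard
  set ρ : ℝ → ℝ := fun x => cayleyAngle n (σ x) with hρdef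
  have hρ : StrictMono ρ := hc.comp σ.strictMono
  have hr : range ρ = Ioo 0 (n : ℝ) := by
    rw [← hcr]; exact σ.surjective.range_comp (cayleyAngle n)
  have hW : ∀ x, x ∈ W ↔ ρ x ∈ range ((↑) : ℤ → ℝ) := by
    intro x
    rw [hσ, Finset.mem_image]
    constructor
    · rintro ⟨k, hk, hkx⟩; exact ⟨k, by rw [hρdef]; simp only [← hkx, hrk k hk]⟩
    · rintro ⟨k, hk⟩
      have hk := hk.symm
      have hx : ρ x ∈ Ioo 0 (n : ℝ) := hr ▸ mem_range_self x
      rw [hk] at hx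
      have hk' : k ∈ Finset.Ioo 0 (n : ℤ) := by
        rw [Finset.mem_Ioo]; exact ⟨by exact_mod_cast hx.1, by exact_mod_cast hx.2⟩
      exact ⟨k, hk', hc.injective ((hrk k hk').trans hk.symm)⟩
  have hψ := (h.toIsHalfPlaneMap.comp_orderIso σ.symm).isDiskMap
  set ψ : ℂ → X := fun w => if w = 1 then p else
    Ψ ((σ.symm (cayleyInv w).re : ℝ) + (cayleyInv w).im * Complex.I) with hψdef
  have hψx : ∀ x : ℝ, Ψ x = ψ (polygonPoint n (ρ x)) := by
    intro x
    rw [hρdef]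
    simp only
    rw [← cayley_ofReal hn0, hψdef]
    have h0 : (0 : ℝ) ≤ (σ x : ℂ).im := by simp
    simp [cayley_ne_one h0, cayleyInv_cayley h0]
  have hper : ∀ (q : ℤ) (θ : ℝ), ψ (polygonPoint n (θ + q * n)) = ψ (polygonPoint n θ) :=
    fun q θ => by rw [polygonPoint_add_int_mul hn0]
  have hfun : (fun t : ℝ => Ψ t) = fun t => (fun θ => ψ (polygonPoint n θ)) (ρ t) :=
    funext hψx
  have hmod : ∀ k : ℤ, (k : ℝ) = ((k % n : ℤ) : ℝ) + ((k / n : ℤ) : ℝ) * n := by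
    intro k
    have e := Int.mul_ediv_add_emod k n
    have : k = k % n + (k / n) * n := by linarith
    exact_mod_cast this
  have hp : ψ (polygonPoint n ((0 : ℤ) : ℝ)) = p := by
    rw [Int.cast_zero, polygonPoint_zero, hψdef]; simp
  refine ⟨n, ψ, hψ, by omega, ?_, ?_, ?_, ?_, h.disjoint_edges, h.disjoint_vertices⟩
  · intro k
    rw [hmod, hper]
    rcases (Int.emod_nonneg k hnpos.ne').eq_or_lt with h0 | h0
    · rw [← h0, hp]; exact h.infty_mem
    · have hk' : ((k % n : ℤ) : ℝ) ∈ range ρ := by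
        rw [hr]; exact ⟨by exact_mod_cast h0, by exact_mod_cast Int.emod_lt_of_pos k hnpos⟩
      obtain ⟨x, hx⟩ := hk'
      rw [← hx, ← hψx]
      exact h.vertex x ((hW x).mpr ⟨_, hx.symm⟩)
  · intro v hv
    rcases h.vertex_surj v hv with rfl | ⟨w, hw, rfl⟩
    · exact ⟨0, hp⟩
    · obtain ⟨k, hk⟩ := (hW w).mp hw
      exact ⟨k, by rw [hψx, ← hk]⟩
  · intro k
    have h1 := Int.emod_nonneg k hnpos.ne'
    have h2 := Int.emod_lt_of_pos k hnpos
    obtain ⟨x, hx⟩ : ((k % n : ℤ) + 1 / 2 : ℝ) ∈ range ρ := by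
      rw [hr]
      have h1 : (0 : ℝ) ≤ (k % n : ℤ) := by exact_mod_cast h1
      have h2 : ((k % n : ℤ) : ℝ) + 1 ≤ n := by exact_mod_cast h2
      constructor <;> linarith
    have hfl : ⌊ρ x⌋ = k % n := by
      rw [hx, Int.floor_eq_iff]; constructor <;> linarith
    have hxW : x ∉ W := by
      rw [hW]
      rintro ⟨l, hl⟩
      have : ⌊ρ x⌋ = l := by rw [← hl, Int.floor_intCast]
      rw [hx, ← this, hfl] at hl
      linarith
    obtain ⟨E, hE, hb⟩ := h.edge x hxW
    refine ⟨E, hE, ?_⟩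
    rw [hfun] at hb
    have hgap := isGap_int (hr ▸ mem_range_self x) (fun h => hxW ((hW x).mpr h))
    have hb := (bijOn_arc_iff (φ := fun θ => ψ (polygonPoint n θ)) hρ hr hW hgap.1 hgap.2).mp hb
    rw [hfl] at hb
    have := bijOn_Ioo_add (hper (k / n)) hb
    rwa [add_right_comm, ← hmod] at this
  · intro E hE
    obtain ⟨x, hxW, hb⟩ := h.edge_surj E hE
    rw [hfun] at hb
    have hgap := isGap_int (hr ▸ mem_range_self x) (fun h => hxW ((hW x).mpr h))
    exact ⟨_, (bijOn_arc_iff (φ := fun θ => ψ (polygonPoint n θ)) hρ hr hW hgap.1 hgap.2).mp hb⟩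

/-- A half-plane map whose boundary values are described by a cyclic subdivision of an interval
gives rise to a one-tile cell structure. -/
lemma IsHalfPlaneMap.exists_polygonTiling {X : Type*} [TopologicalSpace X] {Ψ : ℂ → X} {p : X}
    (h : IsHalfPlaneMap Ψ p) {ρ : ℝ → ℝ} {m : ℝ} {χ : ℝ → X} {S : Set ℝ}
    {V : Set X} {𝓔 : Set (Set X)} (hρ : StrictMono ρ) (hr : range ρ = Ioo 0 m)
    (hχ : ∀ x : ℝ, Ψ x = χ (ρ x)) (hS : S.Finite) (hSm : S ⊆ Ioo 0 m) (hp : p ∈ V)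
    (hvertex : ∀ s ∈ S, χ s ∈ V) (hsurj : ∀ v ∈ V, v = p ∨ ∃ s ∈ S, χ s = v)
    (hedge : ∀ θ ∈ Ioo 0 m, θ ∉ S → ∃ E ∈ 𝓔, ∃ a b, IsGap S m a b ∧ θ ∈ Ioo a b ∧
      BijOn χ (Ioo a b) E)
    (hedge_surj : ∀ E ∈ 𝓔, ∃ a b, a < b ∧ IsGap S m a b ∧ BijOn χ (Ioo a b) E)
    (hdisj : 𝓔.PairwiseDisjoint id) (hdisj' : ∀ E ∈ 𝓔, Disjoint V E) (hV : 3 ≤ V.ncard) :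
    ∃ n ψ, PolygonTiling n ψ V 𝓔 := by
  have hSr : ∀ s ∈ S, ∃ x, ρ x = s := fun s hs => by
    have : s ∈ range ρ := hr ▸ hSm hs
    exact this
  have hfin : (ρ ⁻¹' S).Finite := hS.preimage hρ.injective.injOn
  set W : Finset ℝ := hfin.toFinset with hWdef
  have hW : ∀ x, x ∈ W ↔ ρ x ∈ S := fun x => by simp [W]
  have hfun : (fun t : ℝ => Ψ t) = fun t => χ (ρ t) := funext hχ
  have hT : HalfPlaneTiling W Ψ p V 𝓔 := by
    refine ⟨h, hp, ?_, ?_, ?_, ?_, hdisj, hdisj'⟩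
    · intro w hw
      rw [hχ]; exact hvertex _ ((hW w).mp hw)
    · intro v hv
      rcases hsurj v hv with rfl | ⟨s, hs, rfl⟩
      · exact Or.inl rfl
      · obtain ⟨x, rfl⟩ := hSr s hs
        exact Or.inr ⟨x, (hW x).mpr hs, hχ x⟩
    · intro x hx
      obtain ⟨E, hE, a, b, hab, hxab, hb⟩ := hedge (ρ x) (hr ▸ mem_range_self x)
        (fun h => hx ((hW x).mpr h))
      exact ⟨E, hE, by rw [hfun]; exact (bijOn_arc_iff hρ hr hW hab hxab).mpr hb⟩
    · intro E hE
      obtain ⟨a, b, hlt, hab, hb⟩ := hedge_surj E hE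
      obtain ⟨θ, hθ⟩ := nonempty_Ioo.mpr hlt
      obtain ⟨x, rfl⟩ : θ ∈ range ρ := by
        rw [hr]; exact ⟨hab.1.trans_lt hθ.1, hθ.2.trans_le hab.2.1⟩
      refine ⟨x, fun hx => hab.2.2.2.2 _ hθ ((hW x).mp hx), ?_⟩
      rw [hfun]; exact (bijOn_arc_iff hρ hr hW hab hθ).mpr hb
  refine hT.exists_polygonTiling ?_
  classical
  -- All vertices are values at `∞` or at `W`, so three vertices force two points in `W`.
  have hsub : V ⊆ ((insert p (W.image fun w : ℝ => Ψ w) : Finset X) : Set X) := by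
    intro v hv
    rcases hT.vertex_surj v hv with rfl | ⟨w, hw, rfl⟩
    · simp
    · simp only [Finset.coe_insert, Finset.coe_image]
      exact Or.inr ⟨w, hw, rfl⟩
  have h1 := Set.ncard_le_ncard hsub (Finset.finite_toSet _)
  rw [Set.ncard_coe_finset] at h1
  have h2 := Finset.card_insert_le p (W.image fun w : ℝ => Ψ w)
  have h3 := Finset.card_image_le (s := W) (f := fun w : ℝ => Ψ w)
  omega

/-! ### Rotating the polygon and removing a vertex of valence two -/

namespace PolygonTiling

section General

variable {X : Type*} [TopologicalSpace X] {n : ℕ} {ψ : ℂ → X} {V : Set X} {𝓔 : Set (Set X)}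

/-- Allows a corner over a prescribed vertex to be put at a convenient index. -/
lemma rotate (h : PolygonTiling n ψ V 𝓔) (j : ℤ) :
    PolygonTiling n (fun z => ψ (polygonPoint n j * z)) V 𝓔 := by
  have hφ : ∀ θ : ℝ, ψ (polygonPoint n j * polygonPoint n θ) = ψ (polygonPoint n (θ + j)) :=
    fun θ => by rw [add_comm, polygonPoint_add]
  have hb : ∀ {k : ℤ} {E : Set X}, SideOver n ψ (k + j) E →
      BijOn (fun θ => ψ (polygonPoint n j * polygonPoint n θ)) (Ioo (k : ℝ) (k + 1)) E := by
    intro k E hk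
    simp only [hφ]
    refine (bijOn_comp_iff (g := fun θ => ψ (polygonPoint n θ)) (f := fun θ : ℝ => θ + j)
      (add_left_injective (j : ℝ)).injOn).mpr ?_
    rw [image_add_const_Ioo]
    unfold SideOver at hk
    push_cast at hk
    rwa [add_right_comm]
  refine ⟨h.toIsDiskMap.comp_mul (norm_polygonPoint _ _), h.three_le, ?_, ?_, ?_, ?_,
    h.disjoint_edges, h.disjoint_vertices⟩
  · intro k
    rw [hφ]; exact_mod_cast h.vertex (k + j)
  · intro v hv
    obtain ⟨k, rfl⟩ := h.vertex_surj v hv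
    exact ⟨k - j, by rw [hφ]; push_cast; simp⟩
  · intro k
    obtain ⟨E, hE, hk⟩ := h.edge (k + j)
    exact ⟨E, hE, hb hk⟩
  · intro E hE
    obtain ⟨k, hk⟩ := h.edge_surj E hE
    exact ⟨k - j, hb (by rw [sub_add_cancel]; exact hk)⟩

lemma rotate_apply {Y : Type*} (n : ℕ) (ψ : ℂ → Y) (j : ℤ) (θ : ℝ) :
    ψ (polygonPoint n j * polygonPoint n θ) = ψ (polygonPoint n (θ + j)) := by
  rw [add_comm, polygonPoint_add]

lemma mem_closure_left [T2Space X] (h : PolygonTiling n ψ V 𝓔) {k : ℤ} {E : Set X} (hE : E ∈ 𝓔)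
    (hk : SideOver n ψ k E) : ψ (polygonPoint n k) ∈ closure E := by
  have : ψ (polygonPoint n k) ∈ closure E \ E := by rw [h.closure_diff hE hk]; simp
  exact this.1

lemma mem_closure_right [T2Space X] (h : PolygonTiling n ψ V 𝓔) {k : ℤ} {E : Set X} (hE : E ∈ 𝓔)
    (hk : SideOver n ψ k E) : ψ (polygonPoint n ((k + 1 : ℤ) : ℝ)) ∈ closure E := by
  have : ψ (polygonPoint n ((k + 1 : ℤ) : ℝ)) ∈ closure E \ E := by rw [h.closure_diff hE hk]; simp
  exact this.1

lemma eq_or_eq_of_mem_closure [T2Space X] (h : PolygonTiling n ψ V 𝓔) {k : ℤ} {E : Set X}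
    (hE : E ∈ 𝓔) (hk : SideOver n ψ k E) {v : X} (hv : v ∈ V) (hvE : v ∈ closure E) :
    v = ψ (polygonPoint n k) ∨ v = ψ (polygonPoint n ((k + 1 : ℤ) : ℝ)) := by
  have : v ∈ closure E \ E := ⟨hvE, disjoint_left.mp (h.disjoint_vertices E hE) hv⟩
  rw [h.closure_diff hE hk] at this
  simpa using this

end General

variable {n : ℕ} {ψ : ℂ → OnePoint ℂ} {V : Set (OnePoint ℂ)} {𝓔 : Set (Set (OnePoint ℂ))}

/-- The cut belonging to the edge under side `k` separates the two ends, so the 1-skeleton has no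
loops. -/
lemma vertex_ne (h : PolygonTiling n ψ V 𝓔) (k : ℤ) :
    ψ (polygonPoint n k) ≠ ψ (polygonPoint n ((k + 1 : ℤ) : ℝ)) := by
  obtain ⟨E, hE, hk⟩ := h.edge k
  obtain ⟨s, hs⟩ := h.exists_cut hE
  have := (hs k).mp hk
  intro he
  rw [he] at this
  tauto

/-- If both sides at the corner lay over one edge, `corner_unique` would make it the only corner
over `v` up to period. Then that edge would be the only one at `v`, contrary to `E₁ ≠ E₂`. -/
lemma sides_of_valence_two (h : PolygonTiling n ψ V 𝓔) {v : OnePoint ℂ} {E₁ E₂ : Set (OnePoint ℂ)}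
    (hv : v ∈ V) (hE₁ : E₁ ∈ 𝓔) (hE₂ : E₂ ∈ 𝓔) (hne : E₁ ≠ E₂) (hv₁ : v ∈ closure E₁)
    (hv₂ : v ∈ closure E₂) (hval : ∀ E ∈ 𝓔, v ∈ closure E → E = E₁ ∨ E = E₂) {k : ℤ}
    (hk : ψ (polygonPoint n k) = v) :
    (SideOver n ψ (k - 1) E₁ ∧ SideOver n ψ k E₂) ∨
      (SideOver n ψ (k - 1) E₂ ∧ SideOver n ψ k E₁) := by
  obtain ⟨E, hE, hkE⟩ := h.edge k
  obtain ⟨E', hE', hkE'⟩ := h.edge (k - 1)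
  have hkE : SideOver n ψ k E := hkE
  have hkE' : SideOver n ψ (k - 1) E' := hkE'
  have h1 := hval E hE (hk ▸ h.mem_closure_left hE hkE)
  have h2 := hval E' hE' (by
    have := h.mem_closure_right hE' hkE'
    rwa [sub_add_cancel, hk] at this)
  have hsame : ∀ F ∈ 𝓔, v ∈ closure F → SideOver n ψ k E → SideOver n ψ (k - 1) E → F = E := by
    intro F hF hvF hkE hkE'
    obtain ⟨j, hj⟩ : ∃ j, SideOver n ψ j F := h.edge_surj F hF
    have huniq : ∀ m : ℤ, v = ψ (polygonPoint n m) → ∃ q : ℤ, m = k + q * n := fun m hm =>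
      h.corner_unique hE hkE hkE' (hm.symm.trans hk.symm)
    rcases h.eq_or_eq_of_mem_closure hF hj hv hvF with h' | h'
    · obtain ⟨q, rfl⟩ := huniq j h'
      exact hj.image_eq.symm.trans (h.side_add hkE q).image_eq
    · obtain ⟨q, hq⟩ := huniq (j + 1) h'
      obtain rfl : j = k - 1 + q * n := by linarith
      exact hj.image_eq.symm.trans (h.side_add hkE' q).image_eq
  rcases h1 with rfl | rfl <;> rcases h2 with rfl | rfl
  · exact absurd (hsame E₂ hE₂ hv₂ hkE hkE').symm hne
  · exact Or.inr ⟨hkE', hkE⟩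
  · exact Or.inl ⟨hkE', hkE⟩
  · exact absurd (hsame E₁ hE₁ hv₁ hkE hkE') hne

/-- A vertex of valence two can be removed by joining the two edges at it. -/
theorem exists_merge (h : PolygonTiling n ψ V 𝓔) {v : OnePoint ℂ} {E₁ E₂ : Set (OnePoint ℂ)}
    (hv : v ∈ V) (hE₁ : E₁ ∈ 𝓔) (hE₂ : E₂ ∈ 𝓔) (hne : E₁ ≠ E₂) (hv₁ : v ∈ closure E₁)
    (hv₂ : v ∈ closure E₂) (hval : ∀ E ∈ 𝓔, v ∈ closure E → E = E₁ ∨ E = E₂)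
    (hcard : 3 ≤ (V \ {v}).ncard) : ∃ n' ψ', PolygonTiling n' ψ' (V \ {v})
      (insert (E₁ ∪ {v} ∪ E₂) (𝓔 \ {E₁, E₂})) := by
  -- Adjacent corners lie over different vertices, so a rotation moves `v` away from corner `0`. No
  -- merged side then straddles the cut of the boundary circle at parameter `0`.
  wlog h0 : ψ (polygonPoint n ((0 : ℤ) : ℝ)) ≠ v generalizing ψ
  · obtain ⟨k, hk⟩ := h.vertex_surj v hv
    refine this (h.rotate (k + 1)) ?_
    rw [rotate_apply n ψ, ← hk]
    simpa using (h.vertex_ne k).symm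
  have hn0 := h.n_ne_zero
  have hnpos : (0 : ℤ) < n := by omega
  set φ : ℝ → OnePoint ℂ := fun θ => ψ (polygonPoint n θ) with hφ
  have hφ0 : φ ((0 : ℤ) : ℝ) ≠ v := h0
  have hφn : φ ((n : ℤ) : ℝ) ≠ v := by
    have := h.vertex_periodic 0 1
    rw [zero_add, one_mul] at this
    rw [hφ]; simp only; rw [this]; exact h0
  have hvE : ∀ E ∈ 𝓔, v ∉ E := fun E hE => disjoint_left.mp (h.disjoint_vertices E hE) hv
  have hdis : ∀ E ∈ 𝓔, ∀ F ∈ 𝓔, E ≠ F → Disjoint E F := fun E hE F hF hEF =>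
    h.disjoint_edges hE hF hEF
  -- The map of the disk stays the same; only the corners over `v` are struck from the list.
  set S : Set ℝ := {θ | θ ∈ Ioo 0 (n : ℝ) ∧ ∃ k : ℤ, θ = k ∧ φ k ≠ v} with hS
  have hS_mem : ∀ k : ℤ, 0 < k → k < n → φ k ≠ v → (k : ℝ) ∈ S := fun k h1 h2 h3 =>
    ⟨⟨by exact_mod_cast h1, by exact_mod_cast h2⟩, k, rfl, h3⟩
  have hleft : ∀ k : ℤ, 0 ≤ k → k < n → φ k ≠ v → (k : ℝ) ∈ S ∨ (k : ℝ) = 0 := by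
    intro k h1 h2 h3
    rcases h1.eq_or_lt with h5 | h5
    · right; exact_mod_cast h5.symm
    · exact Or.inl (hS_mem k h5 h2 h3)
  have hright : ∀ k : ℤ, 0 < k → k ≤ n → φ k ≠ v → (k : ℝ) ∈ S ∨ (k : ℝ) = n := by
    intro k h1 h2 h3
    rcases h2.eq_or_lt with h5 | h5
    · right; exact_mod_cast h5
    · exact Or.inl (hS_mem k h1 h5 h3)
  have hmerged : ∀ k : ℤ, 0 < k → k < n → φ k = v → IsGap S n (k - 1) (k + 1) ∧
      BijOn φ (Ioo ((k : ℝ) - 1) (k + 1)) (E₁ ∪ {v} ∪ E₂) := by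
    intro k hk0 hkn hkv
    have hk1 : φ ((k - 1 : ℤ) : ℝ) ≠ v := by
      have := h.vertex_ne (k - 1)
      rw [sub_add_cancel] at this
      rwa [← hkv]
    have hk2 : φ ((k + 1 : ℤ) : ℝ) ≠ v := by
      rw [← hkv]; exact (h.vertex_ne k).symm
    refine ⟨⟨?_, ?_, ?_, ?_, ?_⟩, ?_⟩
    · have : (0 : ℤ) ≤ k - 1 := by omega
      exact_mod_cast this
    · exact_mod_cast hkn
    · exact_mod_cast hleft (k - 1) (by omega) (by omega) hk1
    · exact_mod_cast hright (k + 1) (by omega) (by omega) hk2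
    · rintro θ hθ ⟨-, j, rfl, hj⟩
      have h1 : k - 1 < j := by exact_mod_cast hθ.1
      have h2 : j < k + 1 := by exact_mod_cast hθ.2
      obtain rfl : j = k := by omega
      exact hj hkv
    · have hsplit : Ioo ((k : ℝ) - 1) (k + 1) = Ioo ((k : ℝ) - 1) k ∪ {(k : ℝ)} ∪
          Ioo (k : ℝ) (k + 1) := by
        ext θ
        simp only [mem_Ioo, mem_union, mem_singleton_iff]
        constructor
        · intro hθ
          rcases lt_trichotomy θ k with h1 | h1 | h1
          · exact Or.inl (Or.inl ⟨hθ.1, h1⟩)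
          · exact Or.inl (Or.inr h1)
          · exact Or.inr ⟨h1, hθ.2⟩
        · rintro ((h1 | h1) | h1)
          · exact ⟨h1.1, by linarith [h1.2]⟩
          · rw [h1]; constructor <;> linarith
          · exact ⟨by linarith [h1.1], h1.2⟩
      have key : ∀ F₁ ∈ 𝓔, ∀ F₂ ∈ 𝓔, F₁ ≠ F₂ → SideOver n ψ (k - 1) F₁ → SideOver n ψ k F₂ →
          BijOn φ (Ioo ((k : ℝ) - 1) (k + 1)) (F₁ ∪ {v} ∪ F₂) := by
        intro F₁ hF₁ F₂ hF₂ hF h1 h2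
        unfold SideOver at h1
        push_cast at h1
        rw [sub_add_cancel] at h1
        rw [hsplit]
        have h3 : BijOn φ {(k : ℝ)} {v} := by
          rw [← hkv]; exact (bijOn_singleton).mpr rfl
        have h4 : BijOn φ (Ioo ((k : ℝ) - 1) k ∪ {(k : ℝ)}) (F₁ ∪ {v}) := by
          refine h1.union h3 ((injOn_union ?_).mpr ⟨h1.injOn, h3.injOn, ?_⟩)
          · rw [disjoint_singleton_right]; simp
          · rintro x hx y rfl he
            have h5 : φ x ∈ F₁ := h1.mapsTo hx
            rw [show φ x = φ k from he, hkv] at h5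
            exact hvE F₁ hF₁ h5
        refine h4.union h2 ((injOn_union ?_).mpr ⟨h4.injOn, h2.injOn, ?_⟩)
        · rw [disjoint_left]
          rintro x (hx | rfl) hy
          · linarith [hx.2, hy.1]
          · linarith [hy.1]
        · intro x hx y hy he
          have h5 := h4.mapsTo hx
          have h6 : φ y ∈ F₂ := h2.mapsTo hy
          rw [show φ x = φ y from he] at h5
          rcases h5 with h5 | h5
          · exact disjoint_left.mp (hdis F₁ hF₁ F₂ hF₂ hF) h5 h6
          · exact hvE F₂ hF₂ (mem_singleton_iff.mp h5 ▸ h6)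
      rcases h.sides_of_valence_two hv hE₁ hE₂ hne hv₁ hv₂ hval hkv with ⟨h1, h2⟩ | ⟨h1, h2⟩
      · exact key E₁ hE₁ E₂ hE₂ hne h1 h2
      · have := key E₂ hE₂ E₁ hE₁ hne.symm h1 h2
        rwa [union_comm, ← union_assoc, union_right_comm] at this
  have hgap : ∀ k : ℤ, 0 ≤ k → k < n → φ k ≠ v → φ ((k + 1 : ℤ) : ℝ) ≠ v →
      IsGap S n k (k + 1) := by
    intro k h1 h2 h3 h4
    refine ⟨by exact_mod_cast h1, by exact_mod_cast h2, hleft k h1 h2 h3, ?_, ?_⟩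
    · exact_mod_cast hright (k + 1) (by omega) (by omega) h4
    · rintro θ hθ ⟨-, j, rfl, -⟩
      have h1 : k < j := by exact_mod_cast hθ.1
      have h2 : j < k + 1 := by exact_mod_cast hθ.2
      omega
  obtain ⟨Ψ, hΨ, hΨx⟩ := h.toIsDiskMap.exists_isHalfPlaneMap hn0 (strictMono_cayleyAngle hn0)
    (range_cayleyAngle hn0)
  have hp : ψ 1 = φ ((0 : ℤ) : ℝ) := by
    rw [hφ]; simp only [Int.cast_zero]; rw [polygonPoint_zero]
  have hrep : ∀ k : ℤ, ∃ j : ℤ, 0 ≤ j ∧ j < n ∧ ∃ q : ℤ, j = k + q * n := by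
    intro k
    obtain ⟨q, hq1, hq2⟩ := h.exists_rep 0 k
    exact ⟨_, hq1, by simpa using hq2, q, rfl⟩
  refine hΨ.exists_polygonTiling (S := S) (χ := φ) (strictMono_cayleyAngle hn0)
    (range_cayleyAngle hn0) hΨx ?_ (fun θ hθ => hθ.1) ?_ ?_ ?_ ?_ ?_ ?_ ?_ hcard
  · refine ((Set.finite_Ioo (0 : ℤ) n).image ((↑) : ℤ → ℝ)).subset ?_
    rintro θ ⟨hθ, k, rfl, -⟩
    exact ⟨k, ⟨by exact_mod_cast hθ.1, by exact_mod_cast hθ.2⟩, rfl⟩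
  · rw [hp]; exact ⟨h.vertex 0, hφ0⟩
  · rintro s ⟨-, k, rfl, hk⟩
    exact ⟨h.vertex k, hk⟩
  · rintro w ⟨hw, hwv⟩
    obtain ⟨k, rfl⟩ := h.vertex_surj w hw
    obtain ⟨j, hj0, hjn, q, rfl⟩ := hrep k
    rw [← h.vertex_periodic k q] at hwv ⊢
    rcases hj0.eq_or_lt with h1 | h1
    · left; rw [← h1, hp]
    · right
      exact ⟨_, ⟨⟨by exact_mod_cast h1, by exact_mod_cast hjn⟩, _, rfl, hwv⟩, rfl⟩
  · intro θ hθ hθS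
    have hM : ∀ k : ℤ, 0 < k → k < n → φ k = v → θ ∈ Ioo ((k : ℝ) - 1) (k + 1) →
        ∃ E ∈ insert (E₁ ∪ {v} ∪ E₂) (𝓔 \ {E₁, E₂}), ∃ a b, IsGap S n a b ∧ θ ∈ Ioo a b ∧
          BijOn φ (Ioo a b) E := fun k h1 h2 h3 h4 =>
      ⟨_, mem_insert _ _, _, _, (hmerged k h1 h2 h3).1, h4, (hmerged k h1 h2 h3).2⟩
    have hf0 : 0 ≤ ⌊θ⌋ := Int.floor_nonneg.mpr hθ.1.le
    have hfn : ⌊θ⌋ < n := Int.floor_lt.mpr (by exact_mod_cast hθ.2)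
    by_cases hi : θ = ⌊θ⌋
    · have h1 : φ ⌊θ⌋ = v := by
        by_contra hne
        exact hθS ⟨hθ, _, hi, hne⟩
      have h2 : (0 : ℝ) < ⌊θ⌋ := hi ▸ hθ.1
      refine hM ⌊θ⌋ (by exact_mod_cast h2) hfn h1 ?_
      rw [← hi]; constructor <;> linarith
    · have hk : θ ∈ Ioo (⌊θ⌋ : ℝ) (⌊θ⌋ + 1) :=
        ⟨(Int.floor_le θ).lt_of_ne (Ne.symm hi), Int.lt_floor_add_one θ⟩
      generalize ⌊θ⌋ = k at hf0 hfn hk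
      by_cases h1 : φ k = v
      · refine hM k ?_ hfn h1 ⟨by linarith [hk.1], hk.2⟩
        rcases hf0.eq_or_lt with h2 | h2
        · rw [← h2] at h1; exact absurd h1 hφ0
        · exact h2
      by_cases h2 : φ ((k + 1 : ℤ) : ℝ) = v
      · refine hM (k + 1) (by omega) ?_ h2 ?_
        · refine lt_of_le_of_ne (by omega) fun h3 => ?_
          rw [h3] at h2; exact hφn h2
        · push_cast; constructor <;> linarith [hk.1, hk.2]
      obtain ⟨E, hE, hkE⟩ := h.edge k
      refine ⟨E, Or.inr ⟨hE, ?_⟩, k, k + 1, hgap k hf0 hfn h1 h2, hk, hkE⟩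
      have h3 : v ∉ closure E := fun h3 => by
        rcases h.eq_or_eq_of_mem_closure hE hkE hv h3 with h4 | h4
        · exact h1 h4.symm
        · exact h2 h4.symm
      rintro (rfl | rfl)
      · exact h3 hv₁
      · exact h3 hv₂
  · rintro E (rfl | ⟨hE, hE'⟩)
    · obtain ⟨k, hk⟩ := h.vertex_surj v hv
      obtain ⟨j, hj0, hjn, q, rfl⟩ := hrep k
      rw [← h.vertex_periodic k q] at hk
      have hj : 0 < k + q * n := by
        rcases hj0.eq_or_lt with h1 | h1
        · rw [← h1] at hk; exact absurd hk hφ0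
        · exact h1
      exact ⟨_, _, by linarith, hmerged _ hj hjn hk⟩
    · obtain ⟨k, hk⟩ : ∃ k, SideOver n ψ k E := h.edge_surj E hE
      obtain ⟨j, hj0, hjn, q, rfl⟩ := hrep k
      have hk := h.side_add hk q
      have h3 : v ∉ closure E := fun h3 => by
        have := hval E hE h3
        simp only [mem_insert_iff, mem_singleton_iff] at hE'
        tauto
      refine ⟨_, _, by linarith, hgap _ hj0 hjn ?_ ?_, hk⟩
      · intro h4; exact h3 (h4 ▸ h.mem_closure_left hE hk)
      · intro h4; exact h3 (h4 ▸ h.mem_closure_right hE hk)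
  · have key : ∀ E ∈ 𝓔 \ {E₁, E₂}, Disjoint (E₁ ∪ {v} ∪ E₂) E := by
      rintro E ⟨hE, hE'⟩
      simp only [mem_insert_iff, mem_singleton_iff, not_or] at hE'
      simp only [disjoint_union_left, disjoint_singleton_left]
      exact ⟨⟨hdis E₁ hE₁ E hE (Ne.symm hE'.1), hvE E hE⟩, hdis E₂ hE₂ E hE (Ne.symm hE'.2)⟩
    refine (PairwiseDisjoint.insert (h.disjoint_edges.subset sdiff_subset) ?_)
    intro E hE _
    exact key E hE
  · rintro E (rfl | ⟨hE, hE'⟩)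
    · simp only [disjoint_union_right, disjoint_singleton_right]
      exact ⟨⟨(h.disjoint_vertices E₁ hE₁).mono_left sdiff_subset, by simp⟩,
        (h.disjoint_vertices E₂ hE₂).mono_left sdiff_subset⟩
    · exact (h.disjoint_vertices E hE).mono_left sdiff_subset

end PolygonTiling

/-! ### Boundary parametrizations before and after folding -/

/-- An increasing parametrization of `(0, m)` which is symmetric about the point `2`, up to a
given decreasing bijection from `(2, 3)` onto `(1, 2)`. -/
def foldParam (m : ℝ) (g : ℝ → ℝ) (x : ℝ) : ℝ :=
  if 1 ≤ x then 3 + (m - 3) * (1 - 1 / x)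
  else if 0 ≤ x then 2 + x
  else if -1 < x then g (2 - x)
  else -1 / x

section FoldParam

variable {m : ℝ} {g : ℝ → ℝ}

lemma foldParam_of_one_le {x : ℝ} (hx : 1 ≤ x) : foldParam m g x = 3 + (m - 3) * (1 - 1 / x) :=
  if_pos hx

lemma foldParam_of_mem {x : ℝ} (hx : x ∈ Icc (0 : ℝ) 1) : foldParam m g x = 2 + x := by
  rcases hx.2.eq_or_lt with h | h
  · rw [h, foldParam_of_one_le le_rfl]; norm_num
  · rw [foldParam, if_neg h.not_ge, if_pos hx.1]

lemma foldParam_of_neg {x : ℝ} (hx : x ∈ Ioo (-1 : ℝ) 0) : foldParam m g x = g (2 - x) := by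
  rw [foldParam, if_neg (by linarith [hx.2]), if_neg (by linarith [hx.2]), if_pos hx.1]

lemma foldParam_of_le {x : ℝ} (hx : x ≤ -1) : foldParam m g x = -1 / x := by
  rw [foldParam, if_neg (by linarith), if_neg (by linarith), if_neg hx.not_gt]

/-- The breakpoints `-1`, `0`, `1` go to the corners `1`, `2`, `3`. Corner `2` will be the tip of
the leaf, and `[-1, 1]` the segment to be zipped up. -/
lemma foldParam_mem (hm : 3 < m) (hg : MapsTo g (Ioo 2 3) (Ioo 1 2)) (x : ℝ) :
    (1 ≤ x ∧ foldParam m g x ∈ Ico 3 m) ∨ (x ∈ Ico (0 : ℝ) 1 ∧ foldParam m g x ∈ Ico (2 : ℝ) 3) ∨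
      (x ∈ Ioo (-1 : ℝ) 0 ∧ foldParam m g x ∈ Ioo (1 : ℝ) 2) ∨
      (x ≤ -1 ∧ foldParam m g x ∈ Ioc (0 : ℝ) 1) := by
  rcases le_or_gt 1 x with h1 | h1
  · left
    refine ⟨h1, ?_⟩
    rw [foldParam_of_one_le h1]
    have h2 : 1 / x ≤ 1 := (div_le_one (by linarith)).mpr h1
    have h3 : 0 < 1 / x := by positivity
    constructor <;> nlinarith
  rcases le_or_gt 0 x with h2 | h2
  · right; left
    refine ⟨⟨h2, h1⟩, ?_⟩
    rw [foldParam_of_mem ⟨h2, h1.le⟩]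
    constructor <;> linarith
  rcases lt_or_ge (-1) x with h3 | h3
  · right; right; left
    refine ⟨⟨h3, h2⟩, ?_⟩
    rw [foldParam_of_neg ⟨h3, h2⟩]
    exact hg ⟨by linarith, by linarith⟩
  · right; right; right
    refine ⟨h3, ?_⟩
    rw [foldParam_of_le h3]
    constructor
    · exact div_pos_of_neg_of_neg (by norm_num) (by linarith)
    · rw [div_le_one_of_neg (by linarith)]; exact h3

lemma strictMono_foldParam (hm : 3 < m) (hg : MapsTo g (Ioo 2 3) (Ioo 1 2))
    (hga : StrictAntiOn g (Ioo 2 3)) : StrictMono (foldParam m g) := by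
  intro x y hxy
  rcases foldParam_mem hm hg x with ⟨h1, h1'⟩ | ⟨h1, h1'⟩ | ⟨h1, h1'⟩ | ⟨h1, h1'⟩ <;>
    rcases foldParam_mem hm hg y with ⟨h2, h2'⟩ | ⟨h2, h2'⟩ | ⟨h2, h2'⟩ | ⟨h2, h2'⟩
  · rw [foldParam_of_one_le h1, foldParam_of_one_le h2]
    have : 1 / y < 1 / x := one_div_lt_one_div_of_lt (by linarith) hxy
    have := mul_lt_mul_of_pos_left (sub_lt_sub_left this 1) (sub_pos.mpr hm)
    linarith
  · linarith [h2.2]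
  · linarith [h2.2]
  · linarith
  · exact h1'.2.trans_le h2'.1
  · rw [foldParam_of_mem (Ico_subset_Icc_self h1), foldParam_of_mem (Ico_subset_Icc_self h2)]
    linarith
  · linarith [h2.2, h1.1]
  · linarith [h1.1]
  · linarith [h1'.2, h2'.1]
  · linarith [h1'.2, h2'.1]
  · rw [foldParam_of_neg h1, foldParam_of_neg h2]
    exact hga ⟨by linarith [h2.2], by linarith [h2.1]⟩ ⟨by linarith [h1.2], by linarith [h1.1]⟩
      (by linarith)
  · linarith [h1.1]
  · linarith [h1'.2, h2'.1]
  · linarith [h1'.2, h2'.1]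
  · linarith [h1'.2, h2'.1]
  · rw [foldParam_of_le h1, foldParam_of_le h2, neg_div, neg_div]
    have := one_div_lt_one_div_of_neg_of_lt (by linarith : y < 0) hxy
    linarith

lemma range_foldParam (hm : 3 < m) (hg : MapsTo g (Ioo 2 3) (Ioo 1 2))
    (hgs : SurjOn g (Ioo 2 3) (Ioo 1 2)) : range (foldParam m g) = Ioo 0 m := by
  ext θ
  constructor
  · rintro ⟨x, rfl⟩
    rcases foldParam_mem hm hg x with ⟨-, h⟩ | ⟨-, h⟩ | ⟨-, h⟩ | ⟨-, h⟩ <;>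
      constructor <;> linarith [h.1, h.2]
  · rintro ⟨h0, h1⟩
    rcases le_or_gt θ 1 with h2 | h2
    · have : -1 / θ ≤ -1 := by rw [div_le_iff₀ h0]; linarith
      refine ⟨-1 / θ, ?_⟩
      rw [foldParam_of_le this]; field_simp
    rcases lt_or_ge θ 2 with h3 | h3
    · obtain ⟨t, ht, rfl⟩ := hgs ⟨h2, h3⟩
      refine ⟨2 - t, ?_⟩
      rw [foldParam_of_neg ⟨by linarith [ht.2], by linarith [ht.1]⟩]
      congr 1; ring
    rcases le_or_gt θ 3 with h4 | h4
    · refine ⟨θ - 2, ?_⟩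
      rw [foldParam_of_mem ⟨by linarith, by linarith⟩]; ring
    · have h5 : 0 < m - θ := by linarith
      have h6 : m - 3 ≠ 0 := by linarith
      refine ⟨(m - 3) / (m - θ), ?_⟩
      rw [foldParam_of_one_le (by rw [le_div_iff₀ h5]; linarith)]
      field_simp; ring

end FoldParam

/-- The parametrization of `(0, m)` induced by `foldParam` after folding. -/
def foldedParam (m : ℝ) (x : ℝ) : ℝ := if 0 ≤ x then 1 + (m - 1) * (x / (x + 1)) else 1 / (1 - x)

lemma strictMono_foldedParam {m : ℝ} (hm : 1 < m) : StrictMono (foldedParam m) := by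
  intro x y hxy
  unfold foldedParam
  split_ifs with h1 h2 h2
  · have : x / (x + 1) < y / (y + 1) := by
      rw [div_lt_div_iff₀ (by linarith) (by linarith)]; linarith
    have := mul_lt_mul_of_pos_left this (sub_pos.mpr hm)
    linarith
  · linarith
  · have h3 : 1 / (1 - x) < 1 := by rw [div_lt_one (by linarith)]; linarith
    have h4 : 0 ≤ y / (y + 1) := by positivity
    have h5 : 0 ≤ m - 1 := by linarith
    have h6 : 0 ≤ (m - 1) * (y / (y + 1)) := by positivity
    linarith
  · exact one_div_lt_one_div_of_lt (by linarith) (by linarith)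

lemma range_foldedParam {m : ℝ} (hm : 1 < m) : range (foldedParam m) = Ioo 0 m := by
  ext θ
  constructor
  · rintro ⟨x, rfl⟩
    unfold foldedParam
    split_ifs with h1
    · have h4 : 0 ≤ x / (x + 1) := by positivity
      have h5 : x / (x + 1) < 1 := by rw [div_lt_one (by linarith)]; linarith
      constructor <;> nlinarith
    · have h3 : 1 / (1 - x) < 1 := by rw [div_lt_one (by linarith)]; linarith
      have h4 : 0 < 1 / (1 - x) := div_pos one_pos (by linarith)
      exact ⟨h4, by linarith⟩
  · rintro ⟨h0, h1⟩
    rcases lt_or_ge θ 1 with h2 | h2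
    · have : 1 < 1 / θ := by rw [lt_div_iff₀ h0]; linarith
      refine ⟨1 - 1 / θ, ?_⟩
      rw [foldedParam, if_neg (by linarith)]
      simp
    · have h3 : 0 < m - θ := by linarith
      have h4 : 0 ≤ (θ - 1) / (m - θ) := div_nonneg (by linarith) h3.le
      refine ⟨(θ - 1) / (m - θ), ?_⟩
      rw [foldedParam, if_pos h4]
      have : (θ - 1) / (m - θ) + 1 = (m - 1) / (m - θ) := by field_simp; ring
      rw [this]
      have : m - 1 ≠ 0 := by linarith
      field_simp; ring

/-! ### Removing a vertex of valence one -/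

namespace PolygonTiling

variable {n : ℕ} {ψ : ℂ → OnePoint ℂ} {V : Set (OnePoint ℂ)} {𝓔 : Set (Set (OnePoint ℂ))}

/-- `g` sends a point of side `2` to the point of side `1` with the same image in `E`; that it
decreases is `side_antitone`. It serves as the middle piece of `foldParam`. -/
lemma exists_gluing (h : PolygonTiling n ψ V 𝓔) {E : Set (OnePoint ℂ)} (h1 : SideOver n ψ 1 E)
    (h2 : SideOver n ψ 2 E) : ∃ g : ℝ → ℝ, MapsTo g (Ioo 2 3) (Ioo 1 2) ∧
      SurjOn g (Ioo 2 3) (Ioo 1 2) ∧ StrictAntiOn g (Ioo 2 3) ∧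
      ∀ t ∈ Ioo (2 : ℝ) 3, ψ (polygonPoint n (g t)) = ψ (polygonPoint n t) := by
  have hn := h.three_le
  have e1 : Ioo ((1 : ℤ) : ℝ) ((1 : ℤ) + 1) = Ioo 1 2 := by norm_num
  have e2 : Ioo ((2 : ℤ) : ℝ) ((2 : ℤ) + 1) = Ioo 2 3 := by norm_num
  have h1' := h1
  have h2' := h2
  unfold SideOver at h1 h2
  rw [e1] at h1
  rw [e2] at h2
  choose! g hg hgφ using fun t (ht : t ∈ Ioo (2 : ℝ) 3) => h1.surjOn (h2.mapsTo ht)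
  refine ⟨g, hg, ?_, ?_, hgφ⟩
  · intro s hs
    obtain ⟨t, ht, hts⟩ := h2.surjOn (h1.mapsTo hs)
    exact ⟨t, ht, h1.injOn (hg t ht) hs ((hgφ t ht).trans hts)⟩
  · intro t ht t' ht' htt
    by_contra hle
    rcases (not_lt.mp hle).eq_or_lt with he | hlt
    · have := (hgφ t ht).symm.trans ((congrArg (fun θ => ψ (polygonPoint n θ)) he).trans (hgφ t' ht'))
      exact htt.ne (h2.injOn ht ht' this)
    · have := h.side_antitone h1' (by norm_num : (1 : ℤ) < 2) (by omega) (e1 ▸ hg t ht)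
        (e1 ▸ hg t' ht') (e2 ▸ ht) (e2 ▸ ht') hlt (hgφ t ht) (hgφ t' ht')
      exact absurd this htt.not_gt

set_option maxHeartbeats 400000 in
/-- A vertex of valence one can be removed together with the edge at it. -/
theorem exists_removeLeaf (h : PolygonTiling n ψ V 𝓔) {v : OnePoint ℂ} {E : Set (OnePoint ℂ)}
    (hv : v ∈ V) (hE : E ∈ 𝓔) (hval : ∀ F ∈ 𝓔, v ∈ closure F → F = E)
    (hcard : 3 ≤ (V \ {v}).ncard) : ∃ n' ψ', PolygonTiling n' ψ' (V \ {v}) (𝓔 \ {E}) := by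
  -- With the tip of the leaf at corner `2`, sides `1` and `2` are the two sides over its edge.
  wlog h0 : ψ (polygonPoint n ((2 : ℤ) : ℝ)) = v generalizing ψ
  · obtain ⟨k, hk⟩ := h.vertex_surj v hv
    refine this (h.rotate (k - 2)) ?_
    rw [rotate_apply n ψ, ← hk]
    push_cast; congr 2; ring
  have hn0 := h.n_ne_zero
  have hnpos : (0 : ℤ) < n := by omega
  set φ : ℝ → OnePoint ℂ := fun θ => ψ (polygonPoint n θ) with hφ
  have h2 : SideOver n ψ 2 E := by
    obtain ⟨F, hF, hk⟩ := h.edge 2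
    have := hval F hF (h0 ▸ h.mem_closure_left hF hk)
    exact this ▸ hk
  have h1 : SideOver n ψ 1 E := by
    obtain ⟨F, hF, hk⟩ := h.edge 1
    have h3 := h.mem_closure_right hF hk
    rw [show (1 + 1 : ℤ) = 2 from rfl, h0] at h3
    exact hval F hF h3 ▸ hk
  have hcorner : ∀ m : ℤ, φ m = v → ∃ q : ℤ, m = 2 + q * n := by
    intro m hm
    have h1' : SideOver n ψ (2 - 1) E := by norm_num; exact h1
    have hm' : ψ (polygonPoint n m) = ψ (polygonPoint n ((2 : ℤ) : ℝ)) := by rw [h0]; exact hm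
    exact h.corner_unique hE h2 h1' hm'
  have hsides : ∀ m : ℤ, SideOver n ψ m E → 0 ≤ m → m < n → m = 1 ∨ m = 2 := by
    intro m hm hm0 hmn
    by_contra hne
    push Not at hne
    have hn := h.three_le
    rcases hm0.eq_or_lt with rfl | h3
    · refine h.not_three_sides hm h1 h2 (by omega) (by omega) (by omega)
    · exact h.not_three_sides h1 h2 hm (by omega) (by omega) (by omega)
  -- Sides `1` and `2` have the same pair of ends, and corner `1` differs from the tip.
  have h13 : φ 1 = φ 3 := by
    have := (h.closure_diff hE h1).symm.trans (h.closure_diff hE h2)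
    have hne := h.vertex_ne 1
    have h3 : ψ (polygonPoint n ((1 : ℤ) : ℝ)) ∈ ({ψ (polygonPoint n ((2 : ℤ) : ℝ)),
        ψ (polygonPoint n ((2 + 1 : ℤ) : ℝ))} : Set (OnePoint ℂ)) := by
      rw [← this]; simp
    rcases h3 with h3 | h3
    · exact absurd h3 hne
    · have h3 := mem_singleton_iff.mp h3
      norm_num at h3
      exact h3
  have hrep : ∀ k : ℤ, ∃ j : ℤ, 0 ≤ j ∧ j < n ∧ ∃ q : ℤ, j = k + q * n := by
    intro k
    obtain ⟨q, hq1, hq2⟩ := h.exists_rep 0 k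
    exact ⟨_, hq1, by simpa using hq2, q, rfl⟩
  have hφ2 : φ 2 = v := by simpa using h0
  -- In a polygon with at most four corners, corner `2` is the tip and corner `3` repeats corner
  -- `1`, leaving at most two other vertices.
  have hn5 : 5 ≤ n := by
    by_contra hlt
    have hsub : V \ {v} ⊆ {φ 0, φ 1} := by
      rintro w ⟨hw, hwv⟩
      obtain ⟨k, rfl⟩ := h.vertex_surj w hw
      obtain ⟨j, hj0, hjn, q, rfl⟩ := hrep k
      rw [← h.vertex_periodic k q] at hwv ⊢
      have hj4 : k + q * n < 4 := by omega
      generalize k + q * n = j at *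
      interval_cases j
      · simp [φ]
      · simp [φ]
      · exact absurd h0 hwv
      · rw [h13]; simp [φ]
    have h3 := Set.ncard_le_ncard hsub (by simp)
    have h4 := Set.ncard_insert_le (φ 0) {φ 1}
    rw [Set.ncard_singleton] at h4
    omega
  have hn5' : (5 : ℝ) ≤ n := by exact_mod_cast hn5
  obtain ⟨g, hg, hgs, hga, hgφ⟩ := h.exists_gluing h1 h2
  have hm : (3 : ℝ) < n := by linarith
  have hρ := strictMono_foldParam hm hg hga
  have hr := range_foldParam hm hg hgs
  obtain ⟨Ψ, hΨ, hΨx⟩ := h.toIsDiskMap.exists_isHalfPlaneMap hn0 hρ hr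
  have hΨx : ∀ x : ℝ, Ψ x = φ (foldParam n g x) := hΨx
  have hp : ψ 1 = φ ((0 : ℤ) : ℝ) := by
    rw [hφ]; simp only [Int.cast_zero]; rw [polygonPoint_zero]
  have e2 : Ioo ((2 : ℤ) : ℝ) ((2 : ℤ) + 1) = Ioo 2 3 := by norm_num
  have e1 : Ioo ((1 : ℤ) : ℝ) ((1 : ℤ) + 1) = Ioo 1 2 := by norm_num
  -- In the parameter of `foldParam`, the points `t` and `-t` of `[-1, 1]` have the same image.
  -- Conversely, a point of `E` is hit only on sides `1` and `2`, and the tip only at corner `2`.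
  have hfold : IsHalfPlaneMap (fun z => Ψ (slit z)) (ψ 1) := by
    refine hΨ.fold ?_ ?_ ?_
    · intro t ht0 ht1
      rw [hΨx, hΨx]
      rcases ht0.eq_or_lt with rfl | ht0
      · simp
      rcases ht1.eq_or_lt with rfl | ht1
      · rw [foldParam_of_le le_rfl, foldParam_of_mem ⟨zero_le_one, le_rfl⟩]
        norm_num
        exact h13.symm
      · rw [foldParam_of_mem ⟨ht0.le, ht1.le⟩, foldParam_of_neg ⟨by linarith, by linarith⟩,
          sub_neg_eq_add]
        exact (hgφ _ ⟨by linarith, by linarith⟩).symm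
    · intro t s ht0 ht1 hts
      rw [hΨx, hΨx] at hts
      have hsr : foldParam n g s ∈ Ioo 0 (n : ℝ) := hr ▸ mem_range_self s
      rw [foldParam_of_mem ⟨ht0, ht1.le⟩] at hts
      rcases ht0.eq_or_lt with rfl | ht0
      · left
        rw [add_zero, hφ2] at hts
        obtain ⟨k, hk⟩ := h.exists_int_of_mem (hts ▸ hv : φ (foldParam n g s) ∈ V)
        rw [hk] at hts hsr
        obtain ⟨q, rfl⟩ := hcorner k hts.symm
        have h3 : 0 < 2 + q * n := by exact_mod_cast hsr.1
        have h4 : 2 + q * n < n := by exact_mod_cast hsr.2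
        have hq : q = 0 := by
          rcases lt_trichotomy q 0 with h5 | h5 | h5
          · nlinarith
          · exact h5
          · nlinarith
        refine hρ.injective ?_
        rw [hk, hq, foldParam_of_mem ⟨le_rfl, zero_le_one⟩]
        norm_num
      · have htE : φ (2 + t) ∈ E := h2.mapsTo (e2 ▸ ⟨by linarith, by linarith⟩)
        obtain ⟨k, hk, hkE⟩ := h.exists_side hE (hts ▸ htE : φ (foldParam n g s) ∈ E)
        have h3 : (-1 : ℝ) < k := by linarith [hk.2, hsr.1]
        have h4 : (k : ℝ) < n := by linarith [hk.1, hsr.2]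
        have h3 : -1 < k := by exact_mod_cast h3
        have h4 : k < n := by exact_mod_cast h4
        rcases hsides k hkE (by omega) h4 with rfl | rfl
        · right
          refine hρ.injective ?_
          have h5 : foldParam n g (-t) = g (2 + t) := by
            rw [foldParam_of_neg ⟨by linarith, by linarith⟩, sub_neg_eq_add]
          have h6 : (2 + t) ∈ Ioo (2 : ℝ) 3 := ⟨by linarith, by linarith⟩
          rw [h5]
          exact h1.injOn hk (e1 ▸ hg h6) (hts.symm.trans (hgφ _ h6).symm)
        · left
          refine hρ.injective ?_
          rw [foldParam_of_mem (x := t) ⟨ht0.le, ht1.le⟩]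
          exact h2.injOn hk (e2 ▸ ⟨by linarith, by linarith⟩) hts.symm
    · intro t ht0 ht1 htp
      rw [hΨx, hp, foldParam_of_mem ⟨ht0, ht1.le⟩] at htp
      rcases ht0.eq_or_lt with rfl | ht0
      · rw [add_zero, hφ2] at htp
        obtain ⟨q, hq⟩ := hcorner 0 htp.symm
        have : (n : ℤ) ∣ 2 := ⟨-q, by linarith⟩
        have := Int.le_of_dvd (by norm_num) this
        omega
      · have htE : φ (2 + t) ∈ E := h2.mapsTo (e2 ▸ ⟨by linarith, by linarith⟩)
        rw [htp] at htE
        exact disjoint_left.mp (h.disjoint_vertices E hE) (h.vertex 0) htE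
  set m : ℝ := n - 2 with hmdef
  have hm1 : 1 < m := by linarith
  -- The new boundary omits sides `1` and `2`: it follows the old one up to corner `1` and continues
  -- from corner `3`, shifted by two. Hence its length is `m = n - 2`.
  set χ : ℝ → OnePoint ℂ := fun θ => if θ < 1 then φ θ else φ (θ + 2) with hχ
  have hχ1 : ∀ θ, θ ≤ 1 → χ θ = φ θ := by
    intro θ hθ
    rcases hθ.lt_or_eq with h3 | h3
    · exact if_pos h3
    · rw [h3, hχ]; norm_num; exact h13.symm
  have hχ2 : ∀ θ, 1 ≤ θ → χ θ = φ (θ + 2) := fun θ hθ => if_neg hθ.not_gt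
  have hχside : ∀ k : ℤ, 1 ≤ k → ∀ F, SideOver n ψ (k + 2) F →
      BijOn χ (Ioo (k : ℝ) (k + 1)) F := by
    intro k hk F hF
    have hk' : (1 : ℝ) ≤ k := by exact_mod_cast hk
    have : BijOn (φ ∘ (fun θ : ℝ => θ + 2)) (Ioo (k : ℝ) (k + 1)) F := by
      rw [bijOn_comp_iff (add_left_injective (2 : ℝ)).injOn, image_add_const_Ioo]
      unfold SideOver at hF
      push_cast at hF
      rwa [add_right_comm (k : ℝ) 1 2]
    exact this.congr fun θ hθ => (hχ2 θ (by linarith [hθ.1])).symm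
  have hχside0 : ∀ F, SideOver n ψ 0 F → BijOn χ (Ioo ((0 : ℤ) : ℝ) ((0 : ℤ) + 1)) F := by
    intro F hF
    refine BijOn.congr hF fun θ hθ => (hχ1 θ ?_).symm
    have := hθ.2
    simp at this
    exact this.le
  set S : Set ℝ := Ioo 0 m ∩ range ((↑) : ℤ → ℝ) with hS
  have hgap : ∀ k : ℤ, 0 ≤ k → k + 2 < n → IsGap S m k (k + 1) := by
    intro k hk0 hkn
    have hk0' : (0 : ℝ) ≤ k := by exact_mod_cast hk0
    have hkn' : (k : ℝ) + 2 + 1 ≤ n := by exact_mod_cast hkn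
    refine ⟨hk0', by linarith, ?_, ?_, ?_⟩
    · rcases hk0'.eq_or_lt with h3 | h3
      · exact Or.inr h3.symm
      · exact Or.inl ⟨⟨h3, by linarith⟩, k, rfl⟩
    · rcases (show (k : ℝ) + 1 ≤ m by linarith).eq_or_lt with h3 | h3
      · exact Or.inr h3
      · exact Or.inl ⟨⟨by linarith, h3⟩, k + 1, by push_cast; rfl⟩
    · rintro _ hθ ⟨-, j, rfl⟩
      have h1 : k < j := by exact_mod_cast hθ.1
      have h2 : j < k + 1 := by exact_mod_cast hθ.2
      omega
  refine hfold.exists_polygonTiling (S := S) (χ := χ) (strictMono_foldedParam hm1)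
    (range_foldedParam hm1) ?_ ?_ inter_subset_left ?_ ?_ ?_ ?_ ?_ ?_ ?_ hcard
  -- On the boundary, `slit` pushes `x` outward by one; `foldedParam` is `foldParam` after this
  -- shift, lowered by `2` on the right half.
  · intro x
    rcases le_or_gt 0 x with hx | hx
    · rw [slit_ofReal_of_nonneg hx, hΨx, foldParam_of_one_le (by linarith), foldedParam, if_pos hx,
        hχ2]
      · congr 1
        have : x + 1 ≠ 0 := by linarith
        rw [hmdef]; field_simp; ring
      · have : 0 ≤ x / (x + 1) := by positivity
        have : 0 ≤ (m - 1) * (x / (x + 1)) := mul_nonneg (by linarith) this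
        linarith
    · rw [slit_ofReal_of_neg hx, hΨx, foldParam_of_le (by linarith), foldedParam, if_neg hx.not_ge,
        hχ1]
      · congr 1
        rw [← neg_div_neg_eq]; congr 1 <;> ring
      · rw [div_le_one (by linarith)]; linarith
  · refine ((Set.finite_Ioo (0 : ℤ) n).image ((↑) : ℤ → ℝ)).subset ?_
    rintro _ ⟨hθ, k, rfl⟩
    have : (k : ℝ) < n := by linarith [hθ.2]
    exact ⟨k, ⟨by exact_mod_cast hθ.1, by exact_mod_cast this⟩, rfl⟩
  · rw [hp]
    refine ⟨h.vertex 0, fun h3 => ?_⟩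
    obtain ⟨q, hq⟩ := hcorner 0 h3
    have : (n : ℤ) ∣ 2 := ⟨-q, by linarith⟩
    have := Int.le_of_dvd (by norm_num) this
    omega
  · rintro _ ⟨hθ, k, rfl⟩
    have hk1 : 0 < k := by exact_mod_cast hθ.1
    have hk2 : (k : ℝ) + 2 < n := by linarith [hθ.2]
    have hk2 : k + 2 < n := by exact_mod_cast hk2
    rw [hχ2 _ (by exact_mod_cast hk1)]
    have h3 := h.vertex (k + 2)
    push_cast at h3
    refine ⟨h3, fun h4 => ?_⟩
    obtain ⟨q, hq⟩ := hcorner (k + 2) (by push_cast; exact h4)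
    have : (n : ℤ) ∣ k := ⟨q, by linarith⟩
    have := Int.le_of_dvd hk1 this
    omega
  · rintro w ⟨hw, hwv⟩
    obtain ⟨k, rfl⟩ := h.vertex_surj w hw
    obtain ⟨j, hj0, hjn, q, rfl⟩ := hrep k
    rw [← h.vertex_periodic k q] at hwv ⊢
    generalize k + q * n = j at *
    have hj : j = 0 ∨ j = 1 ∨ j = 2 ∨ 3 ≤ j := by omega
    have hS1 : ∀ i : ℤ, 1 ≤ i → i + 2 < n → (i : ℝ) ∈ S := by
      intro i hi1 hi2
      have hi2 : (i : ℝ) + 2 < n := by exact_mod_cast hi2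
      exact ⟨⟨by exact_mod_cast hi1, by linarith⟩, i, rfl⟩
    rcases hj with rfl | rfl | rfl | hj
    · left; rw [hp]
    · right
      exact ⟨((1 : ℤ) : ℝ), hS1 1 le_rfl (by omega), by rw [hχ1 _ (by simp)]⟩
    · exact absurd h0 hwv
    · right
      refine ⟨((j - 2 : ℤ) : ℝ), hS1 _ (by omega) (by omega), ?_⟩
      have : (1 : ℝ) ≤ ((j - 2 : ℤ) : ℝ) := by exact_mod_cast (by omega : 1 ≤ j - 2)
      rw [hχ2 _ this]
      push_cast; simp [φ]
  · intro θ hθ hθS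
    have hk : θ ∈ Ioo (⌊θ⌋ : ℝ) (⌊θ⌋ + 1) :=
      ⟨(Int.floor_le θ).lt_of_ne fun h3 => hθS ⟨hθ, _, h3⟩, Int.lt_floor_add_one θ⟩
    have hf0 : 0 ≤ ⌊θ⌋ := Int.floor_nonneg.mpr hθ.1.le
    have hfn : (⌊θ⌋ : ℝ) + 2 < n := by linarith [hk.1, hθ.2]
    generalize ⌊θ⌋ = k at *
    have hfn : k + 2 < n := by exact_mod_cast hfn
    rcases hf0.eq_or_lt with rfl | hf0
    · obtain ⟨F, hF, hk0⟩ := h.edge 0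
      have hk0 : SideOver n ψ 0 F := hk0
      refine ⟨F, ⟨hF, fun hFE => ?_⟩, _, _, hgap 0 le_rfl hfn, hk, hχside0 F hk0⟩
      rw [mem_singleton_iff.mp hFE] at hk0
      have := hsides 0 hk0 le_rfl hnpos
      omega
    · obtain ⟨F, hF, hk0⟩ := h.edge (k + 2)
      have hk0 : SideOver n ψ (k + 2) F := hk0
      refine ⟨F, ⟨hF, fun hFE => ?_⟩, _, _, hgap k hf0.le hfn, hk, hχside k hf0 F hk0⟩
      rw [mem_singleton_iff.mp hFE] at hk0
      have := hsides (k + 2) hk0 (by omega) hfn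
      omega
  · rintro F ⟨hF, hFE⟩
    obtain ⟨k, hk⟩ : ∃ k, SideOver n ψ k F := h.edge_surj F hF
    obtain ⟨j, hj0, hjn, q, rfl⟩ := hrep k
    have hk := h.side_add hk q
    generalize k + q * n = j at *
    have hj : j = 0 ∨ j = 1 ∨ j = 2 ∨ 3 ≤ j := by omega
    rcases hj with rfl | rfl | rfl | hj
    · exact ⟨_, _, by linarith, hgap 0 le_rfl (by omega), hχside0 F hk⟩
    · exact absurd (hk.image_eq.symm.trans h1.image_eq) hFE
    · exact absurd (hk.image_eq.symm.trans h2.image_eq) hFE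
    · exact ⟨_, _, by linarith, hgap (j - 2) (by omega) (by omega),
        hχside (j - 2) (by omega) F (by rwa [sub_add_cancel])⟩
  · exact h.disjoint_edges.subset sdiff_subset
  · rintro F ⟨hF, -⟩
    exact (h.disjoint_vertices F hF).mono_left sdiff_subset

end PolygonTiling

/-! ## Local behaviour of holomorphic maps of the sphere -/

lemma isOpenEmbedding_localParam (x : OnePoint ℂ) : IsOpenEmbedding (localParam x) := by
  induction x using OnePoint.rec with
  | infty =>
    have : localParam OnePoint.infty = sphereInvHomeomorph ∘ ((↑) : ℂ → OnePoint ℂ) := by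
      ext1 t
      change (if t = 0 then OnePoint.infty else ((t⁻¹ : ℂ) : OnePoint ℂ)) = sphereInv t
      by_cases ht : t = 0
      · simp [ht]
      · rw [if_neg ht, sphereInv_coe ht]
    rw [this]
    exact sphereInvHomeomorph.isOpenEmbedding.comp OnePoint.isOpenEmbedding_coe
  | coe a =>
    have : localParam (a : OnePoint ℂ) = ((↑) : ℂ → OnePoint ℂ) ∘ (Homeomorph.addLeft a) := rfl
    rw [this]
    exact OnePoint.isOpenEmbedding_coe.comp (Homeomorph.addLeft a).isOpenEmbedding

@[simp] lemma localParam_zero (x : OnePoint ℂ) : localParam x 0 = x := by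
  induction x using OnePoint.rec with
  | infty => exact if_pos rfl
  | coe a => change ((a + 0 : ℂ) : OnePoint ℂ) = a; rw [add_zero]

lemma localParam_localCoord {y w : OnePoint ℂ} (hw : w ∈ range (localParam y)) :
    localParam y (localCoord y w) = w := by
  obtain ⟨t, rfl⟩ := hw
  congr 1
  induction y using OnePoint.rec with
  | infty =>
    change (localParam OnePoint.infty t).elim 0 (fun c => c⁻¹) = t
    have : localParam OnePoint.infty t =
      if t = 0 then OnePoint.infty else ((t⁻¹ : ℂ) : OnePoint ℂ) := rfl
    rw [this]
    split_ifs with ht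
    · exact ht.symm
    · exact inv_inv t
  | coe b =>
    change b + t - b = t
    ring

lemma eventually_eq_localParam {f : OnePoint ℂ → OnePoint ℂ} (hf : Continuous f) (x : OnePoint ℂ) :
    ∀ᶠ t in 𝓝 (0 : ℂ), f (localParam x t) =
      localParam (f x) (localCoord (f x) (f (localParam x t))) := by
  have h1 : ContinuousAt (fun t => f (localParam x t)) 0 :=
    (hf.comp (isOpenEmbedding_localParam x).continuous).continuousAt
  have h2 : range (localParam (f x)) ∈ 𝓝 (f (localParam x 0)) := by
    rw [localParam_zero]
    exact (isOpenEmbedding_localParam (f x)).isOpen_range.mem_nhds ⟨0, localParam_zero _⟩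
  filter_upwards [h1 h2] with t ht
  exact (localParam_localCoord ht).symm

lemma localCoord_self (y : OnePoint ℂ) : localCoord y y = 0 := by
  apply (isOpenEmbedding_localParam y).injective
  rw [localParam_localCoord ⟨0, localParam_zero y⟩, localParam_zero]

lemma exists_localForm {f : OnePoint ℂ → OnePoint ℂ} {x : OnePoint ℂ} {n : ℕ} (hn : n ≠ 0)
    (h : localDegree f x = n) : ∃ g : ℂ → ℂ, AnalyticAt ℂ g 0 ∧ g 0 ≠ 0 ∧
      ∀ᶠ t in 𝓝 (0 : ℂ), localCoord (f x) (f (localParam x t)) = t ^ n * g t := by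
  have ha : AnalyticAt ℂ (fun t : ℂ => localCoord (f x) (f (localParam x t))) 0 := by
    -- A function that is not analytic has order `0` by convention, so a nonzero order includes
    -- analyticity.
    by_contra hna
    rw [localDegree, analyticOrderAt_of_not_analyticAt hna] at h
    exact hn (by exact_mod_cast h.symm)
  obtain ⟨g, hg, hg0, he⟩ := (ha.analyticOrderAt_eq_natCast).mp h
  exact ⟨g, hg, hg0, by simpa using he⟩

/-- In local coordinates `f` is `t * g t` with `g 0 ≠ 0`, and the inverse function theorem applies.
-/
lemma exists_openPartialHomeomorph_of_localDegree_eq_one {f : OnePoint ℂ → OnePoint ℂ}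
    (hf : Continuous f) {x : OnePoint ℂ} (h : localDegree f x = 1) :
    ∃ e : OpenPartialHomeomorph (OnePoint ℂ) (OnePoint ℂ), x ∈ e.source ∧ EqOn f e e.source := by
  obtain ⟨g, hg, hg0, he⟩ := exists_localForm (n := 1) one_ne_zero (by exact_mod_cast h)
  have hd : HasStrictDerivAt (fun t => t ^ 1 * g t) (g 0) 0 := by
    have h1 := (hasStrictDerivAt_id (0 : ℂ)).mul hg.hasStrictDerivAt
    have h2 : (fun t => t ^ 1 * g t) = id * g := by ext t; simp
    rw [h2]
    simpa using h1
  let G := (hd.hasStrictFDerivAt_equiv hg0).toOpenPartialHomeomorph _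
  have hG0 : (0 : ℂ) ∈ G.source := HasStrictFDerivAt.mem_toOpenPartialHomeomorph_source _
  have hGe : ∀ t, G t = t ^ 1 * g t := fun t => rfl
  let A := (isOpenEmbedding_localParam x).toOpenPartialHomeomorph
  let B := (isOpenEmbedding_localParam (f x)).toOpenPartialHomeomorph
  have hA : ∀ t, A t = localParam x t := fun t => rfl
  have hB : ∀ t, B t = localParam (f x) t := fun t => rfl
  have hAs : A.source = univ := rfl
  have hx : A.symm x = 0 := by
    have := A.left_inv (x := 0) (by rw [hAs]; trivial)
    rwa [hA, localParam_zero] at this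
  have hxA : x ∈ A.target := by
    have := A.map_source (x := 0) (by rw [hAs]; trivial)
    rwa [hA, localParam_zero] at this
  obtain ⟨O, hO, hOo, hO0⟩ := _root_.mem_nhds_iff.mp (he.and (eventually_eq_localParam hf x))
  let e := ((A.symm.trans G).trans B).restrOpen (A '' O)
    ((isOpenEmbedding_localParam x).isOpenMap _ hOo)
  refine ⟨e, ?_, ?_⟩
  · refine ⟨⟨⟨hxA, ?_⟩, ?_⟩, ⟨0, hO0, localParam_zero x⟩⟩
    · change A.symm x ∈ G.source
      rw [hx]; exact hG0
    · exact mem_univ _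
  · rintro z ⟨⟨⟨hz, -⟩, -⟩, t, ht, rfl⟩
    have h1 : A.symm (A t) = t := A.left_inv (by rw [hAs]; trivial)
    change f (A t) = B (G (A.symm (A t)))
    rw [h1, hGe, hB, hA, ← (hO ht).1]
    exact (hO ht).2

lemma eventually_ne_of_localDegree {f : OnePoint ℂ → OnePoint ℂ} (hf : Continuous f)
    {x : OnePoint ℂ} {n : ℕ} (hn : n ≠ 0) (h : localDegree f x = n) :
    ∀ᶠ a in 𝓝[≠] x, f a ≠ f x := by
  obtain ⟨g, hg, hg0, he⟩ := exists_localForm hn h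
  have hgne : ∀ᶠ t in 𝓝 (0 : ℂ), g t ≠ 0 := hg.continuousAt.eventually_ne hg0
  obtain ⟨O, hO, hOo, hO0⟩ := _root_.mem_nhds_iff.mp
    (hgne.and (he.and (eventually_eq_localParam hf x)))
  have hN : localParam x '' O ∈ 𝓝 x :=
    ((isOpenEmbedding_localParam x).isOpenMap _ hOo).mem_nhds ⟨0, hO0, localParam_zero x⟩
  rw [eventually_nhdsWithin_iff]
  filter_upwards [hN]
  rintro _ ⟨t, ht, rfl⟩ hne hfx
  obtain ⟨h1, h2, h3⟩ := hO ht
  have ht0 : t ≠ 0 := by rintro rfl; exact hne (localParam_zero x)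
  rw [hfx, localCoord_self] at h2
  exact mul_ne_zero (pow_ne_zero n ht0) h1 h2.symm

/-- With `s` an analytic square root of `g`, the local form `t ^ 2 * g t` is the square of `t * s
t`, which maps neighbourhoods of `0` onto neighbourhoods of `0`. The two square roots of a small
nonzero value yield the two preimages. -/
lemma eventually_two_preimages {f : OnePoint ℂ → OnePoint ℂ} (hf : Continuous f)
    {x : OnePoint ℂ} (h : localDegree f x = 2) {N : Set (OnePoint ℂ)} (hN : N ∈ 𝓝 x) :
    ∀ᶠ y in 𝓝[≠] (f x), ∃ a ∈ N, ∃ b ∈ N, a ≠ b ∧ f a = y ∧ f b = y := by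
  obtain ⟨g, hg, hg0, he⟩ := exists_localForm (n := 2) two_ne_zero (by exact_mod_cast h)
  obtain ⟨c, hc⟩ := IsAlgClosed.exists_pow_nat_eq (g 0) two_pos
  have hc0 : c ≠ 0 := by rintro rfl; simp at hc; exact hg0 hc.symm
  -- The quotient `g t / g 0` is near `1`, where the principal logarithm is analytic; `c` is a
  -- square root of `g 0`.
  let s : ℂ → ℂ := fun t => c * Complex.exp (Complex.log (g t / g 0) / 2)
  have hs : AnalyticAt ℂ s 0 := by
    have h1 : AnalyticAt ℂ (fun t => g t / g 0) 0 := hg.div analyticAt_const hg0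
    have h2 : g 0 / g 0 ∈ Complex.slitPlane := by rw [div_self hg0]; simp
    exact analyticAt_const.mul ((h1.clog h2).div analyticAt_const two_ne_zero).cexp
  have hs0 : s 0 = c := by simp [s, div_self hg0]
  have hs2 : ∀ t, g t ≠ 0 → s t ^ 2 = g t := by
    intro t ht
    simp only [s]
    rw [mul_pow, ← Complex.exp_nat_mul, hc]
    push_cast
    rw [mul_div_cancel₀ _ (two_ne_zero' ℂ), Complex.exp_log (div_ne_zero ht hg0)]
    field_simp
  have hd : HasStrictDerivAt (fun t => t * s t) c 0 := by
    have h1 := (hasStrictDerivAt_id (0 : ℂ)).mul hs.hasStrictDerivAt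
    have h2 : (fun t => t * s t) = id * s := by ext t; simp
    rw [h2]
    simpa [hs0] using h1
  have hmap : map (fun t => t * s t) (𝓝 0) = 𝓝 0 := by
    have := hd.map_nhds_eq hc0
    simpa using this
  have hgne : ∀ᶠ t in 𝓝 (0 : ℂ), g t ≠ 0 := hg.continuousAt.eventually_ne hg0
  have hNt : ∀ᶠ t in 𝓝 (0 : ℂ), localParam x t ∈ N := by
    have := (isOpenEmbedding_localParam x).continuous.continuousAt (x := (0 : ℂ))
    rw [ContinuousAt, localParam_zero] at this
    exact this hN
  have hall := hgne.and (hNt.and (he.and (eventually_eq_localParam hf x)))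
  have himg : (fun t => t * s t) '' {t | g t ≠ 0 ∧ localParam x t ∈ N ∧
      localCoord (f x) (f (localParam x t)) = t ^ 2 * g t ∧ f (localParam x t) =
      localParam (f x) (localCoord (f x) (f (localParam x t)))} ∈ 𝓝 (0 : ℂ) := by
    rw [← hmap]
    exact image_mem_map hall
  obtain ⟨r, hr, hrs⟩ := Metric.mem_nhds_iff.mp himg
  have hM : localParam (f x) '' ball 0 (r ^ 2) ∈ 𝓝 (f x) :=
    ((isOpenEmbedding_localParam (f x)).isOpenMap _ isOpen_ball).mem_nhds
      ⟨0, mem_ball_self (by positivity), localParam_zero _⟩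
  rw [eventually_nhdsWithin_iff]
  filter_upwards [hM]
  rintro _ ⟨y, hy, rfl⟩ hne
  have hy0 : y ≠ 0 := by rintro rfl; exact hne (localParam_zero _)
  obtain ⟨w, hw⟩ := IsAlgClosed.exists_pow_nat_eq y two_pos
  have hw := hw.symm
  have hw0 : w ≠ 0 := by rintro rfl; simp at hw; exact hy0 hw
  have hwr : ‖w‖ < r := by
    rw [mem_ball_zero_iff, hw, norm_pow] at hy
    exact lt_of_pow_lt_pow_left₀ 2 hr.le hy
  have key : ∀ u : ℂ, ‖u‖ < r → u ^ 2 = y → ∃ t, t * s t = u ∧ localParam x t ∈ N ∧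
      f (localParam x t) = localParam (f x) y := by
    intro u hu huy
    obtain ⟨t, ⟨h1, h2, h3, h4⟩, rfl⟩ := hrs (mem_ball_zero_iff.mpr hu)
    refine ⟨t, rfl, h2, ?_⟩
    rw [h4, h3, ← huy, mul_pow, hs2 t h1]
  obtain ⟨t, ht, htN, hty⟩ := key w hwr hw.symm
  obtain ⟨t', ht', htN', hty'⟩ := key (-w) (by rwa [norm_neg]) (by rw [neg_sq, hw])
  refine ⟨_, htN, _, htN', ?_, hty, hty'⟩
  intro heq
  have := (isOpenEmbedding_localParam x).injective heq
  subst this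
  rw [ht] at ht'
  exact hw0 (self_eq_neg.mp ht')

/-! ### Fibers and covering property of a Lattès map -/

namespace IsLattesMap

variable {f : OnePoint ℂ → OnePoint ℂ}

lemma continuous (hf : IsLattesMap f) : Continuous f := hf.isRationalMap.1

lemma localDegree_eq (hf : IsLattesMap f) (x : OnePoint ℂ) :
    localDegree f x = (1 : ℕ) ∨ localDegree f x = (2 : ℕ) := by
  by_cases h : localDegree f x = 1
  · left; exact_mod_cast h
  · right; exact_mod_cast hf.localDegree_eq_two x h

lemma isLocalHomeomorphOn (hf : IsLattesMap f) :
    IsLocalHomeomorphOn f {x | ¬ IsCriticalPoint f x} := by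
  refine IsLocalHomeomorphOn.mk f _ fun x hx => ?_
  exact exists_openPartialHomeomorph_of_localDegree_eq_one hf.continuous (not_not.mp hx)

lemma eventually_ne (hf : IsLattesMap f) (x : OnePoint ℂ) : ∀ᶠ a in 𝓝[≠] x, f a ≠ f x := by
  rcases hf.localDegree_eq x with h | h
  · exact eventually_ne_of_localDegree hf.continuous one_ne_zero h
  · exact eventually_ne_of_localDegree hf.continuous two_ne_zero h

/-- A fiber is compact, and it is discrete because `f` takes the value `f x` at no other point near
`x`. -/
lemma finite_fiber (hf : IsLattesMap f) (y : OnePoint ℂ) : (f ⁻¹' {y}).Finite := by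
  have hc : IsCompact (f ⁻¹' {y}) := (isClosed_singleton.preimage hf.continuous).isCompact
  refine hc.finite ?_
  rw [isDiscrete_iff_forall_mem_exists_isOpen]
  intro x hx
  obtain ⟨O, hO, hOo, hxO⟩ := _root_.mem_nhds_iff.mp
    (eventually_nhdsWithin_iff.mp (hf.eventually_ne x))
  refine ⟨O, hOo, ?_⟩
  ext a
  constructor
  · rintro ⟨haO, hay⟩
    by_contra hax
    exact hO haO hax (hay.trans hx.symm)
  · rintro rfl; exact ⟨hxO, hx⟩

lemma mapsTo_postcriticalSet : MapsTo f (postcriticalSet f) (postcriticalSet f) := by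
  rintro _ ⟨c, hc, n, hn, rfl⟩
  exact ⟨c, hc, n + 1, by omega, Function.iterate_succ_apply' f n c⟩

lemma apply_mem_postcriticalSet {c : OnePoint ℂ} (hc : IsCriticalPoint f c) :
    f c ∈ postcriticalSet f := ⟨c, hc, 1, le_rfl, rfl⟩

/-- Critical values are postcritical, so no critical point lies over the complement; there `f` is a
local homeomorphism with compact source. -/
lemma isCoveringMapOn (hf : IsLattesMap f) : IsCoveringMapOn f (postcriticalSet f)ᶜ :=
  IsCoveringMapOn.of_isLocalHomeomorphOn hf.continuous
    (hf.isLocalHomeomorphOn.mono fun _ hx hc => hx (apply_mem_postcriticalSet hc))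

end IsLattesMap

/-! ## Finite subdivision rules whose subdivision map is a Lattès map -/

section

variable {X : Type*} [TopologicalSpace X]

/-- The underlying set of the 1-skeleton with vertices `V` and edges `𝓔`. -/
def skeletonSet (V : Set X) (𝓔 : Set (Set X)) : Set X := V ∪ ⋃₀ 𝓔

lemma mem_skeletonSet_iff (K : Topology.CWComplex (univ : Set X)) {n : ℕ} {c : Cell K n} {x : X}
    (hx : x ∈ openCell K n c) : x ∈ skeletonSet (vertexSet K) (edgeSets K) ↔ n ≤ 1 := by
  constructor
  · rintro (⟨v, rfl⟩ | ⟨_, ⟨e, rfl⟩, he⟩)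
    · have : vertexPoint K v ∈ openCell K 0 v := by rw [openCell_zero]; rfl
      rw [dim_eq_of_mem_openCell K hx this]; omega
    · rw [dim_eq_of_mem_openCell K hx he]
  · intro hn
    rcases Nat.le_one_iff_eq_zero_or_eq_one.mp hn with rfl | rfl
    · rw [openCell_zero] at hx
      exact Or.inl ⟨c, hx.symm⟩
    · exact Or.inr ⟨_, ⟨c, rfl⟩, hx⟩

lemma exists_ne_mem_openCell (K : Topology.CWComplex (univ : Set X)) {n : ℕ} (hn : n ≠ 0)
    {c : Cell K n} {x : X} (hx : x ∈ openCell K n c) {N : Set X} (hN : N ∈ 𝓝 x) :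
    ∃ y ∈ openCell K n c, y ∈ N ∧ y ≠ x := by
  let := K
  let g := RelCWComplex.map (C := (univ : Set X)) n c
  obtain ⟨t, ht, htx⟩ : ∃ t ∈ ball (0 : Fin n → ℝ) 1, g t = x := hx
  have hcont : ContinuousAt g t :=
    ((RelCWComplex.continuousOn (C := (univ : Set X)) n c).mono ball_subset_closedBall).continuousAt
      (isOpen_ball.mem_nhds ht)
  have hev : ∀ᶠ s in 𝓝 t, s ∈ ball (0 : Fin n → ℝ) 1 ∧ g s ∈ N :=
    (isOpen_ball.eventually_mem ht).and (hcont (htx ▸ hN))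
  have : Nonempty (Fin n) := ⟨⟨0, Nat.pos_of_ne_zero hn⟩⟩
  have : (𝓝[≠] t).NeBot := Module.punctured_nhds_neBot ℝ (Fin n → ℝ) t
  obtain ⟨s, ⟨hs, hsN⟩, hst⟩ := ((hev.filter_mono nhdsWithin_le_nhds).and
    (self_mem_nhdsWithin (s := {t}ᶜ))).exists
  refine ⟨g s, ⟨s, hs, rfl⟩, hsN, fun h => hst ?_⟩
  have hinj : InjOn g (ball 0 1) := by
    have := (RelCWComplex.map (C := (univ : Set X)) n c).injOn
    rwa [RelCWComplex.source_eq] at this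
  exact hinj hs ht (h.trans htx.symm)

end

namespace FiniteSubdivisionRule

section General

variable {X : Type*} [TopologicalSpace X] (R : FiniteSubdivisionRule X)

lemma dim_eq {n m : ℕ} {c : Cell R.subdivision n} {d : Cell R.complex m} {x : X}
    (hx : x ∈ openCell R.subdivision n c) (hfx : R.map x ∈ openCell R.complex m d) : m = n := by
  obtain ⟨d', hd', hd''⟩ := R.map_openCell n c
  exact dim_eq_of_mem_openCell R.complex hfx (hd'' ▸ mem_image_of_mem _ hx)

lemma injOn_openCell {n : ℕ} (c : Cell R.subdivision n) : InjOn R.map (openCell R.subdivision n c) := by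
  obtain ⟨d', hd', -⟩ := R.map_openCell n c
  exact injOn_iff_injective.mpr hd'.injective

/-- A subdivision cell of positive dimension through a vertex would be contained in that vertex, but
such a cell has more than one point. -/
lemma exists_subdivision_vertex {x : X} (hx : x ∈ vertexSet R.complex) :
    ∃ c : Cell R.subdivision 0, x ∈ openCell R.subdivision 0 c := by
  obtain ⟨v, rfl⟩ := hx
  obtain ⟨n, c, hc⟩ := exists_mem_openCell R.subdivision (vertexPoint R.complex v)
  obtain rfl | hn := eq_or_ne n 0
  · exact ⟨c, hc⟩
  exfalso
  obtain ⟨m, d, hd⟩ := R.subdivision_refines n c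
  have h1 : vertexPoint R.complex v ∈ openCell R.complex 0 v := by rw [openCell_zero]; rfl
  obtain rfl := dim_eq_of_mem_openCell R.complex h1 (hd hc)
  obtain ⟨y, hy, -, hne⟩ := exists_ne_mem_openCell R.subdivision hn hc univ_mem
  have h2 := hd hy
  have h3 := hd hc
  rw [openCell_zero] at h2 h3
  exact hne (h2.trans h3.symm)

lemma map_mem_vertexSet_of_mem {c : Cell R.subdivision 0} {x : X}
    (hx : x ∈ openCell R.subdivision 0 c) : R.map x ∈ vertexSet R.complex := by
  obtain ⟨d, -, hd⟩ := R.map_openCell 0 c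
  have : R.map x ∈ openCell R.complex 0 d := hd ▸ mem_image_of_mem _ hx
  rw [openCell_zero] at this
  exact ⟨d, this.symm⟩

lemma mapsTo_vertexSet : MapsTo R.map (vertexSet R.complex) (vertexSet R.complex) := by
  intro x hx
  obtain ⟨c, hc⟩ := R.exists_subdivision_vertex hx
  exact R.map_mem_vertexSet_of_mem hc

/-- A point of the skeleton mapped into a 2-cell would lie in a 2-cell `c` of the subdivision. Being
contained in one cell, `c` would lie inside the skeleton; but 2-cells of the subdivision are
relatively isolated, and purity puts points of the open tile in every neighbourhood. -/
lemma mapsTo_skeletonSet [T2Space X] : MapsTo R.map (skeletonSet (vertexSet R.complex) (edgeSets R.complex))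
    (skeletonSet (vertexSet R.complex) (edgeSets R.complex)) := by
  intro x hx
  obtain ⟨n, hn, c, hc⟩ := exists_mem_openCell_le R.subdivision R.subdivision_finite x
  obtain ⟨m, d, hd⟩ := exists_mem_openCell R.complex (R.map x)
  rw [mem_skeletonSet_iff R.complex hd]
  by_contra hm
  obtain rfl := R.dim_eq hc hd
  obtain rfl : m = 2 := by omega
  obtain ⟨O, hO, hcO, hOu⟩ := exists_isOpen_openCell R.subdivision R.subdivision_finite c
  obtain ⟨l, d', hd'⟩ := R.subdivision_refines 2 c
  have hl := (mem_skeletonSet_iff R.complex (hd' hc)).mp hx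
  obtain ⟨t, ht⟩ := mem_iUnion.mp (R.complex_pure.symm.subset (mem_univ x))
  have hcl : closedCell R.complex 2 t = closure (openCell R.complex 2 t) := by
    let := R.complex
    exact RelCWComplex.closure_openCell_eq_closedCell.symm
  rw [hcl] at ht
  obtain ⟨y, hyO, hyt⟩ := mem_closure_iff.mp ht O hO (hcO hc)
  obtain ⟨k, hk, e, he⟩ := exists_mem_openCell_le R.subdivision R.subdivision_finite y
  have hyc : y ∈ openCell R.subdivision 2 c := by
    have := hOu k e hk y hyO he
    cases this
    exact he
  have := dim_eq_of_mem_openCell R.complex hyt (hd' hyc)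
  omega

end General

variable (R : FiniteSubdivisionRule (OnePoint ℂ))

/-- Suppose a cell `c` of positive dimension contains the critical point. A nearby point of `c` has
a value with two preimages close to the critical point. Since `f` preserves the dimension of cells,
and no other cell of that dimension is near, both preimages lie in `c`, where `f` is injective. -/
lemma exists_subdivision_vertex_of_isCriticalPoint (hf : IsLattesMap R.map) {x : OnePoint ℂ}
    (hx : IsCriticalPoint R.map x) :
    ∃ c : Cell R.subdivision 0, x ∈ openCell R.subdivision 0 c := by
  obtain ⟨n, c, hc⟩ := exists_mem_openCell R.subdivision x
  obtain rfl | hn := eq_or_ne n 0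
  · exact ⟨c, hc⟩
  exfalso
  obtain ⟨O, hO, hcO, hOu⟩ := exists_isOpen_openCell R.subdivision R.subdivision_finite c
  have h2 := eventually_two_preimages hf.continuous (hf.localDegree_eq_two x hx)
    (hO.mem_nhds (hcO hc))
  rw [eventually_nhdsWithin_iff] at h2
  obtain ⟨y, hyc, hyN, hyx⟩ := exists_ne_mem_openCell R.subdivision hn hc
    (hf.continuous.continuousAt (x := x) h2)
  obtain ⟨a, ha, b, hb, hab, hay, hby⟩ := hyN fun h => hyx (R.injOn_openCell c hyc hc h)
  obtain ⟨d, -, hd⟩ := R.map_openCell n c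
  have hyd : R.map y ∈ openCell R.complex n d := hd ▸ mem_image_of_mem _ hyc
  have key : ∀ a ∈ O, R.map a = R.map y → a ∈ openCell R.subdivision n c := by
    intro a ha hay
    obtain ⟨k, e, he⟩ := exists_mem_openCell R.subdivision a
    obtain rfl := R.dim_eq he (hay ▸ hyd)
    have := hOu _ e le_rfl a ha he
    cases this
    exact he
  exact hab (R.injOn_openCell c (key a ha hay) (key b hb hby) (hay.trans hby.symm))

lemma postcriticalSet_subset_vertexSet (hf : IsLattesMap R.map) :
    postcriticalSet R.map ⊆ vertexSet R.complex := by
  rintro _ ⟨c, hc, n, hn, rfl⟩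
  induction n, hn using Nat.le_induction with
  | base =>
    obtain ⟨v, hv⟩ := R.exists_subdivision_vertex_of_isCriticalPoint hf hc
    exact R.map_mem_vertexSet_of_mem hv
  | succ n hn ih =>
    rw [Function.iterate_succ_apply']
    exact R.mapsTo_vertexSet ih

lemma isOneTile (h : R.HasOneTileType) : IsOneTile R.complex :=
  ⟨R.complex_finite, R.complex_pure, R.hasTileType, h⟩

end FiniteSubdivisionRule

/-! ## Trees with four marked vertices -/

section Injective

variable {V : Type*}

lemma injective_vec_four {p q r t : V} (h : [p, q, r, t].Nodup) :
    Function.Injective ![p, q, r, t] := by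
  exact List.nodup_ofFn.mp (by simpa [List.ofFn_succ] using h)

lemma injective_vec_five {p q r t c : V} (h : [p, q, r, t, c].Nodup) :
    Function.Injective ![p, q, r, t, c] := by
  exact List.nodup_ofFn.mp (by simpa [List.ofFn_succ] using h)

lemma injective_vec_six {p q r t c d : V} (h : [p, q, r, t, c, d].Nodup) :
    Function.Injective ![p, q, r, t, c, d] := by
  exact List.nodup_ofFn.mp (by simpa [List.ofFn_succ] using h)

end Injective

section Trees

variable {V : Type*} [Fintype V] [DecidableEq V] {G : SimpleGraph V} [DecidableRel G.Adj]

/-- `G` is isomorphic to the graph with vertex set `{0, …, m - 1}` and edge set `E`, in such a way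
that the members of `M` correspond to `0, 1, 2, 3`. -/
def GraphForm (G : SimpleGraph V) (M : Finset V) (m : ℕ) (E : Finset (Sym2 (Fin m))) : Prop :=
  ∃ α : V ≃ Fin m, (∀ x y, G.Adj x y ↔ s(α x, α y) ∈ E) ∧ ∀ v, v ∈ M ↔ (α v : ℕ) < 4

/-- A tree has one edge fewer than it has vertices, so as soon as the edges of the model are present
there is no room for others. -/
lemma graphForm_of_injective (hT : G.IsTree) {M : Finset V} {m : ℕ} {E : Finset (Sym2 (Fin m))}
    (x : Fin m → V) (hx : Function.Injective x) (hcard : Fintype.card V = m)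
    (hE : ∀ i j, s(i, j) ∈ E → G.Adj (x i) (x j)) (hEc : E.card + 1 = m)
    (hM : ∀ i, x i ∈ M ↔ (i : ℕ) < 4) : GraphForm G M m E := by
  let e : Fin m ≃ V := Equiv.ofBijective x
    ((Fintype.bijective_iff_injective_and_card x).mpr ⟨hx, by simp [hcard]⟩)
  have he : ∀ i, e i = x i := fun i => rfl
  have hsub : E.image (Sym2.map x) ⊆ G.edgeFinset := by
    intro p hp
    obtain ⟨q, hq, rfl⟩ := Finset.mem_image.mp hp
    induction q with
    | _ i j => simpa using hE i j hq
  have heq : E.image (Sym2.map x) = G.edgeFinset := by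
    refine Finset.eq_of_subset_of_card_le hsub ?_
    rw [Finset.card_image_of_injective _ (Sym2.map.injective hx)]
    have := hT.card_edgeFinset
    omega
  refine ⟨e.symm, fun u v => ?_, fun v => ?_⟩
  · obtain ⟨i, rfl⟩ := e.surjective u
    obtain ⟨j, rfl⟩ := e.surjective v
    rw [← SimpleGraph.mem_edgeSet, ← SimpleGraph.mem_edgeFinset, ← heq, e.symm_apply_apply,
      e.symm_apply_apply, Finset.mem_image]
    constructor
    · rintro ⟨q, hq, hqe⟩
      have : q = s(i, j) := Sym2.map.injective hx (by rw [hqe]; rfl)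
      rwa [← this]
    · intro h; exact ⟨_, h, rfl⟩
  · obtain ⟨i, rfl⟩ := e.surjective v
    rw [e.symm_apply_apply, he, hM]

/-- A tree with four marked vertices in which the unmarked vertices have degree at least three is
one of five trees. -/
theorem graphForm_of_isTree (hT : G.IsTree)
    (hcut : ∀ x y, G.Adj x y → ∃ s : Set V, ¬ (x ∈ s ↔ y ∈ s) ∧
      ∀ z w, G.Adj z w → s(z, w) ≠ s(x, y) → (z ∈ s ↔ w ∈ s))
    {M : Finset V} (hM : M.card = 4) (hdeg : ∀ v ∉ M, 3 ≤ G.degree v) :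
    GraphForm G M 4 {s(0, 1), s(1, 2), s(2, 3)} ∨
    GraphForm G M 4 {s(0, 1), s(0, 2), s(0, 3)} ∨
    GraphForm G M 5 {s(4, 0), s(4, 1), s(4, 2), s(4, 3)} ∨
    GraphForm G M 5 {s(4, 0), s(4, 1), s(4, 2), s(2, 3)} ∨
    GraphForm G M 6 {s(4, 0), s(4, 1), s(4, 5), s(5, 2), s(5, 3)} := by
  have hMle : M.card ≤ Fintype.card V := Finset.card_le_univ M
  have : Nontrivial V := Fintype.one_lt_card_iff_nontrivial.mp (by omega)
  have hpos : ∀ v, 0 < G.degree v := fun v =>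
    hT.connected.preconnected.degree_pos_of_nontrivial v
  have hnbr : ∀ v, ∃ w, G.Adj v w := fun v => by
    obtain ⟨w, hw⟩ := Finset.card_pos.mp (hpos v)
    exact ⟨w, by simpa using hw⟩
  have hsum := G.sum_degrees_eq_twice_card_edges
  have hedges := hT.card_edgeFinset
  have hsplit : ∑ v, G.degree v = ∑ v ∈ M, G.degree v + ∑ v ∈ Mᶜ, G.degree v :=
    (Finset.sum_add_sum_compl M _).symm
  have h1 : M.card * 1 ≤ ∑ v ∈ M, G.degree v := by
    rw [← smul_eq_mul]; exact Finset.card_nsmul_le_sum _ _ _ fun v _ => hpos v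
  have h2 : Mᶜ.card * 3 ≤ ∑ v ∈ Mᶜ, G.degree v := by
    rw [← smul_eq_mul]
    exact Finset.card_nsmul_le_sum _ _ _ fun v hv => hdeg v (Finset.mem_compl.mp hv)
  have hMc := Finset.card_compl M
  have h4 : 4 ≤ Fintype.card V := hM ▸ hMle
  -- The degree sum is `2 (m - 1)` for `m` vertices and at least `4 + 3 (m - 4)`.
  have h6 : Fintype.card V ≤ 6 := by omega
  have hne : ∀ {x y}, G.Adj x y → x ≠ y := fun h => h.ne
  have hfresh : ∀ s : Finset V, s.card < Fintype.card V → ∃ d, d ∉ s := fun s hs => by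
    by_contra hall
    push Not at hall
    rw [Finset.eq_univ_iff_forall.mpr hall, Finset.card_univ] at hs
    exact lt_irrefl _ hs
  interval_cases hc : Fintype.card V
  · -- four vertices
    have hMu : ∀ v, v ∈ M := by
      rw [← Finset.eq_univ_iff_forall]
      exact Finset.eq_univ_of_card _ (by rw [hM, hc])
    -- The degree sum is `6`, too much for four vertices of degree one.
    obtain ⟨a, ha⟩ : ∃ a, 1 < G.degree a := by
      by_contra hall
      push Not at hall
      have := Finset.sum_le_card_nsmul Finset.univ (fun v => G.degree v) 1 fun v _ => hall v
      rw [Finset.card_univ, hc] at this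
      simp only [smul_eq_mul] at this
      omega
    obtain ⟨b, c, hb, hc', hbc⟩ := Finset.one_lt_card_iff.mp ha
    rw [SimpleGraph.mem_neighborFinset] at hb hc'
    obtain ⟨d, hd⟩ := hfresh {a, b, c} (by have := Finset.card_le_three (a := a) (b := b) (c := c); omega)
    simp only [Finset.mem_insert, Finset.mem_singleton, not_or] at hd
    obtain ⟨w, hw⟩ := hnbr d
    have hab := hne hb
    have hac := hne hc'
    have hw4 : w = a ∨ w = b ∨ w = c := by
      by_contra hall
      push Not at hall
      have h5 : ({a, b, c, d, w} : Finset V).card ≤ Fintype.card V := Finset.card_le_univ _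
      have hdw := hne hw
      rw [Finset.card_insert_of_notMem, Finset.card_insert_of_notMem, Finset.card_insert_of_notMem,
        Finset.card_insert_of_notMem, Finset.card_singleton] at h5
      · omega
      all_goals grind
    have hbuild : ∀ p q r t : V, p ≠ q → p ≠ r → p ≠ t → q ≠ r → q ≠ t → r ≠ t →
        Function.Injective ![p, q, r, t] := by
      intro p q r t _ _ _ _ _ _
      exact injective_vec_four (by simp [*])
    have hpath : ∀ p q r t : V, p ≠ q → p ≠ r → p ≠ t → q ≠ r → q ≠ t → r ≠ t →
        G.Adj p q → G.Adj q r → G.Adj r t → GraphForm G M 4 {s(0, 1), s(1, 2), s(2, 3)} := by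
      intro p q r t n1 n2 n3 n4 n5 n6 a1 a2 a3
      refine graphForm_of_injective hT ![p, q, r, t] (hbuild p q r t n1 n2 n3 n4 n5 n6) hc ?_
        (by decide) (fun i => by simp [hMu])
      intro i j hij
      fin_cases i <;> fin_cases j <;> first
        | (exfalso; revert hij; decide)
        | (simp [a1, a2, a3, a1.symm, a2.symm, a3.symm])
    rcases hw4 with rfl | rfl | rfl
    · right; left
      refine graphForm_of_injective hT ![w, b, c, d] (hbuild _ _ _ _ hab hac (hne hw).symm hbc
        (Ne.symm hd.2.1) (Ne.symm hd.2.2)) hc ?_ (by decide) (fun i => by simp [hMu])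
      intro i j hij
      have a1 := hb.symm
      have a2 := hc'.symm
      have a3 := hw.symm
      fin_cases i <;> fin_cases j <;> first
        | (exfalso; revert hij; decide)
        | (simp [*])
    · left
      exact hpath d w a c (hne hw) hd.1 hd.2.2 hab.symm hbc hac hw hb.symm hc'
    · left
      exact hpath d w a b (hne hw) hd.1 hd.2.1 hac.symm hbc.symm hab hw hc'.symm hb
  · -- five vertices
    obtain ⟨c, hcM⟩ := Finset.card_pos.mp (show 0 < Mᶜ.card by omega)
    have hMv : ∀ v, v ∈ M ↔ v ≠ c := by
      intro v
      have h1 : Mᶜ = {c} := by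
        obtain ⟨c', hc'⟩ := Finset.card_eq_one.mp (show Mᶜ.card = 1 by omega)
        rw [hc'] at hcM ⊢
        rw [Finset.mem_singleton.mp hcM]
      have := Finset.mem_compl (s := M) (a := v)
      rw [h1, Finset.mem_singleton] at this
      tauto
    rw [Finset.mem_compl] at hcM
    obtain ⟨b₁, b₂, b₃, hb₁, hb₂, hb₃, h12, h13, h23⟩ := Finset.two_lt_card_iff.mp (hdeg c hcM)
    rw [SimpleGraph.mem_neighborFinset] at hb₁ hb₂ hb₃
    obtain ⟨d, hd⟩ := hfresh {c, b₁, b₂, b₃} (by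
      have := Finset.card_le_four (a := c) (b := b₁) (c := b₂) (d := b₃); omega)
    simp only [Finset.mem_insert, Finset.mem_singleton, not_or] at hd
    obtain ⟨w, hw⟩ := hnbr d
    have n1 := hne hb₁
    have n2 := hne hb₂
    have n3 := hne hb₃
    have hw5 : w = c ∨ w = b₁ ∨ w = b₂ ∨ w = b₃ := by
      by_contra hall
      push Not at hall
      have h5 : ({c, b₁, b₂, b₃, d, w} : Finset V).card ≤ Fintype.card V := Finset.card_le_univ _
      have hdw := hne hw
      rw [Finset.card_insert_of_notMem, Finset.card_insert_of_notMem, Finset.card_insert_of_notMem,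
        Finset.card_insert_of_notMem, Finset.card_insert_of_notMem, Finset.card_singleton] at h5
      · omega
      all_goals grind
    have hbuild : ∀ p q r t : V, p ≠ q → p ≠ r → p ≠ t → q ≠ r → q ≠ t → r ≠ t → p ≠ c → q ≠ c →
        r ≠ c → t ≠ c → Function.Injective ![p, q, r, t, c] ∧
          ∀ i, ![p, q, r, t, c] i ∈ M ↔ (i : ℕ) < 4 := by
      intro p q r t _ _ _ _ _ _ _ _ _ _
      constructor
      · exact injective_vec_five (by simp [*])
      · intro i
        rw [hMv]
        fin_cases i <;> simp [*]
    have hleg : ∀ p q r : V, p ≠ q → p ≠ r → q ≠ r → p ≠ d → q ≠ d → r ≠ d → G.Adj c p →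
        G.Adj c q → G.Adj c r → G.Adj r d →
        GraphForm G M 5 {s(4, 0), s(4, 1), s(4, 2), s(2, 3)} := by
      intro p q r m1 m2 m3 m4 m5 m6 a1 a2 a3 a4
      obtain ⟨hi, hm⟩ := hbuild p q r d m1 m2 m4 m3 m5 m6 (hne a1).symm (hne a2).symm (hne a3).symm
        hd.1
      refine graphForm_of_injective hT ![p, q, r, d, c] hi hc ?_ (by decide) hm
      intro i j hij
      fin_cases i <;> fin_cases j <;> first
        | (exfalso; revert hij; decide)
        | (simp [a1, a2, a3, a4, a1.symm, a2.symm, a3.symm, a4.symm])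
    rcases hw5 with rfl | rfl | rfl | rfl
    · right; right; left
      obtain ⟨hi, hm⟩ := hbuild b₁ b₂ b₃ d h12 h13 (Ne.symm hd.2.1) h23 (Ne.symm hd.2.2.1)
        (Ne.symm hd.2.2.2) n1.symm n2.symm n3.symm hd.1
      refine graphForm_of_injective hT ![b₁, b₂, b₃, d, w] hi hc ?_ (by decide) hm
      intro i j hij
      fin_cases i <;> fin_cases j <;> first
        | (exfalso; revert hij; decide)
        | (simp [hb₁, hb₂, hb₃, hw, hb₁.symm, hb₂.symm, hb₃.symm, hw.symm])
    · right; right; right; left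
      exact hleg b₂ b₃ w h23 h12.symm h13.symm (Ne.symm hd.2.2.1) (Ne.symm hd.2.2.2) (hne hw).symm
        hb₂ hb₃ hb₁ hw.symm
    · right; right; right; left
      exact hleg b₁ b₃ w h13 h12 h23.symm (Ne.symm hd.2.1) (Ne.symm hd.2.2.2) (hne hw).symm
        hb₁ hb₃ hb₂ hw.symm
    · right; right; right; left
      exact hleg b₁ b₂ w h12 h13 h23 (Ne.symm hd.2.1) (Ne.symm hd.2.2.1) (hne hw).symm
        hb₁ hb₂ hb₃ hw.symm
  · -- six vertices
    right; right; right; right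
    obtain ⟨c, c', hcc, hMc'⟩ := Finset.card_eq_two.mp (show Mᶜ.card = 2 by omega)
    have hMv : ∀ v, v ∈ M ↔ v ≠ c ∧ v ≠ c' := by
      intro v
      have := Finset.mem_compl (s := M) (a := v)
      rw [hMc', Finset.mem_insert, Finset.mem_singleton] at this
      tauto
    have hcM : c ∉ M := by rw [hMv]; tauto
    have hcM' : c' ∉ M := by rw [hMv]; tauto
    -- A 4-cycle through `c` and `c'`: the remaining three edges would keep the ends of the edge `c
    -- p` in the same class of its cut.
    have hno : ∀ p q, p ≠ q → G.Adj c p → G.Adj c' p → G.Adj c q → G.Adj c' q → False := by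
      intro p q hpq a1 a2 a3 a4
      obtain ⟨s, hs, hs'⟩ := hcut c p a1
      have e1 := hs' c' p a2 (by rw [Ne, Sym2.eq_iff]; have := hne a2; have := hne a1; grind)
      have e2 := hs' c q a3 (by rw [Ne, Sym2.eq_iff]; have := hne a1; grind)
      have e3 := hs' c' q a4 (by rw [Ne, Sym2.eq_iff]; have := hne a4; have := hne a3; grind)
      tauto
    have htri : ∀ p, G.Adj c c' → G.Adj c p → G.Adj c' p → False := by
      intro p a1 a2 a3
      obtain ⟨s, hs, hs'⟩ := hcut c p a2
      have e1 := hs' c' p a3 (by rw [Ne, Sym2.eq_iff]; have := hne a3; have := hne a2; grind)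
      have e2 := hs' c c' a1 (by rw [Ne, Sym2.eq_iff]; have := hne a3; have := hne a2; grind)
      tauto
    by_cases hadj : G.Adj c c'
    · have hsub : ∀ c c', G.Adj c c' → 3 ≤ G.degree c → ∃ a b, a ≠ b ∧ a ≠ c' ∧ b ≠ c' ∧
          G.Adj c a ∧ G.Adj c b := by
        intro c c' hadj h3
        have h1 : 1 < ((G.neighborFinset c).erase c').card := by
          rw [Finset.card_erase_of_mem (by simpa using hadj)]
          have : (G.neighborFinset c).card = G.degree c := rfl
          omega
        obtain ⟨a, b, ha, hb, hab⟩ := Finset.one_lt_card_iff.mp h1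
        simp only [Finset.mem_erase, SimpleGraph.mem_neighborFinset] at ha hb
        exact ⟨a, b, hab, ha.1, hb.1, ha.2, hb.2⟩
      obtain ⟨a, b, hab, hac', hbc', ha, hb⟩ := hsub c c' hadj (hdeg c hcM)
      obtain ⟨a', b', hab', hac, hbc, ha', hb'⟩ := hsub c' c hadj.symm (hdeg c' hcM')
      have n1 : a ≠ a' := fun h => htri a hadj ha (h ▸ ha')
      have n2 : a ≠ b' := fun h => htri a hadj ha (h ▸ hb')
      have n3 : b ≠ a' := fun h => htri b hadj hb (h ▸ ha')
      have n4 : b ≠ b' := fun h => htri b hadj hb (h ▸ hb')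
      have n5 := (hne ha).symm
      have n6 := (hne hb).symm
      have n7 := (hne ha').symm
      have n8 := (hne hb').symm
      refine graphForm_of_injective hT ![a, b, a', b', c, c'] ?_ hc ?_ (by decide) ?_
      · exact injective_vec_six (by
          have := hne hadj
          simp [*])
      · intro i j hij
        fin_cases i <;> fin_cases j <;> first
          | (exfalso; revert hij; decide)
          | (simp [ha, hb, ha', hb', hadj, ha.symm, hb.symm, ha'.symm, hb'.symm, hadj.symm])
      · intro i
        rw [hMv]
        fin_cases i <;> simp [*]
    · exfalso
      have hs1 : G.neighborFinset c ⊆ M := by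
        intro v hv
        rw [SimpleGraph.mem_neighborFinset] at hv
        rw [hMv]
        exact ⟨(hne hv).symm, fun h => hadj (h ▸ hv)⟩
      have hs2 : G.neighborFinset c' ⊆ M := by
        intro v hv
        rw [SimpleGraph.mem_neighborFinset] at hv
        rw [hMv]
        exact ⟨fun h => hadj (h ▸ hv).symm, (hne hv).symm⟩
      have hu := Finset.card_le_card (Finset.union_subset hs1 hs2)
      have hi := Finset.card_union_add_card_inter (G.neighborFinset c) (G.neighborFinset c')
      have d1 : 3 ≤ (G.neighborFinset c).card := hdeg c hcM
      have d2 : 3 ≤ (G.neighborFinset c').card := hdeg c' hcM'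
      -- If `c` and `c'` are not adjacent, each has three neighbours among the four marked vertices,
      -- so they share two of them.
      obtain ⟨p, q, hp, hq, hpq⟩ := Finset.one_lt_card_iff.mp
        (show 1 < (G.neighborFinset c ∩ G.neighborFinset c').card by omega)
      simp only [Finset.mem_inter, SimpleGraph.mem_neighborFinset] at hp hq
      exact hno p q hpq hp.1 hp.2 hq.1 hq.2

end Trees

/-! ## The 1-skeleton of a complex with one tile is a tree -/

/-- A graph on `A` with edge set `B` and endpoint map `ℓ` traversed by a closed walk such that each
edge is the only one that leaves some set of vertices. -/
structure IsTreeWalk {A B : Type*} (u : ℤ → A) (ε : ℤ → B) (ℓ : B → Sym2 A) : Prop where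
  vertex_surj : Function.Surjective u
  edge_surj : Function.Surjective ε
  ends : ∀ k, ℓ (ε k) = s(u k, u (k + 1))
  cut : ∀ e, ∃ s : Set A, ∀ k, ε k = e ↔ ¬ (u k ∈ s ↔ u (k + 1) ∈ s)

namespace IsTreeWalk

variable {A B : Type*} {u : ℤ → A} {ε : ℤ → B} {ℓ : B → Sym2 A} {G : SimpleGraph A}

lemma exists_cut (h : IsTreeWalk u ε ℓ) (e : B) : ∃ s : Set A, ∀ e' x y, ℓ e' = s(x, y) →
    (e' = e ↔ ¬ (x ∈ s ↔ y ∈ s)) := by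
  obtain ⟨s, hs⟩ := h.cut e
  refine ⟨s, fun e' x y hxy => ?_⟩
  obtain ⟨k, rfl⟩ := h.edge_surj e'
  rw [hs]
  rw [h.ends, Sym2.eq_iff] at hxy
  rcases hxy with ⟨rfl, rfl⟩ | ⟨rfl, rfl⟩ <;> tauto

/-- Parallel edges cross the same cuts, whereas the cut of an edge is crossed by that edge only. -/
lemma injective (h : IsTreeWalk u ε ℓ) : Function.Injective ℓ := by
  intro e e' he
  obtain ⟨s, hs⟩ := h.exists_cut e
  generalize hp : ℓ e = p at he
  induction p with
  | _ x y => rw [eq_comm, hs e' x y he.symm, ← hs e x y hp]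

lemma ne (h : IsTreeWalk u ε ℓ) {e : B} {x y : A} (he : ℓ e = s(x, y)) : x ≠ y := by
  rintro rfl
  obtain ⟨s, hs⟩ := h.exists_cut e
  exact ((hs e x x he).mp rfl) Iff.rfl

/-- The simple graph traversed by the walk. -/
def graph (h : IsTreeWalk u ε ℓ) : SimpleGraph A where
  Adj x y := ∃ e, ℓ e = s(x, y)
  symm := ⟨fun x y ⟨e, he⟩ => ⟨e, by rw [he, Sym2.eq_swap]⟩⟩
  loopless := ⟨fun _ ⟨_, he⟩ => h.ne he rfl⟩

lemma exists_cut_of_adj (h : IsTreeWalk u ε ℓ) {x y : A} (hxy : h.graph.Adj x y) :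
    ∃ s : Set A, ¬ (x ∈ s ↔ y ∈ s) ∧
      ∀ z w, h.graph.Adj z w → s(z, w) ≠ s(x, y) → (z ∈ s ↔ w ∈ s) := by
  obtain ⟨e, he⟩ := hxy
  obtain ⟨s, hs⟩ := h.exists_cut e
  refine ⟨s, (hs e x y he).mp rfl, ?_⟩
  rintro z w ⟨e', he'⟩ hne
  by_contra hzw
  obtain rfl := (hs e' z w he').mpr hzw
  exact hne (he'.symm.trans he)

/-- The walk reaches every vertex, and a path avoiding an edge can never cross the cut of that edge,
so each edge is a bridge. -/
lemma isTree (h : IsTreeWalk u ε ℓ) : h.graph.IsTree := by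
  have hreach : ∀ k : ℤ, h.graph.Reachable (u 0) (u k) := by
    have hadj : ∀ k, h.graph.Adj (u k) (u (k + 1)) := fun k => ⟨ε k, h.ends k⟩
    intro k
    induction k with
    | zero => rfl
    | succ k ih => exact ih.trans (hadj _).reachable
    | pred k ih =>
      refine ih.trans ?_
      have := (hadj (-(k : ℤ) - 1)).symm.reachable
      rwa [sub_add_cancel] at this
  have hne : Nonempty A := ⟨u 0⟩
  refine ⟨⟨fun x y => ?_⟩, ?_⟩
  · obtain ⟨k, rfl⟩ := h.vertex_surj x
    obtain ⟨l, rfl⟩ := h.vertex_surj y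
    exact (hreach k).symm.trans (hreach l)
  · rw [SimpleGraph.isAcyclic_iff_forall_isBridge]
    intro p hp
    induction p with
    | _ x y =>
      obtain ⟨s, hs, hs'⟩ := h.exists_cut_of_adj (by simpa using hp)
      rw [SimpleGraph.isBridge_iff]
      intro hr
      have hw : ∀ a b, (h.graph.deleteEdges {s(x, y)}).Walk a b → (a ∈ s ↔ b ∈ s) := by
        intro a b w
        induction w with
        | nil => rfl
        | cons hadj _ ih =>
          rw [SimpleGraph.deleteEdges_adj] at hadj
          exact (hs' _ _ hadj.1 hadj.2).trans ih
      exact hs (hw x y hr.some)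

lemma ncard_eq_degree [Fintype A] [DecidableEq A] [DecidableRel G.Adj] (h : IsTreeWalk u ε ℓ)
    (hG : G = h.graph) (v : A) : {e | v ∈ ℓ e}.ncard = G.degree v := by
  subst hG
  rw [← SimpleGraph.card_incidenceFinset_eq_degree, ← ncard_coe_finset,
    SimpleGraph.coe_incidenceFinset, ← ncard_image_of_injective _ h.injective]
  congr 1
  ext p
  induction p with
  | _ x y =>
    simp only [mem_image, mem_ofPred_eq, SimpleGraph.incidenceSet, SimpleGraph.mem_edgeSet]
    constructor
    · rintro ⟨e, hv, he⟩
      exact ⟨⟨e, he⟩, he ▸ hv⟩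
    · rintro ⟨⟨e, he⟩, hv⟩
      exact ⟨e, he ▸ hv, he⟩

end IsTreeWalk

section Skeleton

variable {X : Type*} [TopologicalSpace X] {K : Topology.CWComplex (univ : Set X)}

lemma hasForm_of_graphForm [Fintype (Cell K 0)] [DecidableEq (Cell K 0)] {P : Set X}
    {u : ℤ → Cell K 0} {ε : ℤ → Cell K 1} {ℓ : Cell K 1 → Sym2 (Cell K 0)} (h : IsTreeWalk u ε ℓ)
    (hlink : ∀ e x y, (oneSkeleton K).IsLink e x y ↔ ℓ e = s(x, y)) {M : Finset (Cell K 0)}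
    (hM : ∀ v, v ∈ M ↔ vertexPoint K v ∈ P) {m : ℕ} {E : Finset (Sym2 (Fin m))}
    (hE : GraphForm h.graph M m E) : HasForm K P m E := by
  obtain ⟨α, hα, hαM⟩ := hE
  have hmem : ∀ e, Sym2.map α (ℓ e) ∈ E := by
    intro e
    generalize hp : ℓ e = p
    induction p with
    | _ x y => exact (hα x y).mp ⟨e, hp⟩
  let β : Cell K 1 ≃ E := Equiv.ofBijective (fun e => ⟨Sym2.map α (ℓ e), hmem e⟩) (by
    constructor
    · intro e e' he
      exact h.injective (Sym2.map.injective α.injective (Subtype.ext_iff.mp he))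
    · rintro ⟨p, hp⟩
      induction p with
      | _ i j =>
        obtain ⟨e, he⟩ := (hα (α.symm i) (α.symm j)).mpr (by simpa using hp)
        exact ⟨e, Subtype.ext (by simp [he])⟩)
  refine ⟨α, β, fun e x y => ?_, fun v => by rw [← hM, hαM]⟩
  rw [hlink]
  change _ ↔ Sym2.map α (ℓ e) = Sym2.map α s(x, y)
  exact (Sym2.map.injective α.injective).eq_iff.symm

end Skeleton

lemma set_pair_eq_iff {A : Type*} {a b c d : A} :
    ({a, b} : Set A) = {c, d} ↔ s(a, b) = s(c, d) := by
  rw [Set.pair_eq_pair_iff, Sym2.eq_iff]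

/-- The 1-skeleton of a complex with one tile on the sphere, as a tree. -/
lemma IsOneTile.exists_isTreeWalk {K : Topology.CWComplex (univ : Set (OnePoint ℂ))}
    (hK : IsOneTile K) : ∃ (u : ℤ → Cell K 0) (ε : ℤ → Cell K 1)
      (ℓ : Cell K 1 → Sym2 (Cell K 0)), IsTreeWalk u ε ℓ ∧
        ∀ e x y, (oneSkeleton K).IsLink e x y ↔ ℓ e = s(x, y) := by
  obtain ⟨n, ψ, h⟩ := hK.exists_polygonTiling
  choose u hu using h.vertex
  have hε' : ∀ k : ℤ, ∃ e : Cell K 1, SideOver n ψ k (openCell K 1 e) := by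
    intro k
    obtain ⟨_, ⟨e, rfl⟩, he⟩ := h.edge k
    exact ⟨e, he⟩
  choose ε hε using hε'
  have huniq : ∀ k e, SideOver n ψ k (openCell K 1 e) → ε k = e := by
    intro k e he
    have hk : ((k : ℝ) + 1 / 2) ∈ Ioo (k : ℝ) (k + 1) := ⟨by linarith, by linarith⟩
    exact cell_eq_of_mem_openCell K ((hε k).mapsTo hk) (he.mapsTo hk)
  have hsurj : Function.Surjective ε := by
    intro e
    obtain ⟨k, hk⟩ := h.edge_surj _ ⟨e, rfl⟩
    exact ⟨k, huniq k e hk⟩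
  choose κ hκ using id hsurj
  have hlink : ∀ k e, ε k = e → ∀ x y,
      (oneSkeleton K).IsLink e x y ↔ s(u k, u (k + 1)) = s(x, y) := by
    rintro k _ rfl x y
    rw [isLink_iff_of_sideOver K h (hε k), ← hu k, ← hu (k + 1), set_pair_eq_iff]
    exact (Sym2.map.injective (vertexPoint_injective K)).eq_iff (a := s(u k, u (k + 1)))
      (b := s(x, y))
  refine ⟨u, ε, fun e => s(u (κ e), u (κ e + 1)), ⟨?_, hsurj, ?_, ?_⟩,
    fun e x y => hlink _ _ (hκ e) x y⟩
  · intro v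
    obtain ⟨k, hk⟩ := h.vertex_surj _ ⟨v, rfl⟩
    exact ⟨k, vertexPoint_injective K (by rw [hu, hk])⟩
  · intro k
    rw [← hlink _ _ (hκ (ε k)), hlink k _ rfl]
  · intro e
    obtain ⟨s, hs⟩ := h.exists_cut (E := openCell K 1 e) ⟨e, rfl⟩
    refine ⟨vertexPoint K ⁻¹' s, fun k => ?_⟩
    rw [mem_preimage, mem_preimage, hu, hu, ← hs]
    exact ⟨fun he => he ▸ hε k, huniq k e⟩

/-- Since the tree is connected with several vertices, degree zero does not occur; `hprune` excludes
degrees one and two outside `P`. -/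
theorem IsOneTile.hasOneOfFiveForms {K : Topology.CWComplex (univ : Set (OnePoint ℂ))}
    (hK : IsOneTile K) {P : Set (OnePoint ℂ)} (hP : P ⊆ vertexSet K) (hP4 : P.ncard = 4)
    (hprune : ∀ v : Cell K 0, valence K v = 1 ∨ valence K v = 2 → vertexPoint K v ∈ P) :
    HasOneOfFiveForms K P := by
  classical
  obtain ⟨u, ε, ℓ, h, hlink⟩ := hK.exists_isTreeWalk
  have := hK.finite.1 0
  have : Fintype (Cell K 0) := Fintype.ofFinite _
  let M : Finset (Cell K 0) := {v | vertexPoint K v ∈ P}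
  have hM : ∀ v, v ∈ M ↔ vertexPoint K v ∈ P := fun v => by simp [M]
  have hM4 : M.card = 4 := by
    rw [← hP4, ← ncard_coe_finset, ← ncard_image_of_injective _ (vertexPoint_injective K)]
    congr 1
    ext x
    constructor
    · rintro ⟨v, hv, rfl⟩
      exact (hM v).mp hv
    · intro hx
      obtain ⟨v, rfl⟩ := hP hx
      exact ⟨v, (hM v).mpr hx, rfl⟩
  have hval : ∀ v, valence K v = h.graph.degree v := by
    intro v
    rw [← h.ncard_eq_degree rfl]
    -- There are no loops, so the number of edge ends is the number of incident edges.
    have h1 : {e | (oneSkeleton K).IsLoopAt e v} = ∅ := by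
      refine eq_empty_of_forall_notMem fun e he => ?_
      exact h.ne ((hlink e v v).mp he) rfl
    have h2 : {e | (oneSkeleton K).Inc e v} = {e | v ∈ ℓ e} := by
      ext e
      rw [mem_ofPred_eq, mem_ofPred_eq, Sym2.mem_iff_exists]
      exact exists_congr fun y => hlink e v y
    rw [valence, h1, h2, ncard_empty, add_zero]
  have hnt : Nontrivial (Cell K 0) := Fintype.one_lt_card_iff_nontrivial.mp (by
    have := Finset.card_le_univ M
    omega)
  have hdeg : ∀ v ∉ M, 3 ≤ h.graph.degree v := by
    intro v hv
    have h0 := h.isTree.connected.preconnected.degree_pos_of_nontrivial v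
    by_contra hlt
    exact hv ((hM v).mpr (hprune v (by rw [hval]; omega)))
  have hform : ∀ {m} {E : Finset (Sym2 (Fin m))}, GraphForm h.graph M m E → HasForm K P m E :=
    hasForm_of_graphForm h hlink hM
  rcases graphForm_of_isTree h.isTree (fun x y hxy => h.exists_cut_of_adj hxy) hM4 hdeg with
    hG | hG | hG | hG | hG
  exacts [Or.inl (hform hG), Or.inr (Or.inl (hform hG)), Or.inr (Or.inr (Or.inl (hform hG))),
    Or.inr (Or.inr (Or.inr (Or.inl (hform hG)))), Or.inr (Or.inr (Or.inr (Or.inr (hform hG))))]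

/-! ## Lifting characteristic maps -/

section Lift

variable {E X Y : Type*} [NormedAddCommGroup E] [NormedSpace ℝ E] [TopologicalSpace X]
  [TopologicalSpace Y]

/-- By compactness `g` has a cluster point `w` over `y`. Separate the finitely many points over `y`
by disjoint open sets. Close to `z` the values of `g` form a connected set inside the union of these
neighbourhoods, so they stay in the one of `w`. -/
lemma exists_tendsto_of_finite_fiber [CompactSpace X] [T2Space X] [T2Space Y] {f : X → Y} (hf : Continuous f) {B : Set E}
    (hB : Convex ℝ B) {g : E → X} (hg : ContinuousOn g B) {z : E} (hz : z ∈ closure B) {y : Y}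
    (hlim : Tendsto (fun t => f (g t)) (𝓝[B] z) (𝓝 y)) (hfin : (f ⁻¹' {y}).Finite) :
    ∃ w, f w = y ∧ Tendsto g (𝓝[B] z) (𝓝 w) := by
  have hne : (𝓝[B] z).NeBot := mem_closure_iff_nhdsWithin_neBot.mp hz
  obtain ⟨w, hw⟩ := exists_clusterPt_of_compactSpace (map g (𝓝[B] z))
  have hfw : f w = y := by
    have h1 : ClusterPt (f w) (map f (map g (𝓝[B] z))) := hw.map hf.continuousAt tendsto_map
    have h2 : ClusterPt (f w) (𝓝 y) := h1.mono hlim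
    exact eq_of_nhds_neBot h2
  refine ⟨w, hfw, ?_⟩
  obtain ⟨U, hU, hUd⟩ := hfin.t2_separation
  rw [tendsto_iff_forall_eventually_mem]
  intro N hN
  obtain ⟨N', hN'N, hN'o, hwN'⟩ := _root_.mem_nhds_iff.mp hN
  set A : Set X := U w ∩ N'
  set A' : Set X := ⋃ v ∈ f ⁻¹' {y} \ {w}, U v
  have hAo : IsOpen A := (hU w).2.inter hN'o
  have hA'o : IsOpen A' := isOpen_biUnion fun v _ => (hU v).2
  have hAA' : Disjoint A A' := by
    refine Disjoint.mono_left inter_subset_left (disjoint_iUnion₂_right.mpr fun v hv => ?_)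
    exact hUd hfw hv.1 fun h => hv.2 h.symm
  have hcompl : IsClosed (f '' (A ∪ A')ᶜ) :=
    ((hAo.union hA'o).isClosed_compl.isCompact.image hf).isClosed
  have hy : y ∉ f '' (A ∪ A')ᶜ := by
    rintro ⟨v, hv, hvy⟩
    apply hv
    by_cases hvw : v = w
    · exact Or.inl (hvw ▸ ⟨(hU w).1, hwN'⟩)
    · exact Or.inr (mem_biUnion (x := v) ⟨hvy, hvw⟩ (hU v).1)
  have hev := hlim.eventually (hcompl.isOpen_compl.mem_nhds hy)
  obtain ⟨r, hr, hrB⟩ := Metric.mem_nhdsWithin_iff.mp hev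
  have hsub : g '' (ball z r ∩ B) ⊆ A ∪ A' := by
    rintro _ ⟨t, ht, rfl⟩
    by_contra hnot
    exact hrB ht ⟨_, hnot, rfl⟩
  have hconn : IsPreconnected (g '' (ball z r ∩ B)) :=
    ((convex_ball z r).inter hB).isPreconnected.image _ (hg.mono inter_subset_right)
  have hmem : g '' (ball z r ∩ B) ∈ map g (𝓝[B] z) :=
    image_mem_map (inter_mem (mem_nhdsWithin_of_mem_nhds (ball_mem_nhds z hr)) self_mem_nhdsWithin)
  have hmeet : (g '' (ball z r ∩ B) ∩ A).Nonempty := by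
    rw [inter_comm]
    exact clusterPt_iff_nonempty.mp hw (hAo.mem_nhds ⟨(hU w).1, hwN'⟩) hmem
  have := hconn.subset_left_of_subset_union hAo hA'o hAA' hsub hmeet
  exact mem_of_superset (mem_map.mp hmem) fun t ht => hN'N (this ht).2

/-- A map of the closed unit ball whose restriction to the open ball takes values over which `f` is
a covering can be lifted, if the fibers of `f` are finite. -/
lemma exists_lift_closedBall [CompactSpace X] [T2Space X] [T2Space Y] {f : X → Y} (hf : Continuous f) {s : Set Y}
    (hs : IsCoveringMapOn f s) (hfin : ∀ y, (f ⁻¹' {y}).Finite) {q : E → Y}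
    (hq : ContinuousOn q (closedBall 0 1)) (hqs : MapsTo q (ball 0 1) s) {z : E}
    (hz : z ∈ ball (0 : E) 1) {x : X} (hx : f x = q z) :
    ∃ g : E → X, ContinuousOn g (closedBall 0 1) ∧ g z = x ∧ ∀ t ∈ closedBall 0 1, f (g t) = q t := by
  have : ContractibleSpace (ball (0 : E) 1) := contractibleSpace_ball one_pos
  have : LocallyPathConnectedSpace (ball (0 : E) 1) :=
    isOpen_ball.locallyPathConnectedSpace
  let q' : C(ball (0 : E) 1, Y) := ⟨fun t => q t,
    (hq.mono ball_subset_closedBall).domRestrict⟩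
  obtain ⟨F, ⟨hF, hFq⟩, -⟩ := hs.existsUnique_continuousMap_lifts q' (a₀ := ⟨z, hz⟩) (e₀ := x) hx
    (fun a => hqs a.2)
  classical
  let g₀ : E → X := fun t => if h : t ∈ ball (0 : E) 1 then F ⟨t, h⟩ else x
  have hg₀ : ∀ t (h : t ∈ ball (0 : E) 1), g₀ t = F ⟨t, h⟩ := fun t h => dif_pos h
  have hfg₀ : ∀ t ∈ ball (0 : E) 1, f (g₀ t) = q t := by
    intro t ht
    rw [hg₀ t ht]
    exact congrFun hFq ⟨t, ht⟩
  have hcont : ContinuousOn g₀ (ball 0 1) := by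
    rw [continuousOn_iff_continuous_domRestrict]
    convert F.continuous using 1
    ext t
    exact hg₀ t t.2
  have hlim : ∀ t ∈ closedBall (0 : E) 1, ∃ w, f w = q t ∧ Tendsto g₀ (𝓝[ball 0 1] t) (𝓝 w) := by
    intro t ht
    refine exists_tendsto_of_finite_fiber hf (convex_ball 0 1) hcont
      (by rwa [closure_ball _ one_ne_zero]) ?_ (hfin _)
    exact ((hq t ht).mono ball_subset_closedBall).tendsto.congr'
      (eventually_nhdsWithin_of_forall fun t ht => (hfg₀ t ht).symm)
  have hext : ∀ t ∈ closedBall (0 : E) 1, ∀ w, Tendsto g₀ (𝓝[ball 0 1] t) (𝓝 w) →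
      extendFrom (ball 0 1) g₀ t = w := fun t ht w hw =>
    extendFrom_eq (by rwa [closure_ball _ one_ne_zero]) hw
  refine ⟨extendFrom (ball 0 1) g₀, ?_, ?_, ?_⟩
  · refine continuousOn_extendFrom (by rw [closure_ball _ one_ne_zero]) fun t ht => ?_
    obtain ⟨w, -, hw⟩ := hlim t ht
    exact ⟨w, hw⟩
  · rw [hext z (ball_subset_closedBall hz) _ (hcont z hz), hg₀ z hz, hF]
  · intro t ht
    obtain ⟨w, hfw, hw⟩ := hlim t ht
    rw [hext t ht w hw, hfw]

/-- Uniqueness of lifts over the simply connected open ball; it makes the lifted cells either equal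
or disjoint. -/
lemma eqOn_lift {f : X → Y} {s : Set Y} (hs : IsCoveringMapOn f s) {q : E → Y}
    (hqs : MapsTo q (ball 0 1) s) {g g' : E → X} (hg : ContinuousOn g (closedBall 0 1))
    (hg' : ContinuousOn g' (closedBall 0 1)) (hgq : ∀ t ∈ closedBall 0 1, f (g t) = q t)
    (hgq' : ∀ t ∈ closedBall 0 1, f (g' t) = q t) (hq : ContinuousOn q (closedBall 0 1)) {z : E}
    (hz : z ∈ ball (0 : E) 1) (hzz : g z = g' z) : EqOn g g' (ball 0 1) := by
  have : ContractibleSpace (ball (0 : E) 1) := contractibleSpace_ball one_pos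
  have : LocallyPathConnectedSpace (ball (0 : E) 1) :=
    isOpen_ball.locallyPathConnectedSpace
  let q' : C(ball (0 : E) 1, Y) := ⟨fun t => q t,
    (hq.mono ball_subset_closedBall).domRestrict⟩
  obtain ⟨F, -, hF⟩ := hs.existsUnique_continuousMap_lifts q' (a₀ := ⟨z, hz⟩) (e₀ := g z)
    (hgq z (ball_subset_closedBall hz)) (fun a => hqs a.2)
  have h1 := hF ⟨fun t => g t, (hg.mono ball_subset_closedBall).domRestrict⟩
    ⟨rfl, funext fun t => hgq t (ball_subset_closedBall t.2)⟩
  have h2 := hF ⟨fun t => g' t, (hg'.mono ball_subset_closedBall).domRestrict⟩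
    ⟨hzz.symm, funext fun t => hgq' t (ball_subset_closedBall t.2)⟩
  intro t ht
  exact congrArg (fun F : C(ball (0 : E) 1, X) => F ⟨t, ht⟩) (h1.trans h2.symm)

end Lift

/-- The cells of a CW structure can be lifted along a map with finite fibers which is a covering
away from a set of vertices. -/
theorem exists_liftedComplex.{u} {X : Type u} [TopologicalSpace X] [CompactSpace X] [T2Space X]
    {f : X → X} (hf : Continuous f) {P : Set X} (hcov : IsCoveringMapOn f Pᶜ)
    (hfin : ∀ y, (f ⁻¹' {y}).Finite) (K : Topology.CWComplex (univ : Set X))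
    (hK : IsFiniteTwoDimensional K) (hP : P ⊆ vertexSet K) :
    ∃ K' : Topology.CWComplex (univ : Set X), IsFiniteTwoDimensional K' ∧
      ∀ n (c : Cell K' n), IsPreconnected (openCell K' n c) ∧ ∃ d : Cell K n,
        MapsHomeomorphicallyOnto f (openCell K' n c) (openCell K n d) := by
  let := K
  let q : ∀ n, Cell K n → (Fin n → ℝ) → X := fun n c => RelCWComplex.map (C := (univ : Set X)) n c
  have hq : ∀ n c, ContinuousOn (q n c) (closedBall 0 1) := fun n c => RelCWComplex.continuousOn n c
  have hqinj : ∀ n c, InjOn (q n c) (ball 0 1) := by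
    intro n c
    have := (RelCWComplex.map (C := (univ : Set X)) n c).injOn
    rwa [RelCWComplex.source_eq] at this
  have hqo : ∀ n c, q n c '' ball 0 1 = openCell K n c := fun n c => rfl
  have hqP : ∀ n, n ≠ 0 → ∀ c, MapsTo (q n c) (ball 0 1) Pᶜ := by
    intro n hn c t ht hP'
    obtain ⟨v, hv⟩ := hP hP'
    have h1 : q n c t ∈ openCell K n c := mem_image_of_mem _ ht
    refine hn (dim_eq_of_mem_openCell K h1 (d := v) ?_)
    rw [openCell_zero]
    exact hv.symm
  have hqs : ∀ n c, ∀ t ∈ sphere (0 : Fin n → ℝ) 1, ∃ m < n, ∃ d : Cell K m,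
      q n c t ∈ openCell K m d := by
    intro n c t ht
    have h1 : q n c t ∈ RelCWComplex.cellFrontier (C := (univ : Set X)) n c := ⟨t, ht, rfl⟩
    obtain ⟨I, hI⟩ := RelCWComplex.cellFrontier_subset_finite_openCell (C := (univ : Set X)) n c
    have h2 := hI h1
    simp only [empty_union, mem_iUnion, exists_prop] at h2
    obtain ⟨m, hm, d, -, hd⟩ := h2
    exact ⟨m, hm, d, hd⟩
  have hlift : ∀ n (c : Cell K n), ∀ z ∈ ball (0 : Fin n → ℝ) 1, ∀ x, f x = q n c z →
      ∃ g : (Fin n → ℝ) → X, ContinuousOn g (closedBall 0 1) ∧ g z = x ∧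
        ∀ t ∈ closedBall 0 1, f (g t) = q n c t := by
    intro n c z hz x hx
    -- Vertices may lie in `P`, where `f` is no covering, so they are lifted by hand; cells of
    -- positive dimension miss `P`.
    rcases eq_or_ne n 0 with rfl | hn
    · exact ⟨fun _ => x, continuousOn_const, rfl, fun t _ => by rw [hx, Subsingleton.elim z t]⟩
    · exact exists_lift_closedBall hf hcov hfin (hq n c) (hqP n hn c) hz hx
  -- There is one lift of a cell for each point of the fiber over its centre.
  let cell : ℕ → Type u := fun n => {p : Cell K n × X // f p.2 = q n p.1 0}
  have h0 : ∀ n, (0 : Fin n → ℝ) ∈ ball (0 : Fin n → ℝ) 1 := fun n => mem_ball_self one_pos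
  choose g hg hg0 hgq using fun n (p : cell n) => hlift n p.1.1 0 (h0 n) p.1.2 p.2
  have hball : ∀ n (p : cell n), ∀ t ∈ ball (0 : Fin n → ℝ) 1,
      f (g n p t) ∈ openCell K n p.1.1 := by
    intro n p t ht
    rw [hgq n p t (ball_subset_closedBall ht)]
    exact mem_image_of_mem _ ht
  have hcover : ∀ x n (d : Cell K n), f x ∈ openCell K n d → ∃ p : cell n, x ∈ g n p '' ball 0 1 := by
    rintro x n d ⟨z, hz, hzx⟩
    obtain ⟨g', hg', hg'z, hg'q⟩ := hlift n d z hz x hzx.symm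
    let p : cell n := ⟨(d, g' 0), hg'q 0 (ball_subset_closedBall (h0 n))⟩
    refine ⟨p, z, hz, ?_⟩
    rw [← hg'z]
    rcases eq_or_ne n 0 with rfl | hn
    · rw [Subsingleton.elim z 0, hg0]
    · exact eqOn_lift hcov (hqP n hn d) (hg n p) hg' (hgq n p) hg'q (hq n d) (h0 n) (hg0 n p) hz
  have hgsphere : ∀ n (p : cell n), ∀ t ∈ sphere (0 : Fin n → ℝ) 1, ∃ m < n, ∃ d : Cell K m,
      f (g n p t) ∈ openCell K m d := by
    intro n p t ht
    rw [hgq n p t (sphere_subset_closedBall ht)]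
    exact hqs n _ t ht
  have hginj : ∀ n (p : cell n), InjOn (g n p) (ball 0 1) := by
    intro n p s hs t ht hst
    refine hqinj n p.1.1 hs ht ?_
    rw [← hgq n p s (ball_subset_closedBall hs), ← hgq n p t (ball_subset_closedBall ht), hst]
  have hcw : ∃ K' : Topology.CWComplex (univ : Set X), IsFiniteTwoDimensional K' ∧
      ∃ e : ∀ n, Cell K' n ≃ cell n, ∀ n c, openCell K' n c = g n (e n c) '' ball 0 1 := by
    refine exists_cwComplex cell ?_ ?_ g hg hginj ?_ ?_ ?_
    · intro n
      have := hK.1 n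
      have hfib : ∀ c : Cell K n, Finite (f ⁻¹' {q n c 0}) := fun c => hfin _
      exact Finite.of_injective
        (fun p : cell n => (⟨p.1.1, ⟨p.1.2, p.2⟩⟩ : Σ c : Cell K n, f ⁻¹' {q n c 0})) (by
          rintro ⟨⟨c, x⟩, hx⟩ ⟨⟨c', x'⟩, hx'⟩ h
          simp only [Sigma.mk.injEq] at h
          obtain ⟨rfl, h⟩ := h
          exact Subtype.ext (Prod.ext rfl (Subtype.ext_iff.mp (eq_of_heq h))))
    · intro n hn
      have := hK.2 n hn
      exact ⟨fun p => this.false p.1.1⟩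
    · intro n p t ht
      obtain ⟨m, hm, d, hd⟩ := hgsphere n p t ht
      obtain ⟨p', hp'⟩ := hcover _ m d hd
      exact ⟨m, hm, p', hp'⟩
    · intro n p m p' s hs t ht hst
      have h1 := hball n p s hs
      have h2 := hball m p' t ht
      rw [← hst] at h2
      obtain rfl := dim_eq_of_mem_openCell K h1 h2
      have hc := cell_eq_of_mem_openCell K h1 h2
      have hcell : p = p' := by
        have hst' : s = t := by
          refine hqinj n p.1.1 hs ht ?_
          rw [← hgq n p s (ball_subset_closedBall hs), hst, hc,
            hgq n p' t (ball_subset_closedBall ht)]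
        subst hst'
        refine Subtype.ext (Prod.ext hc ?_)
        rw [← hg0 n p, ← hg0 n p']
        rcases eq_or_ne n 0 with rfl | hn
        · rwa [Subsingleton.elim s 0] at hst
        · exact eqOn_lift hcov (hqP n hn p.1.1) (hg n p) (hg n p') (hgq n p) (hc ▸ hgq n p') (hq n _)
            hs hst (h0 n)
      rw [hcell]
    · intro x
      obtain ⟨n, d, hd⟩ := exists_mem_openCell K (f x)
      exact ⟨n, hcover x n d hd⟩
  obtain ⟨K', hK', e, he⟩ := hcw
  refine ⟨K', hK', fun n c => ⟨?_, (e n c).1.1, ?_, ?_⟩⟩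
  · rw [he]
    exact (convex_ball 0 1).isPreconnected.image _ ((hg n _).mono ball_subset_closedBall)
  · rw [he]
    refine isEmbedding_domRestrict_of_isCompact
      ((isCompact_closedBall 0 1).image_of_continuousOn (hg n (e n c))) hf.continuousOn
      (image_mono ball_subset_closedBall) ?_ ?_
    · rintro _ ⟨s, hs, rfl⟩ _ ⟨t, ht, rfl⟩ hst
      rw [hgq n _ s (ball_subset_closedBall hs), hgq n _ t (ball_subset_closedBall ht)] at hst
      rw [hqinj n _ hs ht hst]
    · rintro _ ⟨s, hs, rfl⟩ _ ⟨t, ht, rfl⟩ hnt hst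
      have hts : t ∈ sphere (0 : Fin n → ℝ) 1 := by
        rw [← closedBall_sdiff_ball]
        exact ⟨ht, fun h => hnt ⟨t, h, rfl⟩⟩
      obtain ⟨m, hm, d, hd⟩ := hgsphere n _ t hts
      rw [← hst] at hd
      exact hm.ne' (dim_eq_of_mem_openCell K (hball n _ s hs) hd)
  · rw [he, ← hqo, image_image]
    exact image_congr fun t ht => hgq n _ t (ball_subset_closedBall ht)

/-! ## Half-open arcs and legs -/

namespace PolygonTiling

section General

variable {X : Type*} [TopologicalSpace X] {n : ℕ} {ψ : ℂ → X} {V : Set X} {𝓔 : Set (Set X)}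

lemma continuous_comp (h : PolygonTiling n ψ V 𝓔) : Continuous fun θ => ψ (polygonPoint n θ) :=
  h.cont.comp_continuous (continuous_polygonPoint n) (polygonPoint_mem_closedBall n)

lemma skeletonSet_eq (h : PolygonTiling n ψ V 𝓔) : skeletonSet V 𝓔 = ψ '' sphere 0 1 := by
  refine subset_antisymm ?_ ?_
  · rintro x (hx | ⟨E, hE, hx⟩)
    · obtain ⟨k, rfl⟩ := h.vertex_surj x hx
      exact ⟨_, polygonPoint_mem_sphere _ _, rfl⟩
    · obtain ⟨k, hk⟩ := h.edge_surj E hE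
      obtain ⟨θ, -, rfl⟩ := hk.surjOn hx
      exact ⟨_, polygonPoint_mem_sphere _ _, rfl⟩
  · rintro _ ⟨z, hz, rfl⟩
    obtain ⟨θ, rfl⟩ := exists_polygonPoint_eq h.n_ne_zero (by simpa using hz : ‖z‖ = 1)
    by_cases hθ : θ = ⌊θ⌋
    · rw [hθ]
      exact Or.inl (h.vertex _)
    · obtain ⟨E, hE, hk⟩ := h.edge ⌊θ⌋
      exact Or.inr ⟨E, hE, hk.mapsTo
        ⟨(Int.floor_le θ).lt_of_ne (Ne.symm hθ), Int.lt_floor_add_one θ⟩⟩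

lemma isCompact_skeletonSet (h : PolygonTiling n ψ V 𝓔) : IsCompact (skeletonSet V 𝓔) := by
  rw [h.skeletonSet_eq]
  exact (isCompact_sphere _ _).image_of_continuousOn (h.cont.mono sphere_subset_closedBall)

lemma vertex_notMem (h : PolygonTiling n ψ V 𝓔) {v : X} (hv : v ∈ V) {E : Set X} (hE : E ∈ 𝓔) :
    v ∉ E := disjoint_left.mp (h.disjoint_vertices E hE) hv

lemma edge_eq (h : PolygonTiling n ψ V 𝓔) {E F : Set X} (hE : E ∈ 𝓔) (hF : F ∈ 𝓔) {x : X}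
    (hxE : x ∈ E) (hxF : x ∈ F) : E = F :=
  h.disjoint_edges.elim hE hF (not_disjoint_iff.mpr ⟨x, hxE, hxF⟩)

end General

variable {n : ℕ} {ψ : ℂ → OnePoint ℂ} {V : Set (OnePoint ℂ)} {𝓔 : Set (Set (OnePoint ℂ))}

lemma finite_vertices (h : PolygonTiling n ψ V 𝓔) : V.Finite := by
  obtain ⟨K, hK, rfl, -⟩ := h.exists_isOneTile
  have := hK.finite.1 0
  exact finite_range _

lemma finite_edges (h : PolygonTiling n ψ V 𝓔) : 𝓔.Finite := by
  obtain ⟨K, hK, -, rfl⟩ := h.exists_isOneTile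
  have := hK.finite.1 1
  exact finite_range _

/-- What remains is the union of the vertices and the closures of the other edges, a finite union of
closed sets. -/
lemma isClosed_skeletonSet_diff (h : PolygonTiling n ψ V 𝓔) {E : Set (OnePoint ℂ)} (hE : E ∈ 𝓔) :
    IsClosed (skeletonSet V 𝓔 \ E) := by
  have heq : skeletonSet V 𝓔 \ E = V ∪ ⋃ F ∈ 𝓔 \ {E}, closure F := by
    ext x
    constructor
    · rintro ⟨hx | ⟨F, hF, hx⟩, hxE⟩
      · exact Or.inl hx
      · exact Or.inr (mem_biUnion (x := F) ⟨hF, fun hFE => hxE (hFE ▸ hx)⟩ (subset_closure hx))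
    · rintro (hx | hx)
      · exact ⟨Or.inl hx, h.vertex_notMem hx hE⟩
      · simp only [mem_iUnion, exists_prop] at hx
        obtain ⟨F, ⟨hF, hFE⟩, hx⟩ := hx
        by_cases hxF : x ∈ F
        · exact ⟨Or.inr ⟨F, hF, hxF⟩, fun hxE => hFE (h.edge_eq hF hE hxF hxE)⟩
        · obtain ⟨k, hk⟩ := h.edge_surj F hF
          have hxV : x ∈ V := by
            have : x ∈ closure F \ F := ⟨hx, hxF⟩
            rw [h.closure_diff hF hk] at this
            rcases this with rfl | rfl <;> exact h.vertex _
          exact ⟨Or.inl hxV, h.vertex_notMem hxV hE⟩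
  rw [heq]
  exact h.finite_vertices.isClosed.union
    ((h.finite_edges.subset sdiff_subset).isClosed_biUnion fun F _ => isClosed_closure)

/-- An edge together with one of its endpoints is a half-open arc. -/
lemma exists_halfOpenArc (h : PolygonTiling n ψ V 𝓔) {v : OnePoint ℂ} (hv : v ∈ V)
    {E : Set (OnePoint ℂ)} (hE : E ∈ 𝓔) (hvE : v ∈ closure E) :
    ∃ (p : ℝ → OnePoint ℂ) (G : OnePoint ℂ → ℝ), Continuous p ∧ p 1 = v ∧ BijOn p (Ioo 0 1) E ∧
      BijOn p (Ioc 0 1) (insert v E) ∧ ContinuousOn G (insert v E) ∧ LeftInvOn G p (Ioc 0 1) := by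
  obtain ⟨p, hp, hp1, hp0, hpE⟩ : ∃ p : ℝ → OnePoint ℂ, Continuous p ∧ p 1 = v ∧
      p 0 ∉ insert v E ∧ BijOn p (Ioo 0 1) E := by
    obtain ⟨k, hk⟩ := h.edge_surj E hE
    have hne := h.vertex_ne k
    rcases h.eq_or_eq_of_mem_closure hE hk hv hvE with rfl | rfl
    · refine ⟨fun t => ψ (polygonPoint n ((k : ℝ) + 1 - t)),
        h.continuous_comp.comp (by fun_prop : Continuous fun t : ℝ => (k : ℝ) + 1 - t),
        by simp, ?_, ?_⟩
      · have e : (k : ℝ) + 1 - 0 = ((k + 1 : ℤ) : ℝ) := by push_cast; ring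
        simp only [e]
        rintro (h' | h')
        · exact hne h'.symm
        · exact h.vertex_notMem (h.vertex _) hE h'
      · have := hk.comp (s := Ioo (0 : ℝ) 1) (f := fun t : ℝ => (k : ℝ) + 1 - t) ?_
        · exact this
        · have h1 : Ioo (k : ℝ) (k + 1) = (fun t : ℝ => (k : ℝ) + 1 - t) '' Ioo 0 1 := by
            rw [image_const_sub_Ioo]; simp
          rw [h1]
          exact (sub_right_injective.injOn).bijOn_image
    · refine ⟨fun t => ψ (polygonPoint n ((k : ℝ) + t)),
        h.continuous_comp.comp (by fun_prop : Continuous fun t : ℝ => (k : ℝ) + t),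
        by simp, ?_, ?_⟩
      · simp only [add_zero]
        rintro (h' | h')
        · exact hne h'
        · exact h.vertex_notMem (h.vertex _) hE h'
      · have := hk.comp (s := Ioo (0 : ℝ) 1) (f := fun t : ℝ => (k : ℝ) + t) ?_
        · exact this
        · have h1 : Ioo (k : ℝ) (k + 1) = (fun t : ℝ => (k : ℝ) + t) '' Ioo 0 1 := by
            rw [image_const_add_Ioo]; simp
          rw [h1]
          exact ((add_right_injective _).injOn).bijOn_image
  have hvE' := h.vertex_notMem hv hE
  have hIoc : Ioc (0 : ℝ) 1 = insert 1 (Ioo 0 1) := (Ioo_insert_right one_pos).symm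
  have hbij : BijOn p (Ioc 0 1) (insert v E) := by
    rw [hIoc, ← hp1]
    exact hpE.insert (by rwa [hp1])
  have hemb : IsEmbedding ((Ioc 0 1).domRestrict p) := by
    refine isEmbedding_domRestrict_of_isCompact (isCompact_Icc (a := (0 : ℝ)) (b := 1))
      hp.continuousOn Ioc_subset_Icc_self hbij.injOn ?_
    intro s hs t ht htn he
    obtain rfl : t = 0 := by
      by_contra hne
      exact htn ⟨ht.1.lt_of_ne (Ne.symm hne), ht.2⟩
    exact hp0 (he ▸ hbij.mapsTo hs)
  obtain ⟨G, hG, hGl⟩ := exists_continuousOn_leftInvOn hemb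
  exact ⟨p, G, hp, hp1, hpE, hbij, hbij.image_eq ▸ hG, hGl⟩

lemma exists_vertex_mem_closure (h : PolygonTiling n ψ V 𝓔) {E : Set (OnePoint ℂ)} (hE : E ∈ 𝓔) :
    ∃ v ∈ V, v ∈ closure E := by
  obtain ⟨k, hk⟩ := h.edge_surj E hE
  exact ⟨_, h.vertex k, h.mem_closure_left hE hk⟩

lemma exists_edge_mem_closure (h : PolygonTiling n ψ V 𝓔) {v : OnePoint ℂ} (hv : v ∈ V) :
    ∃ E ∈ 𝓔, v ∈ closure E := by
  obtain ⟨k, rfl⟩ := h.vertex_surj v hv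
  obtain ⟨E, hE, hk⟩ := h.edge k
  exact ⟨E, hE, h.mem_closure_left hE hk⟩

end PolygonTiling

section Legs

variable {X Y : Type*} [TopologicalSpace X] [TopologicalSpace Y]

/-- A path which starts at `x` and does not return to `x`. -/
structure IsLeg (γ : ℝ → X) (x : X) : Prop where
  cont : ContinuousOn γ (Icc 0 1)
  zero : γ 0 = x
  ne : ∀ t ∈ Ioc (0 : ℝ) 1, γ t ≠ x

lemma IsLeg.eventually_mem {γ : ℝ → X} {x : X} (h : IsLeg γ x) {N : Set X} (hN : N ∈ 𝓝 x) :
    ∀ᶠ δ in 𝓝[>] (0 : ℝ), δ ≤ 1 ∧ ∀ t ∈ Icc 0 δ, γ t ∈ N := by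
  have h1 := h.cont 0 ⟨le_rfl, zero_le_one⟩
  have h2 : γ ⁻¹' N ∈ 𝓝[≥] (0 : ℝ) := by
    rw [← nhdsWithin_Icc_eq_nhdsGE one_pos]
    exact h1 (by rwa [h.zero])
  obtain ⟨u, hu, hsub⟩ := mem_nhdsGE_iff_exists_Ico_subset.mp h2
  filter_upwards [Ioo_mem_nhdsGT (lt_min hu one_pos)] with δ hδ
  exact ⟨(hδ.2.trans_le (min_le_right _ _)).le, fun t ht =>
    hsub ⟨ht.1, ht.2.trans_lt (hδ.2.trans_le (min_le_left _ _))⟩⟩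

/-- Two continuous functions that leave a common value upwards share a later value, by the
intermediate value theorem. -/
lemma exists_eq_of_lt {g₁ g₂ : ℝ → ℝ} {δ : ℝ} (hδ : 0 < δ) (h₁ : ContinuousOn g₁ (Icc 0 δ))
    (h₂ : ContinuousOn g₂ (Icc 0 δ)) (h0 : g₁ 0 = g₂ 0) (hl₁ : g₁ 0 < g₁ δ) (hl₂ : g₁ 0 < g₂ δ) :
    ∃ s ∈ Ioc 0 δ, ∃ t ∈ Ioc 0 δ, g₁ s = g₂ t := by
  have hm : g₁ 0 < min (g₁ δ) (g₂ δ) := lt_min hl₁ hl₂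
  obtain ⟨s, hs, hs'⟩ := intermediate_value_Icc hδ.le h₁ ⟨hm.le, min_le_left _ _⟩
  obtain ⟨t, ht, ht'⟩ := intermediate_value_Icc hδ.le h₂ ⟨h0 ▸ hm.le, min_le_right _ _⟩
  have hs0 : s ≠ 0 := by rintro rfl; exact hm.ne hs'
  have ht0 : t ≠ 0 := by rintro rfl; exact hm.ne (h0.trans ht')
  exact ⟨s, ⟨hs.1.lt_of_ne hs0.symm, hs.2⟩, t, ⟨ht.1.lt_of_ne ht0.symm, ht.2⟩, hs'.trans ht'.symm⟩

/-- If two disjoint legs are mapped locally injectively into an arc, with coordinate `G`, then the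
images lie on different sides. -/
lemma eventually_opposite {f : X → Y} (hf : Continuous f) {x : X} {N : Set X} (hN : N ∈ 𝓝 x)
    (hinj : InjOn f N) {L : Set Y} {G : Y → ℝ} (hG : ContinuousOn G L) (hGi : InjOn G L)
    {γ₁ γ₂ : ℝ → X} (h₁ : IsLeg γ₁ x) (h₂ : IsLeg γ₂ x)
    (hd : ∀ s ∈ Ioc (0 : ℝ) 1, ∀ t ∈ Ioc (0 : ℝ) 1, γ₁ s ≠ γ₂ t)
    {O : Set Y} (hO : O ∈ 𝓝 (f x)) (hL₁ : ∀ t ∈ Icc (0 : ℝ) 1, f (γ₁ t) ∈ O → f (γ₁ t) ∈ L)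
    (hL₂ : ∀ t ∈ Icc (0 : ℝ) 1, f (γ₂ t) ∈ O → f (γ₂ t) ∈ L) :
    ∀ᶠ δ in 𝓝[>] (0 : ℝ), (∀ t ∈ Icc 0 δ, f (γ₁ t) ∈ L ∧ f (γ₂ t) ∈ L) ∧
      ContinuousOn (fun t => G (f (γ₁ t))) (Icc 0 δ) ∧
      ContinuousOn (fun t => G (f (γ₂ t))) (Icc 0 δ) ∧
      ((G (f (γ₁ δ)) < G (f x) ∧ G (f x) < G (f (γ₂ δ))) ∨
        (G (f (γ₂ δ)) < G (f x) ∧ G (f x) < G (f (γ₁ δ)))) := by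
  have hN' : N ∩ f ⁻¹' O ∈ 𝓝 x := inter_mem hN (hf.continuousAt hO)
  filter_upwards [h₁.eventually_mem hN', h₂.eventually_mem hN', self_mem_nhdsWithin]
    with δ ⟨hδ1, hm₁⟩ ⟨_, hm₂⟩ hδ
  have hδ : 0 < δ := hδ
  have hsub : Icc 0 δ ⊆ Icc (0 : ℝ) 1 := Icc_subset_Icc_right hδ1
  have hl₁ : ∀ t ∈ Icc 0 δ, f (γ₁ t) ∈ L := fun t ht => hL₁ t (hsub ht) (hm₁ t ht).2
  have hl₂ : ∀ t ∈ Icc 0 δ, f (γ₂ t) ∈ L := fun t ht => hL₂ t (hsub ht) (hm₂ t ht).2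
  have hc₁ : ContinuousOn (fun t => G (f (γ₁ t))) (Icc 0 δ) :=
    hG.comp (hf.comp_continuousOn (h₁.cont.mono hsub)) hl₁
  have hc₂ : ContinuousOn (fun t => G (f (γ₂ t))) (Icc 0 δ) :=
    hG.comp (hf.comp_continuousOn (h₂.cont.mono hsub)) hl₂
  refine ⟨fun t ht => ⟨hl₁ t ht, hl₂ t ht⟩, hc₁, hc₂, ?_⟩
  have h0 : (0 : ℝ) ∈ Icc 0 δ := ⟨le_rfl, hδ.le⟩
  have hδm : δ ∈ Icc 0 δ := ⟨hδ.le, le_rfl⟩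
  have hx : f x ∈ L := by have := hl₁ 0 h0; rwa [h₁.zero] at this
  have hxN : x ∈ N := mem_of_mem_nhds hN
  have hne₁ : G (f (γ₁ δ)) ≠ G (f x) := fun he =>
    h₁.ne δ ⟨hδ, hδ1⟩ (hinj (hm₁ δ hδm).1 hxN (hGi (hl₁ δ hδm) hx he))
  have hne₂ : G (f (γ₂ δ)) ≠ G (f x) := fun he =>
    h₂.ne δ ⟨hδ, hδ1⟩ (hinj (hm₂ δ hδm).1 hxN (hGi (hl₂ δ hδm) hx he))
  have hno : ∀ s ∈ Ioc 0 δ, ∀ t ∈ Ioc 0 δ, G (f (γ₁ s)) ≠ G (f (γ₂ t)) := by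
    intro s hs t ht he
    have hs' := Ioc_subset_Icc_self hs
    have ht' := Ioc_subset_Icc_self ht
    exact hd s ⟨hs.1, (hsub hs').2⟩ t ⟨ht.1, (hsub ht').2⟩
      (hinj (hm₁ s hs').1 (hm₂ t ht').1 (hGi (hl₁ s hs') (hl₂ t ht') he))
  -- On the same side of `f x`, the two image legs would share a point of the arc, against
  -- injectivity of `f` on `N` and disjointness of the legs.
  rcases lt_or_gt_of_ne hne₁ with h1 | h1 <;> rcases lt_or_gt_of_ne hne₂ with h2 | h2
  · exfalso
    obtain ⟨s, hs, t, ht, he⟩ := exists_eq_of_lt hδ hc₁.neg hc₂.neg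
      (by simp [h₁.zero, h₂.zero]) (by simpa [h₁.zero] using h1) (by simpa [h₁.zero] using h2)
    exact hno s hs t ht (neg_injective he)
  · exact Or.inl ⟨h1, h2⟩
  · exact Or.inr ⟨h2, h1⟩
  · exfalso
    obtain ⟨s, hs, t, ht, he⟩ := exists_eq_of_lt hδ hc₁ hc₂
      (by simp [h₁.zero, h₂.zero]) (by simpa [h₁.zero] using h1) (by simpa [h₁.zero] using h2)
    exact hno s hs t ht he

end Legs

lemma IsLattesMap.exists_injOn {f : OnePoint ℂ → OnePoint ℂ} (hf : IsLattesMap f) {x : OnePoint ℂ}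
    (hx : ¬ IsCriticalPoint f x) : ∃ N ∈ 𝓝 x, InjOn f N := by
  obtain ⟨e, hxe, he⟩ := hf.isLocalHomeomorphOn x hx
  exact ⟨e.source, e.open_source.mem_nhds hxe, he ▸ e.injOn⟩

/-! ## Construction of subdivision rules -/

namespace PolygonTiling

variable {n : ℕ} {ψ : ℂ → OnePoint ℂ} {V : Set (OnePoint ℂ)} {𝓔 : Set (Set (OnePoint ℂ))}

lemma exists_leg_of_mem_closure (h : PolygonTiling n ψ V 𝓔) {v : OnePoint ℂ} (hv : v ∈ V)
    {E : Set (OnePoint ℂ)} (hE : E ∈ 𝓔) (hvE : v ∈ closure E) :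
    ∃ γ, IsLeg γ v ∧ ∀ t ∈ Ioc (0 : ℝ) 1, γ t ∈ E := by
  obtain ⟨p, G, hp, hp1, hpE, -⟩ := h.exists_halfOpenArc hv hE hvE
  have hmem : ∀ t ∈ Ioc (0 : ℝ) 1, p (1 - t / 2) ∈ E := fun t ht =>
    hpE.mapsTo ⟨by linarith [ht.2], by linarith [ht.1]⟩
  refine ⟨fun t => p (1 - t / 2), ⟨by fun_prop, by simp [hp1], fun t ht he => ?_⟩, hmem⟩
  exact h.vertex_notMem hv hE (he ▸ hmem t ht)

lemma exists_legs_of_mem (h : PolygonTiling n ψ V 𝓔) {E : Set (OnePoint ℂ)} (hE : E ∈ 𝓔)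
    {x : OnePoint ℂ} (hx : x ∈ E) :
    ∃ γ₁ γ₂, IsLeg γ₁ x ∧ IsLeg γ₂ x ∧
      (∀ s ∈ Ioc (0 : ℝ) 1, ∀ t ∈ Ioc (0 : ℝ) 1, γ₁ s ≠ γ₂ t) ∧
      ∀ t ∈ Icc (0 : ℝ) 1, γ₁ t ∈ E ∧ γ₂ t ∈ E := by
  obtain ⟨v, hv, hvE⟩ := h.exists_vertex_mem_closure hE
  obtain ⟨p, G, hp, -, hpE, -⟩ := h.exists_halfOpenArc hv hE hvE
  obtain ⟨t₀, ht₀, rfl⟩ := hpE.surjOn hx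
  obtain ⟨h0, h1⟩ := ht₀
  have hm₁ : ∀ t ∈ Icc (0 : ℝ) 1, t₀ - t * (t₀ / 2) ∈ Ioo (0 : ℝ) 1 := fun t ht =>
    ⟨by nlinarith [ht.1, ht.2], by nlinarith [ht.1, ht.2]⟩
  have hm₂ : ∀ t ∈ Icc (0 : ℝ) 1, t₀ + t * ((1 - t₀) / 2) ∈ Ioo (0 : ℝ) 1 := fun t ht =>
    ⟨by nlinarith [ht.1, ht.2], by nlinarith [ht.1, ht.2]⟩
  refine ⟨fun t => p (t₀ - t * (t₀ / 2)), fun t => p (t₀ + t * ((1 - t₀) / 2)),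
    ⟨by fun_prop, by simp, ?_⟩, ⟨by fun_prop, by simp, ?_⟩, ?_, ?_⟩
  · intro t ht he
    have := hpE.injOn (hm₁ t (Ioc_subset_Icc_self ht)) ⟨h0, h1⟩ he
    nlinarith [ht.1]
  · intro t ht he
    have := hpE.injOn (hm₂ t (Ioc_subset_Icc_self ht)) ⟨h0, h1⟩ he
    nlinarith [ht.1]
  · intro s hs t ht he
    have := hpE.injOn (hm₁ s (Ioc_subset_Icc_self hs)) (hm₂ t (Ioc_subset_Icc_self ht)) he
    nlinarith [hs.1, ht.1]
  · exact fun t ht => ⟨hpE.mapsTo (hm₁ t ht), hpE.mapsTo (hm₂ t ht)⟩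

lemma exists_coordinate (h : PolygonTiling n ψ V 𝓔) {E : Set (OnePoint ℂ)} (hE : E ∈ 𝓔) :
    ∃ G : OnePoint ℂ → ℝ, ContinuousOn G E ∧ InjOn G E := by
  obtain ⟨v, hv, hvE⟩ := h.exists_vertex_mem_closure hE
  obtain ⟨p, G, -, -, -, hpL, hG, hGl⟩ := h.exists_halfOpenArc hv hE hvE
  refine ⟨G, hG.mono (subset_insert _ _), InjOn.mono (subset_insert v E) ?_⟩
  rw [← hpL.image_eq]
  exact LeftInvOn.injOn (f := G) (f₁' := p) (by
    rintro _ ⟨t, ht, rfl⟩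
    rw [hGl ht])

/-- The two legs at `x` inside `F` are carried to opposite sides of `f x`, so their images fill a
neighbourhood of `f x` in `E`. A point near `x` with value in that neighbourhood is on a leg, by
local injectivity. -/
lemma eventually_mem_edge (h : PolygonTiling n ψ V 𝓔) {f : OnePoint ℂ → OnePoint ℂ}
    (hf : Continuous f) (hT : MapsTo f (skeletonSet V 𝓔) (skeletonSet V 𝓔))
    {E F : Set (OnePoint ℂ)} (hE : E ∈ 𝓔) (hF : F ∈ 𝓔) {x : OnePoint ℂ} (hx : x ∈ F)
    (hfx : f x ∈ E) {N : Set (OnePoint ℂ)} (hN : N ∈ 𝓝 x) (hinj : InjOn f N) :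
    ∀ᶠ a in 𝓝 x, f a ∈ E → a ∈ F := by
  obtain ⟨G, hG, hGi⟩ := h.exists_coordinate hE
  obtain ⟨γ₁, γ₂, h₁, h₂, hd, hγ⟩ := h.exists_legs_of_mem hF hx
  have hO : (skeletonSet V 𝓔 \ E)ᶜ ∈ 𝓝 (f x) :=
    (h.isClosed_skeletonSet_diff hE).isOpen_compl.mem_nhds fun h' => h'.2 hfx
  have hL : ∀ y ∈ F, f y ∈ (skeletonSet V 𝓔 \ E)ᶜ → f y ∈ E := by
    intro y hy hy'
    by_contra hyE
    exact hy' ⟨hT (Or.inr ⟨F, hF, hy⟩), hyE⟩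
  have hev := eventually_opposite hf hN hinj hG hGi h₁ h₂ hd hO
    (fun t ht => hL _ (hγ t ht).1) (fun t ht => hL _ (hγ t ht).2)
  obtain ⟨δ, ⟨hδL, hc₁, hc₂, hopp⟩, ⟨hδ1, hm₁⟩, ⟨-, hm₂⟩, hδ⟩ :=
    (hev.and ((h₁.eventually_mem hN).and ((h₂.eventually_mem hN).and
      self_mem_nhdsWithin))).exists
  have hδ : 0 < δ := hδ
  have hconn : ∀ y ∈ E, G y ∈ uIcc (G (f (γ₁ δ))) (G (f (γ₂ δ))) →
      ∃ z ∈ N, z ∈ F ∧ f z = y := by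
    intro y hy hyI
    have hsub : Icc 0 δ ⊆ Icc (0 : ℝ) 1 := Icc_subset_Icc_right hδ1
    have h01 : uIcc 0 δ = Icc 0 δ := uIcc_of_le hδ.le
    have hcov : G y ∈ uIcc (G (f (γ₁ 0))) (G (f (γ₁ δ))) ∨
        G y ∈ uIcc (G (f (γ₂ 0))) (G (f (γ₂ δ))) := by
      rw [h₁.zero, h₂.zero]
      simp only [mem_uIcc] at hyI ⊢
      rcases le_total (G y) (G (f x)) with h' | h' <;> grind
    rcases hcov with h' | h'
    · obtain ⟨t, ht, hty⟩ := intermediate_value_uIcc (f := fun t => G (f (γ₁ t))) (h01 ▸ hc₁) h'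
      rw [h01] at ht
      exact ⟨_, hm₁ t ht, (hγ t (hsub ht)).1, hGi (hδL t ht).1 hy hty⟩
    · obtain ⟨t, ht, hty⟩ := intermediate_value_uIcc (f := fun t => G (f (γ₂ t))) (h01 ▸ hc₂) h'
      rw [h01] at ht
      exact ⟨_, hm₂ t ht, (hγ t (hsub ht)).2, hGi (hδL t ht).2 hy hty⟩
  have hI : uIcc (G (f (γ₁ δ))) (G (f (γ₂ δ))) ∈ 𝓝 (G (f x)) := by
    rcases hopp with ⟨h1, h2⟩ | ⟨h1, h2⟩
    · rw [uIcc_of_le (h1.trans h2).le]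
      exact Icc_mem_nhds h1 h2
    · rw [uIcc_of_ge (h1.trans h2).le]
      exact Icc_mem_nhds h1 h2
  have hev2 : ∀ᶠ y in 𝓝 (f x), y ∈ E → G y ∈ uIcc (G (f (γ₁ δ))) (G (f (γ₂ δ))) :=
    eventually_nhdsWithin_iff.mp (hG (f x) hfx hI)
  filter_upwards [hN, hf.continuousAt.eventually hev2] with a haN ha hfa
  obtain ⟨z, hzN, hzF, hza⟩ := hconn _ hfa (ha hfa)
  exact hinj hzN haN hza ▸ hzF

end PolygonTiling

/-- The lifted complex serves as the subdivision. What needs proof is that it refines `K`: along an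
open cell of `K'`, membership in a given cell of `K` is locally constant, and the cell is connected.
-/
theorem IsLattesMap.exists_rule {f : OnePoint ℂ → OnePoint ℂ} (hf : IsLattesMap f)
    {K : Topology.CWComplex (univ : Set (OnePoint ℂ))} (hK : IsOneTile K)
    (hP : postcriticalSet f ⊆ vertexSet K) (hV : MapsTo f (vertexSet K) (vertexSet K))
    (hT : MapsTo f (skeletonSet (vertexSet K) (edgeSets K))
      (skeletonSet (vertexSet K) (edgeSets K))) :
    ∃ R : FiniteSubdivisionRule (OnePoint ℂ), R.complex = K ∧ R.map = f := by
  obtain ⟨K', hK', hcell⟩ := exists_liftedComplex hf.continuous hf.isCoveringMapOn hf.finite_fiber K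
    hK.finite hP
  obtain ⟨n₀, ψ, h⟩ := hK.exists_polygonTiling
  have hsub : Subsingleton (Cell K 2) := (Nat.card_eq_one_iff_unique.mp hK.card).1
  refine ⟨⟨K, hK.finite, hK.pure, hK.hasTileType, K', hK', fun n c => ?_, f, hf.continuous,
    fun n c => (hcell n c).2⟩, rfl, rfl⟩
  obtain ⟨hconn, d, hd⟩ := hcell n c
  have hfd : ∀ a ∈ openCell K' n c, f a ∈ openCell K n d := fun a ha => hd.2 ▸ mem_image_of_mem f ha
  have hlocal : ∀ x ∈ openCell K' n c, ∀ m (e : Cell K m), x ∈ openCell K m e →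
      ∀ᶠ y in 𝓝[openCell K' n c] x, y ∈ openCell K m e := by
    intro x hx m e hxe
    obtain ⟨m', hm', e', hxe'⟩ := exists_mem_openCell_le K hK.finite x
    obtain rfl := dim_eq_of_mem_openCell K hxe' hxe
    rcases n with _ | n
    · rw [openCell_zero] at hx ⊢
      rw [mem_singleton_iff] at hx
      rw [← hx, nhdsWithin_singleton]
      exact hxe
    -- A cell of `K'` of positive dimension is mapped off the vertices; by `hV` it contains no
    -- vertex of `K`.
    · have hxV : m' ≠ 0 := by
        rintro rfl
        have : f x ∈ vertexSet K := hV ⟨e, by rw [openCell_zero] at hxe; exact hxe.symm⟩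
        obtain ⟨v, hv⟩ := this
        have h1 := dim_eq_of_mem_openCell K (hfd x hx) (d := v) (by rw [openCell_zero]; exact hv.symm)
        omega
      obtain rfl | rfl : m' = 1 ∨ m' = 2 := by omega
      · have hfT : f x ∈ skeletonSet (vertexSet K) (edgeSets K) :=
          hT (Or.inr ⟨_, ⟨e, rfl⟩, hxe⟩)
        obtain rfl : n = 0 := by
          have := (mem_skeletonSet_iff K (hfd x hx)).mp hfT
          omega
        have hcrit : ¬ IsCriticalPoint f x := by
          intro hc
          obtain ⟨v, hv⟩ := hP (IsLattesMap.apply_mem_postcriticalSet hc)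
          have h1 := dim_eq_of_mem_openCell K (hfd x hx) (d := v)
            (by rw [openCell_zero]; exact hv.symm)
          omega
        obtain ⟨N, hN, hinj⟩ := hf.exists_injOn hcrit
        have := h.eventually_mem_edge hf.continuous hT ⟨d, rfl⟩ ⟨e, rfl⟩ hxe (hfd x hx) hN hinj
        filter_upwards [nhdsWithin_le_nhds this, self_mem_nhdsWithin] with a ha haA
        exact ha (hfd a haA)
      -- The complement of the skeleton is open, and it consists of the single open 2-cell.
      · have hxT : x ∈ (skeletonSet (vertexSet K) (edgeSets K))ᶜ := by
          intro hxT
          have := (mem_skeletonSet_iff K hxe).mp hxT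
          omega
        filter_upwards [nhdsWithin_le_nhds
          (h.isCompact_skeletonSet.isClosed.isOpen_compl.mem_nhds hxT)] with a ha
        obtain ⟨m, hm, e'', hae⟩ := exists_mem_openCell_le K hK.finite a
        have hm2 : m = 2 := by
          have := mt (mem_skeletonSet_iff K hae).mpr ha
          omega
        subst hm2
        rwa [Subsingleton.elim e e'']
  obtain ⟨x, hx⟩ := openCell_nonempty K' c
  obtain ⟨m, e, hxe⟩ := exists_mem_openCell K x
  refine ⟨m, e, fun y hy => ?_⟩
  have := hconn.induction₂ (fun x y => ∀ m (e : Cell K m), x ∈ openCell K m e → y ∈ openCell K m e)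
    ?_ ?_ ?_ hx hy
  · exact this m e hxe
  · intro x hx
    obtain ⟨m, e, hxe⟩ := exists_mem_openCell K x
    filter_upwards [hlocal x hx m e hxe] with y hy m' e' hxe'
    have := eq_of_mem_openCell K hxe hxe'
    cases this
    exact hy
  · exact fun a b c _ _ _ hab hbc m e ha => hbc m e (hab m e ha)
  · intro a b _ _ hab m e hb
    obtain ⟨m', e', ha⟩ := exists_mem_openCell K a
    have := eq_of_mem_openCell K hb (hab m' e' ha)
    cases this
    exact ha

/-! ## Pruning -/

/-- A compact set such that two disjoint legs in the set start at each of its points outside `P`. -/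
structure IsTight {X : Type*} [TopologicalSpace X] (P H : Set X) : Prop where
  isCompact : IsCompact H
  exists_legs : ∀ x ∈ H, x ∉ P → ∃ γ₁ γ₂, IsLeg γ₁ x ∧ IsLeg γ₂ x ∧
    (∀ s ∈ Ioc (0 : ℝ) 1, ∀ t ∈ Ioc (0 : ℝ) 1, γ₁ s ≠ γ₂ t) ∧
    ∀ t ∈ Icc (0 : ℝ) 1, γ₁ t ∈ H ∧ γ₂ t ∈ H

lemma IsLeg.mapsTo {X : Type*} [TopologicalSpace X] {γ : ℝ → X} {x : X} (hγ : IsLeg γ x)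
    {H : Set X} (hx : x ∈ H) (h : ∀ t ∈ Ioc (0 : ℝ) 1, γ t ∈ H) : ∀ t ∈ Icc (0 : ℝ) 1, γ t ∈ H := by
  intro t ht
  rcases ht.1.eq_or_lt with rfl | h0
  · rwa [hγ.zero]
  · exact h t ⟨h0, ht.2⟩

namespace PolygonTiling

variable {n n' : ℕ} {ψ ψ' : ℂ → OnePoint ℂ} {V : Set (OnePoint ℂ)}
  {𝓔 : Set (Set (OnePoint ℂ))} {f : OnePoint ℂ → OnePoint ℂ}

/-- The image of a tight set does not enter an edge that ends in a vertex of valence one. -/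
lemma image_subset_of_leaf (h : PolygonTiling n ψ V 𝓔) (hf : IsLattesMap f)
    (hP : postcriticalSet f ⊆ V) {v : OnePoint ℂ} (hv : v ∈ V) (hvP : v ∉ postcriticalSet f)
    {E : Set (OnePoint ℂ)} (hE : E ∈ 𝓔) (hvE : v ∈ closure E)
    (h' : PolygonTiling n' ψ' (V \ {v}) (𝓔 \ {E})) {H : Set (OnePoint ℂ)}
    (hH : IsTight (postcriticalSet f) H) (hfH : MapsTo f H (skeletonSet V 𝓔)) :
    MapsTo f H (skeletonSet (V \ {v}) (𝓔 \ {E})) := by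
  have hsplit : ∀ y ∈ skeletonSet V 𝓔, y ∉ skeletonSet (V \ {v}) (𝓔 \ {E}) → y ∈ insert v E := by
    rintro y (hy | ⟨F, hF, hy⟩) hy'
    · by_contra hne
      exact hy' (Or.inl ⟨hy, fun hyv => hne (Or.inl hyv)⟩)
    · by_contra hne
      exact hy' (Or.inr ⟨F, ⟨hF, fun hFE => hne (Or.inr (hFE ▸ hy))⟩, hy⟩)
  have hdisj : ∀ y ∈ insert v E, y ∉ skeletonSet (V \ {v}) (𝓔 \ {E}) := by
    rintro y (rfl | hy) (hy' | ⟨F, hF, hy'⟩)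
    · exact hy'.2 rfl
    · exact h.vertex_notMem hv hF.1 hy'
    · exact h.vertex_notMem hy'.1 hE hy
    · exact hF.2 (h.edge_eq hF.1 hE hy' hy)
  have hvLP : ∀ y ∈ insert v E, y ∉ postcriticalSet f := by
    rintro y (rfl | hy) hyP
    · exact hvP hyP
    · exact h.vertex_notMem (hP hyP) hE hy
  obtain ⟨p, G, hp, hp1, -, hpL, hG, hGl⟩ := h.exists_halfOpenArc hv hE hvE
  have hGi : InjOn G (insert v E) := by
    rw [← hpL.image_eq]
    exact LeftInvOn.injOn (f := G) (f₁' := p) (by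
      rintro _ ⟨t, ht, rfl⟩
      rw [hGl ht])
  intro x hx
  by_contra hxT
  obtain ⟨t₀, ht₀, ht₀x⟩ := hpL.surjOn (hsplit _ (hfH hx) hxT)
  have hfHc : IsClosed (f '' H) := (hH.isCompact.image hf.continuous).isClosed
  have hSc : IsCompact (Icc t₀ 1 ∩ p ⁻¹' (f '' H)) :=
    isCompact_Icc.inter_right (hfHc.preimage hp)
  -- The vertex `v` is at parameter `1`, so `t₁` marks the point of `f '' H` on the leaf that is
  -- closest to the tip.
  obtain ⟨t₁, ⟨ht₁, z, hz, hzt⟩, hmax⟩ := hSc.exists_isMaxOn (f := id)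
    ⟨t₀, ⟨le_rfl, ht₀.2⟩, x, hx, ht₀x.symm⟩ continuousOn_id
  have ht₁' : t₁ ∈ Ioc (0 : ℝ) 1 := ⟨ht₀.1.trans_le ht₁.1, ht₁.2⟩
  have hfz : f z ∈ insert v E := hzt ▸ hpL.mapsTo ht₁'
  -- The half-open leaf avoids the forward invariant set `P`, so `z` is neither postcritical nor
  -- critical: it has two legs in `H` and `f` is injective near it.
  have hzP : z ∉ postcriticalSet f := fun hzP =>
    hvLP _ hfz (IsLattesMap.mapsTo_postcriticalSet hzP)
  have hcrit : ¬ IsCriticalPoint f z := fun hc =>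
    hvLP _ hfz (IsLattesMap.apply_mem_postcriticalSet hc)
  obtain ⟨N, hN, hinj⟩ := hf.exists_injOn hcrit
  obtain ⟨γ₁, γ₂, h₁, h₂, hd, hγ⟩ := hH.exists_legs z hz hzP
  have hO : (skeletonSet (V \ {v}) (𝓔 \ {E}))ᶜ ∈ 𝓝 (f z) :=
    h'.isCompact_skeletonSet.isClosed.isOpen_compl.mem_nhds (hdisj _ hfz)
  have hle : ∀ y ∈ H, f y ∈ insert v E → G (f y) ≤ G (f z) := by
    intro y hy hfy
    obtain ⟨t, ht, hty⟩ := hpL.surjOn hfy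
    rw [← hty, hGl ht, hzt, hGl ht₁']
    by_contra hlt
    push Not at hlt
    exact hlt.not_ge (hmax ⟨⟨ht₁.1.trans hlt.le, ht.2⟩, y, hy, hty.symm⟩)
  obtain ⟨δ, ⟨hδL, -, -, hopp⟩, hδ1, hδ⟩ :=
    ((eventually_opposite hf.continuous hN hinj hG hGi h₁ h₂ hd hO
      (fun t ht hO => hsplit _ (hfH (hγ t ht).1) hO)
      (fun t ht hO => hsplit _ (hfH (hγ t ht).2) hO)).and
      (((h₁.eventually_mem univ_mem).mono fun _ h => h.1).and self_mem_nhdsWithin)).exists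
  have hδ : 0 < δ := hδ
  have hm := hδL δ ⟨hδ.le, le_rfl⟩
  have hmH := hγ δ ⟨hδ.le, hδ1⟩
  -- Whichever leg moves towards the tip contradicts the maximality of `t₁`.
  rcases hopp with ⟨-, h2⟩ | ⟨-, h2⟩
  · exact h2.not_ge (hle _ hmH.2 hm.2)
  · exact h2.not_ge (hle _ hmH.1 hm.1)

lemma skeletonSet_merge {E₁ E₂ : Set (OnePoint ℂ)} {v : OnePoint ℂ} (hv : v ∈ V) (hE₁ : E₁ ∈ 𝓔)
    (hE₂ : E₂ ∈ 𝓔) :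
    skeletonSet (V \ {v}) (insert (E₁ ∪ {v} ∪ E₂) (𝓔 \ {E₁, E₂})) = skeletonSet V 𝓔 := by
  refine subset_antisymm ?_ ?_
  · rintro x (hx | ⟨F, rfl | hF, hx⟩)
    · exact Or.inl hx.1
    · rcases hx with (hx | rfl) | hx
      · exact Or.inr ⟨E₁, hE₁, hx⟩
      · exact Or.inl hv
      · exact Or.inr ⟨E₂, hE₂, hx⟩
    · exact Or.inr ⟨F, hF.1, hx⟩
  · have hnew : ∀ x ∈ E₁ ∪ {v} ∪ E₂,
        x ∈ skeletonSet (V \ {v}) (insert (E₁ ∪ {v} ∪ E₂) (𝓔 \ {E₁, E₂})) :=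
      fun x hx => Or.inr ⟨_, Or.inl rfl, hx⟩
    rintro x (hx | ⟨F, hF, hx⟩)
    · by_cases hxv : x = v
      · exact hnew x (Or.inl (Or.inr hxv))
      · exact Or.inl ⟨hx, hxv⟩
    · by_cases h1 : F = E₁
      · exact hnew x (Or.inl (Or.inl (h1 ▸ hx)))
      · by_cases h2 : F = E₂
        · exact hnew x (Or.inr (h2 ▸ hx))
        · exact Or.inr ⟨F, Or.inr ⟨hF, by simp [h1, h2]⟩, hx⟩

/-- If each vertex outside `P` lies on two edges, the 1-skeleton is tight. -/
lemma isTight (h : PolygonTiling n ψ V 𝓔) {P : Set (OnePoint ℂ)}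
    (hval : ∀ v ∈ V, v ∉ P → ∃ E ∈ 𝓔, ∃ F ∈ 𝓔, E ≠ F ∧ v ∈ closure E ∧ v ∈ closure F) :
    IsTight P (skeletonSet V 𝓔) := by
  refine ⟨h.isCompact_skeletonSet, ?_⟩
  rintro x (hx | ⟨E, hE, hx⟩) hxP
  · obtain ⟨E, hE, F, hF, hne, hxE, hxF⟩ := hval x hx hxP
    obtain ⟨γ₁, h₁, hm₁⟩ := h.exists_leg_of_mem_closure hx hE hxE
    obtain ⟨γ₂, h₂, hm₂⟩ := h.exists_leg_of_mem_closure hx hF hxF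
    refine ⟨γ₁, γ₂, h₁, h₂, fun s hs t ht he => ?_, fun t ht => ⟨?_, ?_⟩⟩
    · exact hne (h.edge_eq hE hF (hm₁ s hs) (he ▸ hm₂ t ht))
    · exact h₁.mapsTo (H := skeletonSet V 𝓔) (Or.inl hx) (fun t ht => Or.inr ⟨E, hE, hm₁ t ht⟩) t ht
    · exact h₂.mapsTo (H := skeletonSet V 𝓔) (Or.inl hx) (fun t ht => Or.inr ⟨F, hF, hm₂ t ht⟩) t ht
  · obtain ⟨γ₁, γ₂, h₁, h₂, hd, hm⟩ := h.exists_legs_of_mem hE hx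
    exact ⟨γ₁, γ₂, h₁, h₂, hd, fun t ht => ⟨Or.inr ⟨E, hE, (hm t ht).1⟩, Or.inr ⟨E, hE, (hm t ht).2⟩⟩⟩

/-- A vertex with three edges is not mapped into an edge. -/
lemma apply_mem_of_three_edges (h : PolygonTiling n ψ V 𝓔) (hf : IsLattesMap f)
    (hP : postcriticalSet f ⊆ V) (hT : MapsTo f (skeletonSet V 𝓔) (skeletonSet V 𝓔))
    {v : OnePoint ℂ} (hv : v ∈ V) {E : Fin 3 → Set (OnePoint ℂ)} (hE : ∀ i, E i ∈ 𝓔)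
    (hinjE : Function.Injective E) (hvE : ∀ i, v ∈ closure (E i)) : f v ∈ V := by
  by_cases hcrit : IsCriticalPoint f v
  · exact hP (IsLattesMap.apply_mem_postcriticalSet hcrit)
  by_contra hfv
  obtain ⟨F, hF, hfF⟩ : ∃ F ∈ 𝓔, f v ∈ F := by
    rcases hT (Or.inl hv) with h' | h'
    · exact absurd h' hfv
    · exact h'
  obtain ⟨N, hN, hinj⟩ := hf.exists_injOn hcrit
  obtain ⟨G, hG, hGi⟩ := h.exists_coordinate hF
  have hO : (skeletonSet V 𝓔 \ F)ᶜ ∈ 𝓝 (f v) :=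
    (h.isClosed_skeletonSet_diff hF).isOpen_compl.mem_nhds fun h' => h'.2 hfF
  choose γ hγ hm using fun i => h.exists_leg_of_mem_closure hv (hE i) (hvE i)
  have hL : ∀ i, ∀ t ∈ Icc (0 : ℝ) 1, f (γ i t) ∈ (skeletonSet V 𝓔 \ F)ᶜ → f (γ i t) ∈ F := by
    intro i t ht hy
    by_contra hyF
    exact hy ⟨hT ((hγ i).mapsTo (H := skeletonSet V 𝓔) (Or.inl hv)
      (fun t ht => Or.inr ⟨E i, hE i, hm i t ht⟩) t ht), hyF⟩
  have hopp : ∀ i j, i ≠ j → _ := fun i j hij =>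
    eventually_opposite hf.continuous hN hinj hG hGi (hγ i) (hγ j)
      (fun s hs t ht he => hij (hinjE (h.edge_eq (hE i) (hE j) (hm i s hs) (he ▸ hm j t ht)))) hO
      (hL i) (hL j)
  obtain ⟨δ, ⟨-, -, -, h01⟩, ⟨-, -, -, h02⟩, -, -, -, h12⟩ :=
    ((hopp 0 1 (by decide)).and ((hopp 0 2 (by decide)).and (hopp 1 2 (by decide)))).exists
  -- An arc has only two sides at a point, so three legs cannot be pairwise opposite.
  rcases h01 with ⟨_, _⟩ | ⟨_, _⟩ <;> rcases h02 with ⟨_, _⟩ | ⟨_, _⟩ <;>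
    rcases h12 with ⟨_, _⟩ | ⟨_, _⟩ <;> linarith

end PolygonTiling

/-- Passes from the topological condition that `v` is in the closure of an edge, used during
pruning, to incidence in the 1-skeleton. -/
lemma IsOneTile.three_le_valence {K : Topology.CWComplex (univ : Set (OnePoint ℂ))}
    (hK : IsOneTile K) (v : Cell K 0) {E : Fin 3 → Set (OnePoint ℂ)} (hE : ∀ i, E i ∈ edgeSets K)
    (hinjE : Function.Injective E) (hvE : ∀ i, vertexPoint K v ∈ closure (E i)) :
    3 ≤ valence K v := by
  obtain ⟨n, ψ, h⟩ := hK.exists_polygonTiling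
  have := hK.finite.1 1
  choose e he using hE
  have he : ∀ i, openCell K 1 (e i) = E i := he
  have hinc : ∀ i, (oneSkeleton K).Inc (e i) v := by
    intro i
    obtain ⟨k, hk⟩ := h.edge_surj (E i) ⟨e i, he i⟩
    have hk : SideOver n ψ k (openCell K 1 (e i)) := he i ▸ hk
    obtain ⟨w, hw⟩ := h.vertex k
    obtain ⟨w', hw'⟩ := h.vertex (k + 1)
    have hv := h.eq_or_eq_of_mem_closure ⟨e i, rfl⟩ hk ⟨v, rfl⟩ (he i ▸ hvE i)
    rcases hv with hv | hv
    · refine ⟨w', (isLink_iff_of_sideOver K h hk v w').mpr ?_⟩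
      rw [hw', ← hv]
    · refine ⟨w, (isLink_iff_of_sideOver K h hk v w).mpr ?_⟩
      rw [hw, ← hv, pair_comm]
  have hinj : Function.Injective e := fun i j hij => hinjE (by rw [← he, ← he, hij])
  have h3 : (range e).ncard = 3 := by
    rw [← image_univ, ncard_image_of_injective _ hinj]
    simp
  have hle : (range e).ncard ≤ {e | (oneSkeleton K).Inc e v}.ncard :=
    ncard_le_ncard (range_subset_iff.mpr hinc)
  exact h3 ▸ hle.trans (Nat.le_add_right _ _)

/-- Vertices of valence one and two outside the postcritical set can be removed. -/
theorem IsLattesMap.exists_pruned_tiling {f : OnePoint ℂ → OnePoint ℂ} (hf : IsLattesMap f)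
    {n : ℕ} {ψ : ℂ → OnePoint ℂ} {V : Set (OnePoint ℂ)} {𝓔 : Set (Set (OnePoint ℂ))}
    (h : PolygonTiling n ψ V 𝓔) (hP : postcriticalSet f ⊆ V)
    (hadm : ∀ H, IsTight (postcriticalSet f) H → H ⊆ skeletonSet V 𝓔 →
      MapsTo f H (skeletonSet V 𝓔)) :
    ∃ n' ψ' V' 𝓔', PolygonTiling n' ψ' V' 𝓔' ∧ postcriticalSet f ⊆ V' ∧
      (∀ H, IsTight (postcriticalSet f) H → H ⊆ skeletonSet V' 𝓔' →
        MapsTo f H (skeletonSet V' 𝓔')) ∧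
      ∀ v ∈ V', v ∉ postcriticalSet f → ∃ E : Fin 3 → Set (OnePoint ℂ), (∀ i, E i ∈ 𝓔') ∧
        Function.Injective E ∧ ∀ i, v ∈ closure (E i) := by
  -- Induction on the number of vertices. Intermediate skeletons are not known to be mapped into
  -- themselves; the hypothesis on their tight subsets is what each removal preserves.
  obtain ⟨m, hm⟩ : ∃ m, V.ncard = m := ⟨_, rfl⟩
  induction m using Nat.strong_induction_on generalizing n ψ V 𝓔 with
  | _ m ih =>
    by_cases hdone : ∀ v ∈ V, v ∉ postcriticalSet f → ∃ E : Fin 3 → Set (OnePoint ℂ),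
        (∀ i, E i ∈ 𝓔) ∧ Function.Injective E ∧ ∀ i, v ∈ closure (E i)
    · exact ⟨n, ψ, V, 𝓔, h, hP, hadm, hdone⟩
    push Not at hdone
    obtain ⟨v, hv, hvP, hno⟩ := hdone
    have hP' : postcriticalSet f ⊆ V \ {v} := fun x hx => ⟨hP hx, fun hxv => hvP (hxv ▸ hx)⟩
    have hcard : 3 ≤ (V \ {v}).ncard := by
      have := ncard_le_ncard hP' (h.finite_vertices.subset sdiff_subset)
      rw [hf.ncard_postcriticalSet] at this
      omega
    have hlt : (V \ {v}).ncard < m := hm ▸ ncard_sdiff_singleton_lt_of_mem hv h.finite_vertices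
    obtain ⟨E, hE, hvE⟩ := h.exists_edge_mem_closure hv
    by_cases hleaf : ∀ F ∈ 𝓔, v ∈ closure F → F = E
    · obtain ⟨n', ψ', h'⟩ := h.exists_removeLeaf hv hE hleaf hcard
      have hsub : skeletonSet (V \ {v}) (𝓔 \ {E}) ⊆ skeletonSet V 𝓔 :=
        union_subset_union sdiff_subset (sUnion_subset_sUnion sdiff_subset)
      exact ih _ hlt h' hP' (fun H hH hHT => h.image_subset_of_leaf hf hP hv hvP hE hvE h' hH
        (hadm H hH (hHT.trans hsub))) rfl
    · push Not at hleaf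
      obtain ⟨F, hF, hvF, hFE⟩ := hleaf
      have hval : ∀ D ∈ 𝓔, v ∈ closure D → D = E ∨ D = F := by
        intro D hD hvD
        by_contra hne
        push Not at hne
        -- A third edge at `v` would give the three distinct edges that `hno` rules out.
        obtain ⟨i, hi⟩ := hno ![E, F, D] (by intro i; fin_cases i <;> assumption) (by
          intro i j hij
          fin_cases i <;> fin_cases j <;> simp_all [eq_comm])
        fin_cases i <;> simp_all
      obtain ⟨n', ψ', h'⟩ := h.exists_merge hv hE hF hFE.symm hvE hvF hval hcard
      have hT := PolygonTiling.skeletonSet_merge hv hE hF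
      exact ih _ hlt h' hP' (by rw [hT]; exact hadm) rfl

/-- At the end of pruning, every vertex outside `P` has three edges. Two of them make the skeleton
tight, hence invariant; all three force vertices to go to vertices. -/
theorem IsLattesMap.exists_pruned_rule {f : OnePoint ℂ → OnePoint ℂ} (hf : IsLattesMap f)
    {R : FiniteSubdivisionRule (OnePoint ℂ)} (hR : R.HasOneTileType) (hRf : R.map = f) :
    ∃ R : FiniteSubdivisionRule (OnePoint ℂ), R.HasOneTileType ∧ R.map = f ∧
      R.IsPruned (postcriticalSet f) := by
  subst hRf
  obtain ⟨n, ψ, h⟩ := (R.isOneTile hR).exists_polygonTiling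
  obtain ⟨n', ψ', V, 𝓔, h', hP, hadm, hval⟩ := hf.exists_pruned_tiling h
    (R.postcriticalSet_subset_vertexSet hf) (fun H _ hH => R.mapsTo_skeletonSet.mono_left hH)
  have hT : MapsTo R.map (skeletonSet V 𝓔) (skeletonSet V 𝓔) := by
    refine hadm _ (h'.isTight fun v hv hvP => ?_) subset_rfl
    obtain ⟨E, hE, hinj, hvE⟩ := hval v hv hvP
    exact ⟨E 0, hE 0, E 1, hE 1, hinj.ne (by decide), hvE 0, hvE 1⟩
  have hV : MapsTo R.map V V := by
    intro v hv
    by_cases hvP : v ∈ postcriticalSet R.map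
    · exact hP (IsLattesMap.mapsTo_postcriticalSet hvP)
    · obtain ⟨E, hE, hinj, hvE⟩ := hval v hv hvP
      exact h'.apply_mem_of_three_edges hf hP hT hv hE hinj hvE
  obtain ⟨K, hK, rfl, rfl⟩ := h'.exists_isOneTile
  obtain ⟨R', rfl, hR'⟩ := hf.exists_rule hK hP hV hT
  refine ⟨R', hK.card, hR', fun v hv => ?_⟩
  by_contra hvP
  obtain ⟨E, hE, hinj, hvE⟩ := hval _ ⟨v, rfl⟩ hvP
  have := hK.three_le_valence v hE hinj hvE
  omega

end Lattes

end

theorem lemma2p1 (f : OnePoint ℂ → OnePoint ℂ) (hf : Lattes.IsLattesMap f) :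
    ((∃ R : Lattes.FiniteSubdivisionRule (OnePoint ℂ), R.HasOneTileType ∧ R.map = f) →
      ∃ R : Lattes.FiniteSubdivisionRule (OnePoint ℂ), R.HasOneTileType ∧ R.map = f ∧
        R.IsPruned (Lattes.postcriticalSet f)) ∧
    ∀ R : Lattes.FiniteSubdivisionRule (OnePoint ℂ), R.HasOneTileType → R.map = f →
      R.IsPruned (Lattes.postcriticalSet f) →
      Lattes.HasOneOfFiveForms R.complex (Lattes.postcriticalSet f) := by
  refine ⟨fun ⟨R, hR, hRf⟩ => hf.exists_pruned_rule hR hRf, ?_⟩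
  rintro R hR rfl hprune
  exact (R.isOneTile hR).hasOneOfFiveForms (R.postcriticalSet_subset_vertexSet hf)
    hf.ncard_postcriticalSet hprune
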